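/- Setting. Let $\mathbb{T}=\mathbb{R}/2\pi\mathbb{Z}$ with the normalized measure $\frac{dx}{2\pi}$ (all integrals over $\mathbb T$ and the $L^2(\mathbb{T})$ norm refer to it), $\langle n\rangle=(1+n^2)^{1/2}$, $\widehat u(n)$ the Fourier coefficients of $u$, and $H^{1/2-}(\mathbb{T})=\bigcap_{\sigma<1/2}H^\sigma(\mathbb{T})$ with the $\sigma$-algebra generated by the Fourier coefficients. Let $(g_n)_{n\in\mathbb{Z}}$ be i.i.d. complex Gaussians whose real and imaginary parts are independent and $N(0,\tfrac12)$, and let $\mu$ be the law on $H^{1/2-}(\mathbb{T})$ of $u=\sum_n \frac{g_n}{\langle n\rangle}e^{inx}$. For $N\ge 0$ put $u_N=P_{\le N}u=\sum_{|n|\le N}\widehat u(n)e^{inx}$ and $$f_N(u)=-\frac{3i}{4}\int_{\mathbb{T}}\overline{u_N}^{\,2}\,\partial_x\big(u_N^2\big)\,dx\in\mathbb{R}.$$ Let $A_m=\{u:\|u\|_{L^2}^2\le m\}$. For $k\ge 0$ let $P_k$ be the probability density of $\sum_{|n|\ne k}|\widehat u(n)|^2$ under $\mu$. For $s>0$ let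 $T_s^k$ multiply the Fourier coefficients at the frequencies $\pm k$ by $s$ and fix the others; for $s>1$ let $\Gamma^k_{m,s}=\{u:\|T^k_{1/s}u\|_{L^2}^2\le m<\|T^k_su\|_{L^2}^2\}$ and $\nu^k_{m,s}=\mu(\,\cdot\,|\,\Gamma^k_{m,s})$. The measure $\nu^k_m$ is the measure on $H^{1/2-}(\mathbb{T})$ with $\nu^k_m(E)=\lim_{s\to1^+}\nu^k_{m,s}(E)$ for every measurable $E$ that depends on finitely many Fourier coefficients only. For $q\ge 1$ call a number $m_q>0$ a mass threshold for the exponent $q$ if there is a constant $K$ such that for all $N\ge 0$ and all sets $Q_1,\dots,Q_4\subset\mathbb{Z}$ with $Q_i=-Q_i$, $$\int 1_{\|u\|_{L^2}^2<m_q}\,\exp\Big(q\,\mathrm{Re}\Big[-\frac{3i}{2}\int_{\mathbb{T}}\partial_x(P_{Q_1}u_N)\,P_{Q_2}u_N\,\overline{P_{Q_3}u_N}\,\overline{P_{Q_4}u_N}\,dx\Big]\Big)\,d\mu(u)\le K,$$ where $P_Qv=\sum_{n\in Q}\widehat v(n)e^{inx}$. (For $Q_1=\dots=Q_4=\mathbb{Z}$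 the exponent is $q f_N(u)$.) Theorem. Let $p\ge 1$. Mass thresholds $m_{480p}$ for the exponent $480p$ with $\frac12 m_{480p}<1$ exist. Fix any such $m_{480p}$. Then there is a constant $C(p)$, depending only on $p$ and on the chosen $m_{480p}$, such that for all $k,N\ge 0$ and all $0<m<\frac12 m_{480p}$ the measure $\nu^k_m$ exists and is unique, and $$\int_{H^{1/2-}(\mathbb{T})}e^{pf_N(u)}\,d\nu^k_m\le\frac{C(p)\,e^m\,\langle k\rangle^{19/20}}{\mu(A_m)\,m^2\int_{m/2}^m P_k\big(m-\frac{y}{\langle k\rangle^2}\big)\,dy}.$$ -/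

import Mathlib

open MeasureTheory ProbabilityTheory Filter Topology
open scoped ENNReal NNReal

noncomputable section

namespace FixedMass

instance twoPiPos : Fact (0 < 2 * Real.pi) := ⟨Real.two_pi_pos⟩

/-- `L²(𝕋)` for `𝕋 = ℝ / 2πℤ`, with respect to the Haar measure of total mass one. -/
abbrev L2T : Type := Lp ℂ 2 (AddCircle.haarAddCircle : Measure (AddCircle (2 * Real.pi)))

/-- The Japanese bracket `⟨n⟩ = (1 + n²)^{1/2}`. -/
def bracket (n : ℤ) : ℝ := Real.sqrt (1 + (n : ℝ) ^ 2)

/-- `H^{1/2-}(𝕋) = ⋂_{σ < 1/2} H^σ(𝕋)`, as a space of functions in `L²(𝕋)`. -/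
def HalfMinus : Type :=
  {u : L2T // ∀ σ : ℝ, σ < 1 / 2 →
    Summable fun n : ℤ => bracket n ^ (2 * σ) * ‖fourierCoeff u n‖ ^ 2}

/-- The Fourier coefficient `û(n)`. -/
def coeff (u : HalfMinus) (n : ℤ) : ℂ := fourierCoeff u.1 n

/-- The `σ`-algebra generated by the Fourier coefficients. -/
instance : MeasurableSpace HalfMinus := MeasurableSpace.comap coeff MeasurableSpace.pi

/-- The law of a complex Gaussian `a + ib` with `a`, `b` independent and `N(0, 1/2)`. -/
def complexGaussian : Measure ℂ :=
  ((gaussianReal 0 (1 / 2)).prod (gaussianReal 0 (1 / 2))).map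
    Complex.measurableEquivRealProd.symm

instance : IsProbabilityMeasure complexGaussian :=
  Measure.isProbabilityMeasure_map (Complex.measurableEquivRealProd.symm.measurable.aemeasurable)

/-- The law `ℙ` of an i.i.d. family `(g_n)_{n ∈ ℤ}` of standard complex Gaussians. -/
def gaussianFamily : Measure (ℤ → ℂ) := Measure.infinitePi fun _ : ℤ => complexGaussian

/-- The event that `∑ g_n ⟨n⟩⁻¹ e^{inx}` belongs to `H^{1/2-}(𝕋)`; it has probability one. -/
def SeriesConverges (g : ℤ → ℂ) : Prop :=
  ∀ σ : ℝ, σ < 1 / 2 → Summable fun n : ℤ => bracket n ^ (2 * σ) * ‖g n / (bracket n : ℂ)‖ ^ 2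

theorem exists_series (g : ℤ → ℂ) :
    ∃ u : HalfMinus, (SeriesConverges g → ∀ n, coeff u n = g n / (bracket n : ℂ)) ∧
      (¬ SeriesConverges g → ∀ n, coeff u n = 0) := by
  by_cases h : SeriesConverges g
  · have h0 := h 0 (by norm_num)
    simp only [mul_zero, Real.rpow_zero, one_mul] at h0
    have hm : Memℓp (fun n : ℤ => g n / (bracket n : ℂ)) 2 := by
      refine memℓp_gen ?_
      simpa using h0
    let v : lp (fun _ : ℤ => ℂ) 2 := ⟨_, hm⟩
    have hv : ∀ n, fourierCoeff ((fourierBasis (T := 2 * Real.pi)).repr.symm v) n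
        = g n / (bracket n : ℂ) := by
      intro n
      rw [← fourierBasis_repr, LinearIsometryEquiv.apply_symm_apply]
    refine ⟨⟨fourierBasis.repr.symm v, fun σ hσ => ?_⟩, fun _ n => hv n, fun h' => absurd h h'⟩
    simpa only [hv] using h σ hσ
  · have hz : ∀ n, fourierCoeff (0 : L2T) n = 0 := by
      intro n
      rw [← fourierBasis_repr, map_zero]
      rfl
    refine ⟨⟨0, fun σ _ => ?_⟩, fun h' => absurd h' h, fun _ n => hz n⟩
    simp only [hz, norm_zero, ne_eq, OfNat.ofNat_ne_zero, not_false_eq_true, zero_pow, mul_zero]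
    exact summable_zero

/-- The random function `u = ∑ g_n ⟨n⟩⁻¹ e^{inx}` in `H^{1/2-}(𝕋)`, and `0` on the null event that
the series does not converge there. -/
def randomSeries (g : ℤ → ℂ) : HalfMinus := (exists_series g).choose

/-- The Gaussian measure `μ` on `H^{1/2-}(𝕋)`: the law of the random series. -/
def mu : Measure HalfMinus := gaussianFamily.map randomSeries

/-- The mass `‖u‖²_{L²(𝕋)}`. -/
def mass (u : L2T) : ℝ := ‖u‖ ^ 2

/-- `A_m`, the set of functions of mass at most `m`. -/
def massBall (m : ℝ) : Set HalfMinus := {u | mass u.1 ≤ m}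

/-- `T^k_s`, which multiplies the Fourier coefficients at the frequencies `k` and `-k` by `s`
(for `k = 0` there is only one such frequency). -/
def scale (k : ℕ) (s : ℝ) (u : L2T) : L2T :=
  u + ∑ n ∈ ({(k : ℤ), -(k : ℤ)} : Finset ℤ),
    (((s : ℂ) - 1) * fourierCoeff u n) • fourierLp 2 n

/-- `Γ^k_{m,s}`. -/
def shell (k : ℕ) (m s : ℝ) : Set HalfMinus :=
  {u | m < mass (scale k s u.1) ∧ mass (scale k (1 / s) u.1) ≤ m}

/-- `ν^k_{m,s}`, the measure `μ` conditioned on `Γ^k_{m,s}`. -/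
def nuApprox (k : ℕ) (m s : ℝ) : Measure HalfMinus := ProbabilityTheory.cond mu (shell k m s)

/-- The Fourier coefficients at the frequencies `|n| ≤ N`. -/
def lowCoeffs (N : ℕ) (u : HalfMinus) : Set.Icc (-(N : ℤ)) (N : ℤ) → ℂ := fun n => coeff u n

/-- `ν` is the fixed-mass measure `ν^k_m`: on each measurable set that depends on finitely many
frequencies, it is the limit of `ν^k_{m,s}` as `s ↓ 1`. -/
def IsNu (k : ℕ) (m : ℝ) (ν : Measure HalfMinus) : Prop :=
  ∀ (N : ℕ) (B : Set (Set.Icc (-(N : ℤ)) (N : ℤ) → ℂ)), MeasurableSet B →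
    Tendsto (fun s : ℝ => nuApprox k m s (lowCoeffs N ⁻¹' B)) (𝓝[>] 1)
      (𝓝 (ν (lowCoeffs N ⁻¹' B)))

/-- The mass `∑_{|n| ≠ k} |û(n)|²` away from the frequencies `±k`. -/
def massOff (k : ℕ) (u : HalfMinus) : ℝ := ∑' n : {n : ℤ // |n| ≠ (k : ℤ)}, ‖coeff u n‖ ^ 2

/-- `P_k`, the probability density with respect to Lebesgue measure of `∑_{|n| ≠ k} |û(n)|²`
under `μ`. -/
def density (k : ℕ) (y : ℝ) : ℝ := (pdf (massOff k) mu volume y).toReal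

/-- `P_Q P_{≤ N} u`, as a function of `x ∈ ℝ`. -/
def proj (Q : Set ℤ) (N : ℕ) (u : HalfMinus) (x : ℝ) : ℂ :=
  ∑ n ∈ Finset.Icc (-(N : ℤ)) (N : ℤ),
    Q.indicator (fun n : ℤ => coeff u n * Complex.exp (Complex.I * n * x)) n

/-- The normalized integral over the torus. -/
def torusIntegral (f : ℝ → ℂ) : ℂ := (1 / (2 * Real.pi)) * ∫ x in (0 : ℝ)..(2 * Real.pi), f x

/-- `f_N(u) = -(3i/4) ∫ conj(u_N)² ∂ₓ(u_N²) dx` with `u_N = P_{≤ N} u`; this number is real. -/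
def energyTerm (N : ℕ) (u : HalfMinus) : ℝ :=
  (-(3 * Complex.I / 4) * torusIntegral fun x =>
    (starRingEnd ℂ) (proj Set.univ N u x) ^ 2 * deriv (fun y => proj Set.univ N u y ^ 2) x).re

/-- The real part of `-(3i/2) ∫ ∂ₓ(P_{Q₁} u_N) · P_{Q₂} u_N · conj(P_{Q₃} u_N) · conj(P_{Q₄} u_N) dx`
with `u_N = P_{≤ N} u`. -/
def quadTerm (Q : Fin 4 → Set ℤ) (N : ℕ) (u : HalfMinus) : ℝ :=
  (-(3 * Complex.I / 2) * torusIntegral fun x =>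
    deriv (proj (Q 0) N u) x * proj (Q 1) N u x *
      (starRingEnd ℂ) (proj (Q 2) N u x) * (starRingEnd ℂ) (proj (Q 3) N u x)).re

/-- `m₀` is a mass threshold `m_q` for the exponent `q`: on `{‖u‖² < m₀}` the exponential moments
of order `q` of `f_N`, and more generally of its pieces obtained by projecting the four factors to
even sets of frequencies, are bounded uniformly. -/
def IsThreshold (q m₀ : ℝ) : Prop :=
  0 < m₀ ∧ ∃ K : ℝ, ∀ (N : ℕ) (Q : Fin 4 → Set ℤ), (∀ i n, n ∈ Q i ↔ -n ∈ Q i) →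
    ∫⁻ u in {u : HalfMinus | mass u.1 < m₀}, ENNReal.ofReal (Real.exp (q * quadTerm Q N u)) ∂mu
      ≤ ENNReal.ofReal K

end FixedMass

end

open FixedMass

open MeasureTheory ProbabilityTheory Filter Topology
open scoped ENNReal NNReal

noncomputable section

namespace FixedMass

/-! ### The standard complex Gaussian -/

/-! Everything is done in Fourier coordinates: under `mu` the coefficients are independent and
`‖û(n)‖²` is exponential of rate `⟨n⟩²`. The tools are resampling of one coefficient
(`lintegral_mu_resample`) and quasi-invariance under dilation of the frequencies `±k`
(`lintegral_mu_dilate`).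

Mass thresholds (`exists_isThreshold`). The quartic form is a sum over `n₁ + n₂ = n₃ + n₄`. Its
resonant part is momentum times mass, minus a diagonal quartic sum; since the `Q i` are even, the
divergent means in the momentum cancel between `n` and `-n`. For the nonresonant part, reveal the
frequencies in order of increasing modulus. As a function of the newest coefficient `y = û(a)` the
increment is `Re(α y + β y²)`: mixed and cubic terms are resonant. Linear and square monomials of a
Gaussian have mean zero, so the exponential moment is controlled by `‖α‖² + ‖β‖²`, and the factor
`|a|` from the derivative is absorbed by `û(a) = g/⟨a⟩`. This gives a supermartingale
(`exists_nonres_compensator`) whose compensator is essentially `∑ₐ T(a)²`, with `T` the cubic sum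
`tripleSum`. That functional is at most `C M² (mass + tail beyond M)³` for every cutoff `M`. Taking
the least `M` at which the weighted tail is at most `m₀`, it is at most a small multiple of `m₀ M²`,
while a tail above `m₀` at scale `M` costs about `exp(-m₀ M²/2)`; for small `m₀` the sum over `M`
converges.

Moments on a shell (`exists_lintegral_shell_energyTerm_le`). Splitting each factor into the
frequencies `±k` and the rest writes `f_N` as 16 pieces, each homogeneous under dilation of `±k`. A
thin shell can therefore be spread over the ball `{mass < m₀}` by averaging over dilations `σ ∈
[3/5, 1)` with respect to `dσ/σ`: a given `u` is met for a logarithmic time at most `2 log s`, which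
is of the order of the shell width. The price is a factor 10 in the exponent. Interpolating with `mu
(shell) ≲ (s² - s⁻²) ⟨k⟩⁻²` gives the power `⟨k⟩^(-21/20)`. Division by the lower bound
`mu_shell_ge`, in which the integral of `P_k` appears with a factor `⟨k⟩⁻²`, yields `⟨k⟩^(19/20)`.

The measure `ν` (`isNu_sphereMeasure`). For an event that does not involve some frequency `n ≠ ±k`,
integrating out `‖û(n)‖²` gives the limit of `mu (shell ∩ E) / (s² - s⁻²)`. To realise these limits
by one countably additive measure, `mu` is pushed forward by dilating `±k` onto the sphere of mass
`m`, with a suitable weight; `sphereMeasure_eq` identifies the result with `log 2` times the limit.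
Uniqueness holds because cylinder sets form a generating π-system, and the moment bound passes to
the limit because `f_N` depends on finitely many coefficients. -/

theorem complexGaussian_eq_withDensity :
    complexGaussian = (volume : Measure ℂ).withDensity
      fun x => ENNReal.ofReal (Real.pi⁻¹ * Real.exp (-‖x‖ ^ 2)) := by
  have h2 : (1 / 2 : ℝ≥0) ≠ 0 := by norm_num
  have hd : ∀ z : ℝ × ℝ, gaussianPDF 0 (1 / 2) z.1 * gaussianPDF 0 (1 / 2) z.2 =
      ENNReal.ofReal (Real.pi⁻¹ * Real.exp (-‖Complex.measurableEquivRealProd.symm z‖ ^ 2)) := by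
    rintro ⟨x, y⟩
    rw [gaussianPDF, gaussianPDF, ← ENNReal.ofReal_mul (gaussianPDFReal_nonneg _ _ _)]
    congr 1
    have hn : ‖Complex.measurableEquivRealProd.symm (x, y)‖ ^ 2 = x ^ 2 + y ^ 2 := by
      rw [← Complex.normSq_eq_norm_sq, Complex.normSq_apply]
      simp [Complex.measurableEquivRealProd]
      ring
    rw [hn]
    simp only [gaussianPDFReal, sub_zero]
    have e1 : ((1 / 2 : ℝ≥0) : ℝ) = 1 / 2 := by simp
    rw [e1]
    have e2 : √(2 * Real.pi * (1 / 2)) = √Real.pi := by congr 1; ring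
    have e3 : (√Real.pi)⁻¹ * (√Real.pi)⁻¹ = Real.pi⁻¹ := by
      rw [← mul_inv, Real.mul_self_sqrt Real.pi_pos.le]
    rw [e2, show -(x ^ 2 + y ^ 2) = -x ^ 2 / (2 * (1 / 2)) + -y ^ 2 / (2 * (1 / 2)) by ring,
      Real.exp_add, ← e3]
    ring
  rw [complexGaussian, gaussianReal_of_var_ne_zero _ h2,
    prod_withDensity (by fun_prop) (by fun_prop)]
  ext s hs
  rw [Measure.map_apply (by fun_prop) hs, withDensity_apply _ (by measurability),
    withDensity_apply _ hs,
    ← Complex.volume_preserving_equiv_real_prod.symm.setLIntegral_comp_preimage hs (by fun_prop)]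
  simp_rw [hd]
  rfl

theorem lintegral_complexGaussian {F : ℂ → ℝ≥0∞} (hF : Measurable F) :
    ∫⁻ x, F x ∂complexGaussian =
      ∫⁻ x : ℂ, ENNReal.ofReal (Real.pi⁻¹ * Real.exp (-‖x‖ ^ 2)) * F x := by
  rw [complexGaussian_eq_withDensity, lintegral_withDensity_eq_lintegral_mul _ (by fun_prop) hF]
  rfl

/-- The Jacobian is `t²` because `ℂ` has real dimension two; the exponential is the quotient of the
Gaussian densities at `t x` and at `x`. -/
theorem lintegral_complexGaussian_scale {F : ℂ → ℝ≥0∞} (hF : Measurable F) {t : ℝ} (ht : 0 < t) :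
    ∫⁻ x, F x ∂complexGaussian =
      ∫⁻ x, F (t * x) * ENNReal.ofReal (t ^ 2 * Real.exp (-(t ^ 2 - 1) * ‖x‖ ^ 2))
        ∂complexGaussian := by
  rw [lintegral_complexGaussian hF, lintegral_complexGaussian (by fun_prop)]
  have key : (volume : Measure ℂ) =
      ENNReal.ofReal (t ^ 2) • Measure.map (fun x : ℂ => t • x) volume := by
    rw [Measure.map_addHaar_smul _ ht.ne', smul_smul, Complex.finrank_real_complex,
      abs_of_nonneg (by positivity), ← ENNReal.ofReal_mul (by positivity),
      mul_inv_cancel₀ (by positivity), ENNReal.ofReal_one, one_smul]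
  conv_lhs => rw [key]
  rw [lintegral_smul_measure, lintegral_map (by fun_prop) (by fun_prop), smul_eq_mul,
    ← lintegral_const_mul _ (by fun_prop)]
  refine lintegral_congr fun x => ?_
  rw [Complex.real_smul, mul_comm (F _), ← mul_assoc, ← mul_assoc,
    ← ENNReal.ofReal_mul (by positivity), ← ENNReal.ofReal_mul (by positivity)]
  congr 2
  rw [norm_mul, Complex.norm_real, mul_pow, Real.norm_eq_abs, sq_abs,
    show -(t ^ 2 * ‖x‖ ^ 2) = -‖x‖ ^ 2 + -(t ^ 2 - 1) * ‖x‖ ^ 2 by ring, Real.exp_add]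
  ring

/-- Polar coordinates followed by `r = ρ²`: the squared modulus of a standard complex Gaussian is
exponential of rate one. -/
theorem lintegral_complexGaussian_norm_sq {h : ℝ → ℝ≥0∞} (hh : Measurable h) :
    ∫⁻ x, h (‖x‖ ^ 2) ∂complexGaussian =
      ∫⁻ r in Set.Ioi (0 : ℝ), ENNReal.ofReal (Real.exp (-r)) * h r := by
  rw [lintegral_complexGaussian (by fun_prop), ← Complex.lintegral_comp_polarCoord_symm]
  have h1 : ∀ p ∈ polarCoord.target, ENNReal.ofReal p.1 •
      (ENNReal.ofReal (Real.pi⁻¹ * Real.exp (-‖Complex.polarCoord.symm p‖ ^ 2)) *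
        h (‖Complex.polarCoord.symm p‖ ^ 2)) =
      ENNReal.ofReal p.1 * (ENNReal.ofReal (Real.pi⁻¹ * Real.exp (-p.1 ^ 2)) * h (p.1 ^ 2)) := by
    intro p hp
    rw [Complex.norm_polarCoord_symm, sq_abs, smul_eq_mul]
  rw [setLIntegral_congr_fun polarCoord.open_target.measurableSet h1,
    polarCoord_target, Measure.volume_eq_prod, ← Measure.prod_restrict,
    lintegral_prod _ (by fun_prop)]
  simp only [lintegral_const, Measure.restrict_apply_univ, Real.volume_Ioo]
  have himg : (fun r : ℝ => r ^ 2) '' Set.Ioi 0 = Set.Ioi 0 := by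
    ext y
    simp only [Set.mem_image, Set.mem_Ioi]
    exact ⟨fun ⟨r, hr, e⟩ => e ▸ by positivity,
      fun hy => ⟨√y, Real.sqrt_pos.2 hy, Real.sq_sqrt hy.le⟩⟩
  have hinj : Set.InjOn (fun r : ℝ => r ^ 2) (Set.Ioi 0) := fun a ha b hb e =>
    (pow_left_inj₀ (le_of_lt ha) (le_of_lt hb) two_ne_zero).1 e
  have hsub := lintegral_image_eq_lintegral_abs_deriv_mul measurableSet_Ioi
    (f' := fun r => 2 * r) (fun x _ => by simpa using (hasDerivAt_pow 2 x).hasDerivWithinAt) hinj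
    fun r => ENNReal.ofReal (Real.exp (-r)) * h r
  rw [himg] at hsub
  rw [hsub]
  refine setLIntegral_congr_fun measurableSet_Ioi fun r (hr : 0 < r) => ?_
  have e1 : ENNReal.ofReal (Real.pi - -Real.pi) = ENNReal.ofReal (2 * Real.pi) := by
    congr 1; ring
  rw [e1, abs_of_nonneg (by positivity), ← mul_assoc, ← mul_assoc,
    ← ENNReal.ofReal_mul (by positivity), ← ENNReal.ofReal_mul (by positivity), mul_right_comm,
    ← ENNReal.ofReal_mul (by positivity)]
  congr 2
  field_simp

/-- Used with `c = -1` and `c = i`, to make the means of `x` and `x²` vanish. -/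
theorem measurePreserving_complexGaussian_mul (c : ℂ) (hc : ‖c‖ = 1) :
    MeasurePreserving (fun x => c * x) complexGaussian complexGaussian := by
  have hv : MeasurePreserving (fun x : ℂ => c * x) volume volume := by
    exact (rotation (⟨c, mem_sphere_zero_iff_norm.2 hc⟩ : Circle)).measurePreserving
  refine ⟨by fun_prop, ?_⟩
  ext s hs
  rw [Measure.map_apply (by fun_prop) hs, complexGaussian_eq_withDensity, withDensity_apply _ hs,
    withDensity_apply _ (hs.preimage (by fun_prop)),
    ← hv.setLIntegral_comp_preimage hs (by fun_prop)]
  simp [hc]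

/-! ### The space `HalfMinus` in Fourier coordinates -/

theorem one_le_bracket (n : ℤ) : 1 ≤ bracket n := by
  rw [bracket, Real.one_le_sqrt]
  nlinarith [sq_nonneg (n : ℝ)]

theorem bracket_pos (n : ℤ) : 0 < bracket n := zero_lt_one.trans_le (one_le_bracket n)

theorem bracket_sq (n : ℤ) : bracket n ^ 2 = 1 + (n : ℝ) ^ 2 := Real.sq_sqrt (by positivity)

theorem bracket_neg (n : ℤ) : bracket (-n) = bracket n := by simp [bracket]

theorem abs_le_bracket (n : ℤ) : |(n : ℝ)| ≤ bracket n := by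
  rw [bracket, ← Real.sqrt_sq_eq_abs]
  exact Real.sqrt_le_sqrt (by linarith)

theorem coeff_injective : Function.Injective coeff := by
  intro u v h
  apply Subtype.ext
  apply (fourierBasis (T := 2 * Real.pi)).repr.injective
  ext n
  rw [fourierBasis_repr, fourierBasis_repr]
  exact congrFun h n

theorem measurable_coeff : Measurable coeff := comap_measurable coeff

theorem measurable_coeff_apply (n : ℤ) : Measurable fun u : HalfMinus => coeff u n :=
  (measurable_pi_apply n).comp measurable_coeff

theorem measurable_halfMinus {α : Type*} [MeasurableSpace α] {f : α → HalfMinus}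
    (h : ∀ n, Measurable fun x => coeff (f x) n) : Measurable f := by
  rw [measurable_comap_iff]
  exact measurable_pi_lambda _ h

theorem summable_coeff (u : HalfMinus) {σ : ℝ} (hσ : σ < 1 / 2) :
    Summable fun n : ℤ => bracket n ^ (2 * σ) * ‖coeff u n‖ ^ 2 := u.2 σ hσ

theorem summable_norm_sq_coeff (u : HalfMinus) : Summable fun n : ℤ => ‖coeff u n‖ ^ 2 := by
  simpa using summable_coeff u (σ := 0) (by norm_num)

/-- The construction behind the random series, applied to `g n = ⟨n⟩ c n`. -/
theorem exists_coeff_eq (c : ℤ → ℂ)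
    (hc : ∀ σ : ℝ, σ < 1 / 2 → Summable fun n : ℤ => bracket n ^ (2 * σ) * ‖c n‖ ^ 2) :
    ∃ u : HalfMinus, ∀ n, coeff u n = c n := by
  have e : ∀ n, c n * (bracket n : ℂ) / (bracket n : ℂ) = c n := fun n =>
    mul_div_cancel_right₀ _ (by exact_mod_cast (bracket_pos n).ne')
  obtain ⟨u, hu, -⟩ := exists_series fun n => c n * (bracket n : ℂ)
  refine ⟨u, fun n => ?_⟩
  rw [hu (fun σ hσ => by simpa only [e] using hc σ hσ), e]

theorem exists_coeff_eq_of_finite (u : HalfMinus) (c : ℤ → ℂ) (s : Finset ℤ)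
    (h : ∀ n, n ∉ s → c n = coeff u n) : ∃ v : HalfMinus, ∀ n, coeff v n = c n := by
  refine exists_coeff_eq c fun σ hσ => ?_
  refine (summable_congr_cofinite ?_).2 (summable_coeff u hσ)
  have : ∀ᶠ n in cofinite, n ∉ (s : Set ℤ) := s.finite_toSet.eventually_cofinite_notMem
  filter_upwards [this] with n hn
  rw [h n hn]

/-- Replace the Fourier coefficient at the frequency `n` by `x`. -/
def setCoeff (n : ℤ) (x : ℂ) (u : HalfMinus) : HalfMinus :=
  (exists_coeff_eq_of_finite u (Function.update (coeff u) n x) {n} fun j hj => by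
    rw [Function.update_of_ne (by simpa using hj)]).choose

theorem coeff_setCoeff (n : ℤ) (x : ℂ) (u : HalfMinus) (j : ℤ) :
    coeff (setCoeff n x u) j = if j = n then x else coeff u j := by
  have h := Exists.choose_spec (exists_coeff_eq_of_finite u (Function.update (coeff u) n x) {n}
    fun j hj => by rw [Function.update_of_ne (by simpa using hj)])
  rw [← Function.update_apply]
  exact h j

theorem exists_dilate (k : ℕ) (t : ℝ) (u : HalfMinus) : ∃ v : HalfMinus, ∀ n,
    coeff v n = if |n| = (k : ℤ) then t * coeff u n else coeff u n := by
  refine exists_coeff_eq_of_finite u _ {(k : ℤ), -(k : ℤ)} fun j hj => if_neg ?_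
  simp only [Finset.mem_insert, Finset.mem_singleton, not_or] at hj
  rw [abs_eq (by positivity)]
  tauto

/-- Multiply the Fourier coefficients at the frequencies `k` and `-k` by `t`. -/
def dilate (k : ℕ) (t : ℝ) (u : HalfMinus) : HalfMinus :=
  (exists_dilate k t u).choose

theorem coeff_dilate (k : ℕ) (t : ℝ) (u : HalfMinus) (n : ℤ) :
    coeff (dilate k t u) n = if |n| = (k : ℤ) then t * coeff u n else coeff u n :=
  (exists_dilate k t u).choose_spec n

theorem measurable_setCoeff (n : ℤ) :
    Measurable fun z : HalfMinus × ℂ => setCoeff n z.2 z.1 := by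
  refine measurable_halfMinus fun j => ?_
  simp only [coeff_setCoeff]
  split_ifs
  · exact measurable_snd
  · exact (measurable_coeff_apply j).comp measurable_fst

theorem measurable_dilate (k : ℕ) :
    Measurable fun z : HalfMinus × ℝ => dilate k z.2 z.1 := by
  refine measurable_halfMinus fun j => ?_
  simp only [coeff_dilate]
  have h1 : Measurable fun z : HalfMinus × ℝ => coeff z.1 j :=
    (measurable_coeff_apply j).comp measurable_fst
  split_ifs
  · exact (Complex.measurable_ofReal.comp measurable_snd).mul h1
  · exact h1

/-! ### Masses -/

theorem mass_eq_tsum (u : L2T) : mass u = ∑' n : ℤ, ‖fourierCoeff u n‖ ^ 2 := by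
  have h := lp.norm_rpow_eq_tsum (p := 2) (by norm_num)
    ((fourierBasis (T := 2 * Real.pi)).repr u)
  rw [LinearIsometryEquiv.norm_map] at h
  simpa [mass, fourierBasis_repr] using h

/-- The mass carried by the frequencies `k` and `-k`. -/
def massOn (k : ℕ) (u : HalfMinus) : ℝ := ∑ n ∈ ({(k : ℤ), -(k : ℤ)} : Finset ℤ), ‖coeff u n‖ ^ 2

theorem mem_pm_iff (k : ℕ) (n : ℤ) : n ∈ ({(k : ℤ), -(k : ℤ)} : Finset ℤ) ↔ |n| = (k : ℤ) := by
  rw [abs_eq (by positivity)]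
  simp

theorem massOn_nonneg (k : ℕ) (u : HalfMinus) : 0 ≤ massOn k u :=
  Finset.sum_nonneg fun _ _ => by positivity

theorem massOff_nonneg (k : ℕ) (u : HalfMinus) : 0 ≤ massOff k u :=
  tsum_nonneg fun _ => by positivity

theorem massOff_add_massOn (k : ℕ) (u : HalfMinus) :
    massOff k u + massOn k u = ∑' n : ℤ, ‖coeff u n‖ ^ 2 := by
  rw [add_comm, ← (summable_norm_sq_coeff u).sum_add_tsum_subtype_compl {(k : ℤ), -(k : ℤ)}]
  congr 1
  have : {n : ℤ | |n| ≠ (k : ℤ)} = {n | n ∉ ({(k : ℤ), -(k : ℤ)} : Finset ℤ)} := by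
    ext n; simp only [Set.mem_ofPred_eq, mem_pm_iff, ne_eq]
  exact tsum_congr_set_coe (fun n => ‖coeff u n‖ ^ 2) this

theorem mass_eq (k : ℕ) (u : HalfMinus) : mass u.1 = massOff k u + massOn k u := by
  rw [massOff_add_massOn, mass_eq_tsum]; rfl

theorem massOff_dilate (k : ℕ) (t : ℝ) (u : HalfMinus) : massOff k (dilate k t u) = massOff k u := by
  refine tsum_congr fun n => ?_
  rw [coeff_dilate, if_neg n.2]

theorem massOn_dilate (k : ℕ) (t : ℝ) (u : HalfMinus) :
    massOn k (dilate k t u) = t ^ 2 * massOn k u := by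
  rw [massOn, massOn, Finset.mul_sum]
  refine Finset.sum_congr rfl fun n hn => ?_
  rw [coeff_dilate, if_pos ((mem_pm_iff k n).1 hn), norm_mul, mul_pow, Complex.norm_real,
    Real.norm_eq_abs, sq_abs]

/-- Comparison of Fourier coefficients. For `k = 0` the finset `{k, -k}` is a singleton, so the zero
mode is scaled once and not twice. -/
theorem scale_eq_dilate (k : ℕ) (s : ℝ) (u : HalfMinus) : scale k s u.1 = (dilate k s u).1 := by
  apply (fourierBasis (T := 2 * Real.pi)).repr.injective
  ext n
  rw [fourierBasis_repr (dilate k s u).1]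
  change _ = coeff (dilate k s u) n
  rw [coeff_dilate, scale, HilbertBasis.repr_apply_apply, inner_add_right, inner_sum,
    ← HilbertBasis.repr_apply_apply, fourierBasis_repr]
  simp_rw [inner_smul_right, coe_fourierBasis, orthonormal_iff_ite.1 orthonormal_fourier]
  simp only [mul_ite, mul_one, mul_zero, Finset.sum_ite_eq, mem_pm_iff]
  change coeff u n + _ = _
  split_ifs
  · change coeff u n + (s - 1) * coeff u n = _
    ring
  · simp

theorem mem_shell_iff (k : ℕ) (m s : ℝ) (u : HalfMinus) : u ∈ shell k m s ↔
    m < massOff k u + s ^ 2 * massOn k u ∧ massOff k u + (1 / s) ^ 2 * massOn k u ≤ m := by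
  simp only [shell, Set.mem_ofPred_eq, scale_eq_dilate, mass_eq k, massOff_dilate, massOn_dilate]

theorem measurable_massOn (k : ℕ) : Measurable (massOn k) :=
  Finset.measurable_sum _ fun n _ => (measurable_coeff_apply n).norm.pow_const 2

theorem measurable_massOff (k : ℕ) : Measurable (massOff k) := by
  exact Measurable.tsum fun n => (measurable_coeff_apply n).norm.pow_const 2

theorem measurable_mass : Measurable fun u : HalfMinus => mass u.1 := by
  simp only [mass_eq 0]
  exact (measurable_massOff 0).add (measurable_massOn 0)

theorem measurableSet_shell (k : ℕ) (m s : ℝ) : MeasurableSet (shell k m s) := by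
  have : shell k m s = {u | m < massOff k u + s ^ 2 * massOn k u} ∩
      {u | massOff k u + (1 / s) ^ 2 * massOn k u ≤ m} := by
    ext u; exact mem_shell_iff k m s u
  rw [this]
  have h1 := measurable_massOn k
  have h2 := measurable_massOff k
  exact (measurableSet_lt measurable_const (h2.add (h1.const_mul _))).inter
    (measurableSet_le (h2.add (h1.const_mul _)) measurable_const)

/-! ### Resampling one Fourier coefficient -/

theorem lintegral_exp_mul_norm_sq {θ : ℝ} (hθ : θ < 1) :
    ∫⁻ x, ENNReal.ofReal (Real.exp (θ * ‖x‖ ^ 2)) ∂complexGaussian =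
      ENNReal.ofReal (1 - θ)⁻¹ := by
  rw [lintegral_complexGaussian_norm_sq (h := fun r => ENNReal.ofReal (Real.exp (θ * r)))
    (by fun_prop)]
  have e : ∀ r : ℝ, ENNReal.ofReal (Real.exp (-r)) * ENNReal.ofReal (Real.exp (θ * r)) =
      ENNReal.ofReal (Real.exp ((θ - 1) * r)) := fun r => by
    rw [← ENNReal.ofReal_mul (by positivity), ← Real.exp_add]
    congr 2; ring
  simp_rw [e]
  rw [← ofReal_integral_eq_lintegral_ofReal (integrableOn_exp_mul_Ioi (by linarith) 0)
    (ae_of_all _ fun r => by positivity), integral_exp_mul_Ioi (by linarith)]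
  congr 1
  rw [mul_zero, Real.exp_zero, ← neg_sub, neg_div_neg_eq, one_div]

theorem lintegral_norm_sq_complexGaussian_le :
    ∫⁻ x, ENNReal.ofReal (‖x‖ ^ 2) ∂complexGaussian ≤ 4 := by
  calc ∫⁻ x, ENNReal.ofReal (‖x‖ ^ 2) ∂complexGaussian
      ≤ ∫⁻ x, 2 * ENNReal.ofReal (Real.exp (1 / 2 * ‖x‖ ^ 2)) ∂complexGaussian := by
        refine lintegral_mono fun x => ?_
        rw [← ENNReal.ofReal_ofNat 2, ← ENNReal.ofReal_mul (by norm_num)]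
        apply ENNReal.ofReal_le_ofReal
        linarith [Real.add_one_le_exp (1 / 2 * ‖x‖ ^ 2)]
    _ = 4 := by
        rw [lintegral_const_mul _ (by fun_prop), lintegral_exp_mul_norm_sq (by norm_num)]
        rw [← ENNReal.ofReal_ofNat 2, ← ENNReal.ofReal_mul (by norm_num)]
        norm_num

theorem summable_of_tsum_ofReal_ne_top {ι : Type*} {f : ι → ℝ} (hf : ∀ i, 0 ≤ f i)
    (h : ∑' i, ENNReal.ofReal (f i) ≠ ∞) : Summable f := by
  have := ENNReal.summable_toReal h
  simpa only [ENNReal.toReal_ofReal (hf _)] using this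

theorem summable_bracket_rpow {a : ℝ} (ha : 1 < a) : Summable fun n : ℤ => bracket n ^ (-a) := by
  refine Summable.of_norm_bounded_eventually (g := fun n : ℤ => |(n : ℝ)| ^ (-a))
    (Real.summable_abs_int_rpow ha) ?_
  have : ∀ᶠ n : ℤ in cofinite, n ∉ ({0} : Set ℤ) :=
    (Set.finite_singleton (0 : ℤ)).eventually_cofinite_notMem
  filter_upwards [this] with n hn
  rw [Real.norm_of_nonneg (Real.rpow_nonneg (bracket_pos n).le _)]
  exact Real.rpow_le_rpow_of_nonpos (abs_pos.2 (by exact_mod_cast hn)) (abs_le_bracket n)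
    (by linarith)

theorem norm_sq_div_bracket (n : ℤ) (x : ℂ) :
    ‖x / (bracket n : ℂ)‖ ^ 2 = (bracket n ^ 2)⁻¹ * ‖x‖ ^ 2 := by
  rw [norm_div, Complex.norm_real, Real.norm_of_nonneg (bracket_pos n).le, div_pow, div_eq_inv_mul]

theorem lintegral_gaussianFamily_eval {h : ℂ → ℝ≥0∞} (hh : Measurable h) (n : ℤ) :
    ∫⁻ g, h (g n) ∂gaussianFamily = ∫⁻ x, h x ∂complexGaussian :=
  (measurePreserving_eval_infinitePi (fun _ : ℤ => complexGaussian) n).lintegral_comp hh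

/-- The expected sum is at most `4 ∑ ⟨n⟩^(-(2 - 2σ))`, which is finite because `2 - 2σ > 1`. -/
theorem ae_summable_series {σ : ℝ} (hσ : σ < 1 / 2) : ∀ᵐ g ∂gaussianFamily,
    Summable fun n : ℤ => bracket n ^ (2 * σ) * ‖g n / (bracket n : ℂ)‖ ^ 2 := by
  have e : ∀ (g : ℤ → ℂ) (n : ℤ), bracket n ^ (2 * σ) * ‖g n / (bracket n : ℂ)‖ ^ 2 =
      bracket n ^ (-(2 - 2 * σ)) * ‖g n‖ ^ 2 := fun g n => by
    rw [norm_sq_div_bracket, ← mul_assoc, ← Real.rpow_natCast, ← Real.rpow_neg (bracket_pos n).le,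
      ← Real.rpow_add (bracket_pos n)]
    congr 2
    push_cast; ring
  have hm : ∀ n : ℤ, Measurable fun g : ℤ → ℂ =>
      ENNReal.ofReal (bracket n ^ (-(2 - 2 * σ)) * ‖g n‖ ^ 2) := fun n => by fun_prop
  have hfin : ∫⁻ g, ∑' n : ℤ, ENNReal.ofReal (bracket n ^ (-(2 - 2 * σ)) * ‖g n‖ ^ 2)
      ∂gaussianFamily ≠ ∞ := by
    rw [lintegral_tsum fun n => (hm n).aemeasurable]
    refine ne_top_of_le_ne_top (b := ∑' n : ℤ, ENNReal.ofReal (bracket n ^ (-(2 - 2 * σ))) * 4) ?_ ?_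
    · rw [ENNReal.tsum_mul_right]
      exact ENNReal.mul_ne_top (summable_bracket_rpow (by linarith)).tsum_ofReal_ne_top (by simp)
    · refine ENNReal.tsum_le_tsum fun n => ?_
      have hb := Real.rpow_nonneg (bracket_pos n).le (-(2 - 2 * σ))
      simp_rw [ENNReal.ofReal_mul hb]
      rw [lintegral_const_mul _ (by fun_prop)]
      gcongr
      rw [lintegral_gaussianFamily_eval (h := fun x => ENNReal.ofReal (‖x‖ ^ 2)) (by fun_prop)]
      exact lintegral_norm_sq_complexGaussian_le
  filter_upwards [ae_lt_top (Measurable.tsum hm) hfin] with g hg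
  simp_rw [e]
  exact summable_of_tsum_ofReal_ne_top
    (fun n => mul_nonneg (Real.rpow_nonneg (bracket_pos n).le _) (by positivity)) hg.ne

theorem summable_series_mono {g : ℤ → ℂ} {σ τ : ℝ} (h : σ ≤ τ)
    (hs : Summable fun n : ℤ => bracket n ^ (2 * τ) * ‖g n / (bracket n : ℂ)‖ ^ 2) :
    Summable fun n : ℤ => bracket n ^ (2 * σ) * ‖g n / (bracket n : ℂ)‖ ^ 2 := by
  refine hs.of_nonneg_of_le
    (fun n => mul_nonneg (Real.rpow_nonneg (bracket_pos n).le _) (by positivity)) fun n => ?_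
  gcongr
  exact one_le_bracket n

/-- By monotonicity in `σ` countably many exponents suffice; this makes the event measurable and
allows the almost sure statements to be intersected. -/
theorem seriesConverges_iff (g : ℤ → ℂ) : SeriesConverges g ↔ ∀ j : ℕ,
    Summable fun n : ℤ => bracket n ^ (2 * (1 / 2 - 1 / ((j : ℝ) + 1))) *
      ‖g n / (bracket n : ℂ)‖ ^ 2 := by
  refine ⟨fun h j => h _ (by linarith [Nat.one_div_pos_of_nat (α := ℝ) (n := j)]),
    fun h σ hσ => ?_⟩
  obtain ⟨j, hj⟩ := exists_nat_one_div_lt (sub_pos.2 hσ)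
  exact summable_series_mono (by linarith) (h j)

theorem ae_seriesConverges : ∀ᵐ g ∂gaussianFamily, SeriesConverges g := by
  simp_rw [seriesConverges_iff]
  rw [ae_all_iff]
  exact fun j => ae_summable_series (by linarith [Nat.one_div_pos_of_nat (α := ℝ) (n := j)])

theorem measurableSet_seriesConverges : MeasurableSet {g | SeriesConverges g} := by
  have h : {g | SeriesConverges g} = ⋂ j : ℕ, {g | ∑' n : ℤ, ENNReal.ofReal
      (bracket n ^ (2 * (1 / 2 - 1 / ((j : ℝ) + 1))) * ‖g n / (bracket n : ℂ)‖ ^ 2) < ∞} := by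
    ext g
    simp only [Set.mem_ofPred_eq, seriesConverges_iff, Set.mem_iInter]
    refine forall_congr' fun j => ⟨fun h => h.tsum_ofReal_ne_top.lt_top, fun h =>
      summable_of_tsum_ofReal_ne_top (fun n =>
        mul_nonneg (Real.rpow_nonneg (bracket_pos n).le _) (by positivity)) h.ne⟩
  rw [h]
  refine MeasurableSet.iInter fun j => measurableSet_lt (Measurable.tsum fun n => ?_)
    measurable_const
  fun_prop

theorem coeff_randomSeries {g : ℤ → ℂ} (h : SeriesConverges g) (n : ℤ) :
    coeff (randomSeries g) n = g n / (bracket n : ℂ) :=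
  (exists_series g).choose_spec.1 h n

theorem measurable_randomSeries : Measurable randomSeries := by
  refine measurable_halfMinus fun n => ?_
  have h : (fun g => coeff (randomSeries g) n) =
      {g | SeriesConverges g}.indicator fun g => g n / (bracket n : ℂ) := by
    ext g
    by_cases hg : SeriesConverges g
    · rw [Set.indicator_of_mem (by exact hg), coeff_randomSeries hg]
    · rw [Set.indicator_of_notMem (by exact hg)]
      exact (exists_series g).choose_spec.2 hg n
  rw [h]
  exact Measurable.indicator (by fun_prop) measurableSet_seriesConverges

instance : IsProbabilityMeasure gaussianFamily := by unfold gaussianFamily; infer_instance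

instance : IsProbabilityMeasure mu :=
  Measure.isProbabilityMeasure_map measurable_randomSeries.aemeasurable

/-- The infinite product measure is determined by finite rectangles, and on these the fresh variable
simply takes the place of the factor at `n`. -/
theorem gaussianFamily_prod_map_update (n : ℤ) :
    (gaussianFamily.prod complexGaussian).map (fun z => Function.update z.1 n z.2) =
      gaussianFamily := by
  have hmeas : Measurable fun z : (ℤ → ℂ) × ℂ => Function.update z.1 n z.2 := by
    refine measurable_pi_lambda _ fun j => ?_
    simp only [Function.update_apply]
    split_ifs
    · exact measurable_snd
    · fun_prop
  refine Measure.eq_infinitePi _ fun s t ht => ?_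
  rw [Measure.map_apply hmeas (MeasurableSet.pi s.countable_toSet fun i _ => ht i)]
  by_cases hn : n ∈ s
  · have : (fun z : (ℤ → ℂ) × ℂ => Function.update z.1 n z.2) ⁻¹' (Set.pi s t) =
        (Set.pi (s.erase n : Finset ℤ) t) ×ˢ t n := by
      ext ⟨g, x⟩
      simp only [Set.mem_preimage, Set.mem_pi, Finset.mem_coe, Set.mem_prod, Finset.mem_erase]
      constructor
      · intro h
        refine ⟨fun i hi => ?_, by simpa using h n hn⟩
        simpa [Function.update_of_ne hi.1] using h i hi.2
      · rintro ⟨h1, h2⟩ i hi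
        by_cases hin : i = n
        · subst hin; simpa using h2
        · simpa [Function.update_of_ne hin] using h1 i ⟨hin, hi⟩
    rw [this, Measure.prod_prod, gaussianFamily, Measure.infinitePi_pi _ fun i _ => ht i,
      Finset.prod_erase_mul _ _ hn]
  · have : (fun z : (ℤ → ℂ) × ℂ => Function.update z.1 n z.2) ⁻¹' (Set.pi s t) =
        (Set.pi (s : Set ℤ) t) ×ˢ Set.univ := by
      ext ⟨g, x⟩
      simp only [Set.mem_preimage, Set.mem_pi, Finset.mem_coe, Set.mem_prod, Set.mem_univ, and_true]
      refine forall₂_congr fun i hi => ?_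
      rw [Function.update_of_ne (by rintro rfl; exact hn hi)]
    rw [this, Measure.prod_prod, gaussianFamily, Measure.infinitePi_pi _ fun i _ => ht i,
      measure_univ, mul_one]

theorem seriesConverges_update {g : ℤ → ℂ} (h : SeriesConverges g) (n : ℤ) (x : ℂ) :
    SeriesConverges (Function.update g n x) := by
  intro σ hσ
  refine (summable_congr_cofinite ?_).2 (h σ hσ)
  have : ∀ᶠ j in cofinite, j ∉ ({n} : Set ℤ) :=
    (Set.finite_singleton n).eventually_cofinite_notMem
  filter_upwards [this] with j hj
  rw [Function.update_of_ne (by simpa using hj)]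

/-- Under `μ` the Fourier coefficients are independent: resampling one of them preserves `μ`. -/
theorem lintegral_mu_resample (n : ℤ) {Φ : HalfMinus → ℝ≥0∞} (hΦ : Measurable Φ) :
    ∫⁻ u, Φ u ∂mu =
      ∫⁻ u, ∫⁻ x, Φ (setCoeff n (x / (bracket n : ℂ)) u) ∂complexGaussian ∂mu := by
  have hmeas : Measurable fun z : (ℤ → ℂ) × ℂ => Function.update z.1 n z.2 := by
    refine measurable_pi_lambda _ fun j => ?_
    simp only [Function.update_apply]
    split_ifs
    · exact measurable_snd
    · fun_prop
  have hm2 : Measurable fun z : HalfMinus × ℂ => Φ (setCoeff n (z.2 / (bracket n : ℂ)) z.1) :=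
    hΦ.comp ((measurable_setCoeff n).comp
      (measurable_fst.prodMk (measurable_snd.div_const _)))
  rw [mu, lintegral_map hΦ measurable_randomSeries,
    lintegral_map hm2.lintegral_prod_right' measurable_randomSeries]
  conv_lhs => rw [← gaussianFamily_prod_map_update n]
  rw [lintegral_map (f := fun g => Φ (randomSeries g)) (hΦ.comp measurable_randomSeries) hmeas,
    lintegral_prod (fun z : (ℤ → ℂ) × ℂ => Φ (randomSeries (Function.update z.1 n z.2)))
      (hΦ.comp (measurable_randomSeries.comp hmeas)).aemeasurable]
  refine lintegral_congr_ae ?_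
  filter_upwards [ae_seriesConverges] with g hg
  refine lintegral_congr fun x => ?_
  congr 1
  apply coeff_injective
  ext j
  rw [coeff_setCoeff, coeff_randomSeries hg, coeff_randomSeries (seriesConverges_update hg n x),
    Function.update_apply]
  split_ifs with h
  · rw [h]
  · rfl

theorem setCoeff_setCoeff (n : ℤ) (x y : ℂ) (u : HalfMinus) :
    setCoeff n x (setCoeff n y u) = setCoeff n x u := by
  apply coeff_injective
  ext j
  simp only [coeff_setCoeff]
  split_ifs <;> rfl

theorem coeff_setCoeff_self (n : ℤ) (x : ℂ) (u : HalfMinus) : coeff (setCoeff n x u) n = x := by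
  simp [coeff_setCoeff]

theorem coeff_setCoeff_of_ne {n j : ℤ} (h : j ≠ n) (x : ℂ) (u : HalfMinus) :
    coeff (setCoeff n x u) j = coeff u j := by
  simp [coeff_setCoeff, h]

/-! ### Independence of the modes and quasi-invariance under dilations -/

theorem measurable_setCoeff_mul (n : ℤ) (t : ℝ) :
    Measurable fun u : HalfMinus => setCoeff n (t * coeff u n) u :=
  (measurable_setCoeff n).comp (measurable_id.prodMk ((measurable_coeff_apply n).const_mul _))

/-- Resampling both sides at `n` reduces the identity to the scaling rule for a single Gaussian `g =
⟨n⟩ û(n)`. -/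
theorem lintegral_mu_setCoeff_mul (n : ℤ) {t : ℝ} (ht : 0 < t) {Φ : HalfMinus → ℝ≥0∞}
    (hΦ : Measurable Φ) :
    ∫⁻ u, Φ u ∂mu = ∫⁻ u, Φ (setCoeff n (t * coeff u n) u) *
      ENNReal.ofReal (t ^ 2 * Real.exp (-(t ^ 2 - 1) * (bracket n ^ 2 * ‖coeff u n‖ ^ 2))) ∂mu := by
  have hm : Measurable fun u : HalfMinus => Φ (setCoeff n (t * coeff u n) u) *
      ENNReal.ofReal (t ^ 2 * Real.exp (-(t ^ 2 - 1) * (bracket n ^ 2 * ‖coeff u n‖ ^ 2))) := by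
    have := measurable_coeff_apply n
    exact (hΦ.comp (measurable_setCoeff_mul n t)).mul (by fun_prop)
  rw [lintegral_mu_resample n hΦ, lintegral_mu_resample n hm]
  refine lintegral_congr fun u => ?_
  have hm1 : Measurable fun x : ℂ => Φ (setCoeff n (x / (bracket n : ℂ)) u) :=
    hΦ.comp ((measurable_setCoeff n).comp (measurable_const.prodMk (measurable_id.div_const _)))
  rw [lintegral_complexGaussian_scale hm1 ht]
  refine lintegral_congr fun x => ?_
  rw [coeff_setCoeff_self, setCoeff_setCoeff, norm_sq_div_bracket, mul_div_assoc,
    mul_inv_cancel_left₀ (pow_ne_zero 2 (bracket_pos n).ne')]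

theorem lintegral_mu_prod (I : Finset ℤ) {φ : ℤ → ℂ → ℝ≥0∞} (hφ : ∀ n, Measurable (φ n)) :
    ∫⁻ u, ∏ n ∈ I, φ n (coeff u n) ∂mu =
      ∏ n ∈ I, ∫⁻ x, φ n (x / (bracket n : ℂ)) ∂complexGaussian := by
  induction I using Finset.induction_on with
  | empty => simp
  | insert n I hn ih =>
    have hm : ∀ J : Finset ℤ, Measurable fun u : HalfMinus => ∏ j ∈ J, φ j (coeff u j) :=
      fun J => Finset.measurable_prod _ fun j _ => (hφ j).comp (measurable_coeff_apply j)
    rw [lintegral_mu_resample n (hm _), Finset.prod_insert hn, ← ih,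
      ← lintegral_const_mul _ (hm _)]
    refine lintegral_congr fun u => ?_
    have : ∀ x : ℂ, ∏ j ∈ insert n I, φ j (coeff (setCoeff n (x / (bracket n : ℂ)) u) j) =
        φ n (x / (bracket n : ℂ)) * ∏ j ∈ I, φ j (coeff u j) := fun x => by
      rw [Finset.prod_insert hn, coeff_setCoeff_self]
      congr 1
      refine Finset.prod_congr rfl fun j hj => ?_
      rw [coeff_setCoeff_of_ne (by rintro rfl; exact hn hj)]
    simp_rw [this]
    exact lintegral_mul_const _ ((hφ n).comp (measurable_id.div_const _))

/-- The number of frequencies `n` with `|n| = k`. -/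
def pmCard (k : ℕ) : ℕ := ({(k : ℤ), -(k : ℤ)} : Finset ℤ).card

/-- Scale the modes `k` and `-k` in turn. Each contributes a Jacobian `t²`, whence the exponent
`pmCard k`, which is one for `k = 0`. -/
theorem lintegral_mu_dilate (k : ℕ) {t : ℝ} (ht : 0 < t) {Φ : HalfMinus → ℝ≥0∞}
    (hΦ : Measurable Φ) :
    ∫⁻ u, Φ u ∂mu = ∫⁻ u, Φ (dilate k t u) * ENNReal.ofReal ((t ^ 2) ^ pmCard k *
      Real.exp (-(t ^ 2 - 1) * (bracket k ^ 2 * massOn k u))) ∂mu := by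
  rcases Nat.eq_zero_or_pos k with rfl | hk
  · rw [lintegral_mu_setCoeff_mul 0 ht hΦ]
    refine lintegral_congr fun u => ?_
    congr 2
    · apply coeff_injective
      ext j
      rw [coeff_setCoeff, coeff_dilate]
      by_cases hj : j = 0 <;> simp [hj]
    · simp [pmCard, massOn]
  · have hne : (k : ℤ) ≠ -(k : ℤ) := by omega
    have hm : Measurable fun u : HalfMinus => Φ (setCoeff k (t * coeff u k) u) *
        ENNReal.ofReal (t ^ 2 * Real.exp (-(t ^ 2 - 1) * (bracket k ^ 2 * ‖coeff u k‖ ^ 2))) := by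
      have := measurable_coeff_apply k
      exact (hΦ.comp (measurable_setCoeff_mul k t)).mul (by fun_prop)
    rw [lintegral_mu_setCoeff_mul k ht hΦ, lintegral_mu_setCoeff_mul (-k) ht hm]
    refine lintegral_congr fun u => ?_
    rw [mul_assoc, ← ENNReal.ofReal_mul (by positivity)]
    congr 2
    · apply coeff_injective
      ext j
      rw [coeff_setCoeff, coeff_dilate, coeff_setCoeff, coeff_setCoeff, if_neg hne]
      have hj := mem_pm_iff k j
      rw [Finset.mem_insert, Finset.mem_singleton] at hj
      by_cases h1 : j = k
      · simp [h1]
      · by_cases h2 : j = -k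
        · rw [if_neg h1, if_pos h2, if_pos (hj.1 (Or.inr h2)), h2]
        · rw [if_neg h1, if_neg h2, if_neg (by tauto)]
    · rw [coeff_setCoeff_of_ne hne, bracket_neg, pmCard, Finset.card_pair hne, massOn,
        Finset.sum_pair hne, mul_mul_mul_comm, ← Real.exp_add, pow_two (t ^ 2)]
      congr 2
      ring

/-! ### The quartic form in Fourier coordinates -/

theorem integral_exp_int_mul (n : ℤ) :
    ∫ x in (0 : ℝ)..(2 * Real.pi), Complex.exp (Complex.I * n * x) =
      if n = 0 then 2 * (Real.pi : ℂ) else 0 := by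
  split_ifs with h
  · simp [h]
  · have hc : Complex.I * n ≠ 0 := mul_ne_zero Complex.I_ne_zero (by exact_mod_cast h)
    rw [integral_exp_mul_complex hc]
    have : Complex.exp (Complex.I * n * ((2 * Real.pi : ℝ) : ℂ)) = 1 := by
      rw [Complex.exp_eq_one_iff]
      exact ⟨n, by push_cast; ring⟩
    rw [this]
    simp

theorem proj_eq (Q : Set ℤ) (N : ℕ) (u : HalfMinus) (x : ℝ) :
    proj Q N u x = ∑ n ∈ Finset.Icc (-(N : ℤ)) (N : ℤ),
      Q.indicator (coeff u) n * Complex.exp (Complex.I * n * x) := by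
  refine Finset.sum_congr rfl fun n _ => ?_
  by_cases h : n ∈ Q <;> simp [h]

theorem hasDerivAt_proj (Q : Set ℤ) (N : ℕ) (u : HalfMinus) (x : ℝ) :
    HasDerivAt (proj Q N u) (∑ n ∈ Finset.Icc (-(N : ℤ)) (N : ℤ),
      Q.indicator (coeff u) n * (Complex.I * n) * Complex.exp (Complex.I * n * x)) x := by
  have : proj Q N u = fun x : ℝ => ∑ n ∈ Finset.Icc (-(N : ℤ)) (N : ℤ),
      Q.indicator (coeff u) n * Complex.exp (Complex.I * n * x) := funext (proj_eq Q N u)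
  rw [this]
  refine HasDerivAt.fun_sum fun n _ => ?_
  have h1 : HasDerivAt (fun x : ℝ => Complex.I * n * (x : ℂ)) (Complex.I * n) x := by
    simpa using (Complex.ofRealCLM.hasDerivAt (x := x)).const_mul (Complex.I * n)
  exact (h1.cexp.const_mul (Q.indicator (coeff u) n)).congr_deriv (by ring)

/-- The quadruples `(n₁, n₂, n₃, n₄)` of frequencies in `I` with `n₁ + n₂ = n₃ + n₄`. -/
def quadruples (I : Finset ℤ) : Finset (ℤ × ℤ × ℤ × ℤ) :=
  (I ×ˢ I ×ˢ I ×ˢ I).filter fun n => n.1 + n.2.1 = n.2.2.1 + n.2.2.2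

/-- Orthogonality of the exponentials selects `n₁ + n₂ = n₃ + n₄`, and the factor `i n₁` of the
derivative turns `-3i/2` into `3 n₁/2`. -/
theorem quadTerm_eq_sum (Q : Fin 4 → Set ℤ) (N : ℕ) (u : HalfMinus) :
    quadTerm Q N u = 3 / 2 * ∑ n ∈ quadruples (Finset.Icc (-(N : ℤ)) (N : ℤ)), (n.1 : ℝ) *
      ((Q 0).indicator (coeff u) n.1 * (Q 1).indicator (coeff u) n.2.1 *
        (starRingEnd ℂ) ((Q 2).indicator (coeff u) n.2.2.1) *
        (starRingEnd ℂ) ((Q 3).indicator (coeff u) n.2.2.2)).re := by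
  set I := Finset.Icc (-(N : ℤ)) (N : ℤ) with hI
  have hint : ∀ x : ℝ, deriv (proj (Q 0) N u) x * proj (Q 1) N u x *
      (starRingEnd ℂ) (proj (Q 2) N u x) * (starRingEnd ℂ) (proj (Q 3) N u x) =
      ∑ n ∈ I ×ˢ I ×ˢ I ×ˢ I, (Complex.I * n.1 * ((Q 0).indicator (coeff u) n.1 *
        (Q 1).indicator (coeff u) n.2.1 *
        (starRingEnd ℂ) ((Q 2).indicator (coeff u) n.2.2.1) *
        (starRingEnd ℂ) ((Q 3).indicator (coeff u) n.2.2.2))) *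
        Complex.exp (Complex.I * ((n.1 + n.2.1 - n.2.2.1 - n.2.2.2 : ℤ) : ℂ) * x) := by
    intro x
    rw [(hasDerivAt_proj _ _ _ _).deriv, proj_eq, proj_eq, proj_eq, map_sum, map_sum,
      mul_assoc, mul_assoc, Finset.sum_mul_sum, Finset.sum_mul_sum, Finset.sum_mul_sum]
    simp_rw [Finset.sum_product, Finset.mul_sum]
    have hc : ∀ n : ℤ, (starRingEnd ℂ) (Complex.exp (Complex.I * n * x)) =
        Complex.exp (-(Complex.I * n * x)) := fun n => by
      rw [← Complex.exp_conj]; simp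
    have he : ∀ a b c d : ℤ, Complex.exp (Complex.I * ((a + b - c - d : ℤ) : ℂ) * x) =
        Complex.exp (Complex.I * a * x) * Complex.exp (Complex.I * b * x) *
          Complex.exp (-(Complex.I * c * x)) * Complex.exp (-(Complex.I * d * x)) := by
      intro a b c d
      rw [← Complex.exp_add, ← Complex.exp_add, ← Complex.exp_add]
      congr 1
      push_cast; ring
    refine Finset.sum_congr rfl fun a _ => Finset.sum_congr rfl fun b _ => Finset.sum_congr rfl
      fun c _ => Finset.sum_congr rfl fun d _ => ?_
    rw [he, map_mul, map_mul, hc, hc]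
    ring
  rw [quadTerm, torusIntegral]
  simp_rw [hint]
  rw [intervalIntegral.integral_finsetSum fun n _ =>
    Continuous.intervalIntegrable (by fun_prop) _ _]
  simp_rw [intervalIntegral.integral_const_mul, integral_exp_int_mul]
  rw [quadruples, Finset.sum_filter, Finset.mul_sum, Finset.mul_sum, Finset.mul_sum, Complex.re_sum]
  refine Finset.sum_congr rfl fun n _ => ?_
  by_cases h : n.1 + n.2.1 = n.2.2.1 + n.2.2.2
  · rw [if_pos (by omega), if_pos h]
    set z := (Q 0).indicator (coeff u) n.1 *
        (Q 1).indicator (coeff u) n.2.1 *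
        (starRingEnd ℂ) ((Q 2).indicator (coeff u) n.2.2.1) *
        (starRingEnd ℂ) ((Q 3).indicator (coeff u) n.2.2.2)
    have hpi : (Real.pi : ℂ) ≠ 0 := by exact_mod_cast Real.pi_ne_zero
    have : -(3 * Complex.I / 2) * (1 / (2 * (Real.pi : ℂ)) * (Complex.I * n.1 * z *
        (2 * (Real.pi : ℂ)))) = ((3 / 2 * n.1 : ℝ) : ℂ) * z := by
      field_simp
      push_cast
      linear_combination (-3 * n.1 * z) * Complex.I_sq
    rw [this, Complex.re_ofReal_mul]
    ring
  · rw [if_neg (by omega), if_neg h]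
    simp

/-- `∂ₓ(u²) = 2 u ∂ₓu` accounts for the passage from `3/4` to `3/2`. -/
theorem energyTerm_eq_quadTerm (N : ℕ) (u : HalfMinus) :
    energyTerm N u = quadTerm ![Set.univ, Set.univ, Set.univ, Set.univ] N u := by
  have h : ∀ x : ℝ, (starRingEnd ℂ) (proj Set.univ N u x) ^ 2 *
      deriv (fun y => proj Set.univ N u y ^ 2) x = 2 * (deriv (proj Set.univ N u) x *
        proj Set.univ N u x * (starRingEnd ℂ) (proj Set.univ N u x) *
        (starRingEnd ℂ) (proj Set.univ N u x)) := by
    intro x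
    have h1 := hasDerivAt_proj Set.univ N u x
    rw [(h1.fun_pow 2).deriv, h1.deriv]
    push_cast
    ring
  rw [energyTerm, quadTerm, torusIntegral, torusIntegral]
  simp_rw [h]
  rw [intervalIntegral.integral_const_mul]
  simp only [Matrix.cons_val_zero, Matrix.cons_val_one, Matrix.cons_val]
  congr 1
  ring

theorem measurable_indicator_coeff (Q : Set ℤ) (n : ℤ) :
    Measurable fun u : HalfMinus => Q.indicator (coeff u) n := by
  by_cases h : n ∈ Q
  · simpa [h] using measurable_coeff_apply n
  · simp [h]

theorem measurable_quadTerm (Q : Fin 4 → Set ℤ) (N : ℕ) : Measurable (quadTerm Q N) := by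
  simp_rw [funext (quadTerm_eq_sum Q N)]
  refine (Finset.measurable_sum _ fun n _ => ?_).const_mul _
  have := measurable_indicator_coeff
  fun_prop

/-! ### Exponential moments of a quadratic polynomial of a complex Gaussian -/

theorem exp_le_one_add_add_sq_mul_exp (y : ℝ) :
    Real.exp y ≤ 1 + y + y ^ 2 * Real.exp |y| := by
  have h := Complex.norm_exp_sub_sum_le_norm_mul_exp (y : ℂ) 2
  have e : Complex.exp y - ∑ m ∈ Finset.range 2, (y : ℂ) ^ m / (m.factorial : ℂ) =
      ((Real.exp y - (1 + y) : ℝ) : ℂ) := by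
    simp [Finset.sum_range_succ]
  rw [e, Complex.norm_real, Complex.norm_real, Real.norm_eq_abs, Real.norm_eq_abs, sq_abs] at h
  linarith [le_abs_self (Real.exp y - (1 + y))]

theorem integrable_exp_half_norm_sq :
    Integrable (fun x : ℂ => Real.exp (1 / 2 * ‖x‖ ^ 2)) complexGaussian := by
  refine ⟨by fun_prop, ?_⟩
  rw [hasFiniteIntegral_iff_ofReal (ae_of_all _ fun x => by positivity),
    lintegral_exp_mul_norm_sq (by norm_num)]
  exact ENNReal.ofReal_lt_top

theorem integral_exp_half_norm_sq :
    ∫ x : ℂ, Real.exp (1 / 2 * ‖x‖ ^ 2) ∂complexGaussian = 2 := by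
  rw [integral_eq_lintegral_of_nonneg_ae (ae_of_all _ fun x => by positivity) (by fun_prop),
    lintegral_exp_mul_norm_sq (by norm_num), ENNReal.toReal_ofReal (by norm_num)]
  norm_num

theorem norm_sq_le_exp (x : ℂ) : ‖x‖ ^ 2 ≤ 8 * Real.exp (1 / 8 * ‖x‖ ^ 2) := by
  linarith [Real.add_one_le_exp (1 / 8 * ‖x‖ ^ 2)]

theorem norm_pow_four_le_exp (x : ℂ) : ‖x‖ ^ 4 ≤ 128 * Real.exp (1 / 8 * ‖x‖ ^ 2) := by
  have := Real.quadratic_le_exp_of_nonneg (x := 1 / 8 * ‖x‖ ^ 2) (by positivity)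
  nlinarith [sq_nonneg ‖x‖]

theorem exp_eighth_le_exp_half (x : ℂ) :
    Real.exp (1 / 8 * ‖x‖ ^ 2) ≤ Real.exp (1 / 2 * ‖x‖ ^ 2) :=
  Real.exp_le_exp.2 (by nlinarith [sq_nonneg ‖x‖])

theorem integrable_re_mul_sq (c : ℂ) :
    Integrable (fun x : ℂ => (c * x ^ 2).re) complexGaussian := by
  refine (integrable_exp_half_norm_sq.const_mul (‖c‖ * 8)).mono' (by fun_prop)
    (ae_of_all _ fun x => ?_)
  rw [Real.norm_eq_abs]
  refine (Complex.abs_re_le_norm _).trans ?_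
  rw [norm_mul, norm_pow, mul_assoc]
  gcongr
  exact (norm_sq_le_exp x).trans (by linarith [exp_eighth_le_exp_half x])

theorem integrable_re_mul (c : ℂ) : Integrable (fun x : ℂ => (c * x).re) complexGaussian := by
  refine (integrable_exp_half_norm_sq.const_mul (‖c‖ * 9)).mono' (by fun_prop)
    (ae_of_all _ fun x => ?_)
  rw [Real.norm_eq_abs]
  refine (Complex.abs_re_le_norm _).trans ?_
  rw [norm_mul, mul_assoc]
  gcongr
  have h1 := exp_eighth_le_exp_half x
  have h2 := norm_sq_le_exp x
  have h3 : (1 : ℝ) ≤ Real.exp (1 / 8 * ‖x‖ ^ 2) := Real.one_le_exp (by positivity)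
  nlinarith [sq_nonneg (‖x‖ - 1)]

theorem integral_comp_mul_complexGaussian (c : ℂ) (hc : ‖c‖ = 1) {f : ℂ → ℝ} (hf : Continuous f) :
    ∫ x, f (c * x) ∂complexGaussian = ∫ x, f x ∂complexGaussian := by
  have h := measurePreserving_complexGaussian_mul c hc
  conv_rhs => rw [← h.map_eq]
  rw [integral_map h.measurable.aemeasurable (by fun_prop)]

theorem integral_re_linear (c : ℂ) : ∫ x : ℂ, (c * x).re ∂complexGaussian = 0 := by
  have h := integral_comp_mul_complexGaussian (-1) (by simp) (f := fun x => (c * x).re)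
    (by fun_prop)
  have e : ∀ x : ℂ, (c * (-1 * x)).re = -(c * x).re := fun x => by simp
  simp_rw [e] at h
  rw [integral_neg] at h
  linarith

theorem integral_re_square (c : ℂ) : ∫ x : ℂ, (c * x ^ 2).re ∂complexGaussian = 0 := by
  have h := integral_comp_mul_complexGaussian Complex.I (by simp) (f := fun x => (c * x ^ 2).re)
    (by fun_prop)
  have e : ∀ x : ℂ, (c * (Complex.I * x) ^ 2).re = -(c * x ^ 2).re := fun x => by
    rw [mul_pow, Complex.I_sq, ← Complex.neg_re]
    congr 1
    ring
  simp_rw [e] at h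
  rw [integral_neg] at h
  linarith

/-- Both monomials have mean zero, so only the second-order remainder of the exponential
contributes, and the bound is quadratic in `α` and `β`. The condition on `β` keeps that remainder
below a multiple of `exp(‖x‖²/2)`, whose mean is 2. -/
theorem lintegral_exp_quadratic_le (α β : ℂ) (hβ : ‖β‖ ≤ 1 / 8) :
    ∫⁻ x : ℂ, ENNReal.ofReal (Real.exp ((α * x + β * x ^ 2).re)) ∂complexGaussian ≤
      ENNReal.ofReal (Real.exp (514 * (‖α‖ ^ 2 + ‖β‖ ^ 2))) := by
  set D : ℝ := 256 * (‖α‖ ^ 2 + ‖β‖ ^ 2) * Real.exp (2 * ‖α‖ ^ 2) with hD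
  have hpt : ∀ x : ℂ, Real.exp ((α * x + β * x ^ 2).re) ≤
      1 + ((α * x).re + (β * x ^ 2).re) + D * Real.exp (1 / 2 * ‖x‖ ^ 2) := by
    intro x
    set Z := (α * x + β * x ^ 2).re with hZ
    have hZ1 : |Z| ≤ ‖α‖ * ‖x‖ + ‖β‖ * ‖x‖ ^ 2 := by
      refine (Complex.abs_re_le_norm _).trans ((norm_add_le _ _).trans ?_)
      rw [norm_mul, norm_mul, norm_pow]
    -- Half of the `1/4` comes from Young's inequality for `‖α‖‖x‖`, the other half from `‖β‖ ≤
    -- 1/8`.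
    have hZ2 : |Z| ≤ 2 * ‖α‖ ^ 2 + 1 / 4 * ‖x‖ ^ 2 := by
      nlinarith [sq_nonneg (2 * ‖α‖ - 1 / 2 * ‖x‖), sq_nonneg ‖x‖]
    have hZ3 : Z ^ 2 ≤ 2 * (‖α‖ ^ 2 * ‖x‖ ^ 2 + ‖β‖ ^ 2 * ‖x‖ ^ 4) := by
      rw [← sq_abs]
      have := pow_le_pow_left₀ (abs_nonneg Z) hZ1 2
      nlinarith [sq_nonneg (‖α‖ * ‖x‖ - ‖β‖ * ‖x‖ ^ 2)]
    have hZ4 : Z ^ 2 ≤ 256 * (‖α‖ ^ 2 + ‖β‖ ^ 2) * Real.exp (1 / 8 * ‖x‖ ^ 2) := by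
      have h1 := mul_le_mul_of_nonneg_left (norm_sq_le_exp x) (sq_nonneg ‖α‖)
      have h2 := mul_le_mul_of_nonneg_left (norm_pow_four_le_exp x) (sq_nonneg ‖β‖)
      have h3 : 0 ≤ ‖α‖ ^ 2 * Real.exp (1 / 8 * ‖x‖ ^ 2) := by positivity
      nlinarith
    have h5 : Z ^ 2 * Real.exp |Z| ≤ D * Real.exp (1 / 2 * ‖x‖ ^ 2) := by
      calc Z ^ 2 * Real.exp |Z|
          ≤ (256 * (‖α‖ ^ 2 + ‖β‖ ^ 2) * Real.exp (1 / 8 * ‖x‖ ^ 2)) *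
            Real.exp (2 * ‖α‖ ^ 2 + 1 / 4 * ‖x‖ ^ 2) :=
              mul_le_mul hZ4 (Real.exp_le_exp.2 hZ2) (Real.exp_pos _).le (by positivity)
        _ = D * Real.exp (1 / 8 * ‖x‖ ^ 2 + 1 / 4 * ‖x‖ ^ 2) := by
              rw [hD, Real.exp_add, Real.exp_add]; ring
        _ ≤ D * Real.exp (1 / 2 * ‖x‖ ^ 2) := by
              gcongr
              nlinarith [sq_nonneg ‖x‖]
    have h6 := exp_le_one_add_add_sq_mul_exp Z
    have h7 : Z = (α * x).re + (β * x ^ 2).re := by rw [hZ, Complex.add_re]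
    linarith
  have i1 : Integrable (fun x : ℂ => (α * x).re + (β * x ^ 2).re) complexGaussian :=
    (integrable_re_mul α).add (integrable_re_mul_sq β)
  have i0 : Integrable (fun x : ℂ => 1 + ((α * x).re + (β * x ^ 2).re)) complexGaussian :=
    (integrable_const 1).add i1
  have i2 := integrable_exp_half_norm_sq.const_mul D
  have hint : Integrable (fun x : ℂ => 1 + ((α * x).re + (β * x ^ 2).re) +
      D * Real.exp (1 / 2 * ‖x‖ ^ 2)) complexGaussian := i0.add i2
  have hval : ∫ x : ℂ, (1 + ((α * x).re + (β * x ^ 2).re) +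
      D * Real.exp (1 / 2 * ‖x‖ ^ 2)) ∂complexGaussian = 1 + D * 2 := by
    rw [integral_add i0 i2, integral_add (integrable_const 1) i1,
      integral_add (integrable_re_mul α) (integrable_re_mul_sq β), integral_re_linear,
      integral_re_square, integral_const_mul, integral_exp_half_norm_sq]
    simp
  calc ∫⁻ x : ℂ, ENNReal.ofReal (Real.exp ((α * x + β * x ^ 2).re)) ∂complexGaussian
      ≤ ∫⁻ x : ℂ, ENNReal.ofReal (1 + ((α * x).re + (β * x ^ 2).re) +
          D * Real.exp (1 / 2 * ‖x‖ ^ 2)) ∂complexGaussian :=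
        lintegral_mono fun x => ENNReal.ofReal_le_ofReal (hpt x)
    _ = ENNReal.ofReal (1 + D * 2) := by
        rw [← ofReal_integral_eq_lintegral_ofReal hint
          (ae_of_all _ fun x => (Real.exp_pos _).le.trans (hpt x)), hval]
    _ ≤ _ := by
        apply ENNReal.ofReal_le_ofReal
        have h1 : (1 : ℝ) ≤ Real.exp (2 * ‖α‖ ^ 2) := Real.one_le_exp (by positivity)
        have h2 := Real.add_one_le_exp (512 * (‖α‖ ^ 2 + ‖β‖ ^ 2))
        -- The constant 514 is `512 + 2`: `2 · 256` from `D`, and 2 from the prefactor `exp(2‖α‖²)`.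
        calc 1 + D * 2 ≤ Real.exp (2 * ‖α‖ ^ 2) * (512 * (‖α‖ ^ 2 + ‖β‖ ^ 2) + 1) := by
              rw [hD]; nlinarith
          _ ≤ Real.exp (2 * ‖α‖ ^ 2) * Real.exp (512 * (‖α‖ ^ 2 + ‖β‖ ^ 2)) := by gcongr
          _ ≤ _ := by
              rw [← Real.exp_add, Real.exp_le_exp]
              nlinarith [sq_nonneg ‖β‖]

/-! ### The nonresonant part of the quartic form -/

/-- A summand of the quartic form, restricted to `n₁ + n₂ = n₃ + n₄` with `n₁ ∉ {n₃, n₄}`. -/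
def nonresTerm (c : Fin 4 → ℤ → ℂ) (n₁ n₂ n₃ n₄ : ℤ) : ℂ :=
  if n₁ + n₂ = n₃ + n₄ ∧ n₁ ≠ n₃ ∧ n₁ ≠ n₄ then
    (n₁ : ℂ) * (c 0 n₁ * c 1 n₂ * (starRingEnd ℂ) (c 2 n₃) * (starRingEnd ℂ) (c 3 n₄)) else 0

/-- The nonresonant part of the quartic form, over the frequencies in `I`. -/
def nonresSum (c : Fin 4 → ℤ → ℂ) (I : Finset ℤ) : ℂ :=
  ∑ n₁ ∈ I, ∑ n₂ ∈ I, ∑ n₃ ∈ I, ∑ n₄ ∈ I, nonresTerm c n₁ n₂ n₃ n₄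

/-- On `n₁ + n₂ = n₃ + n₄`, equality of `n₂` with one of `n₃, n₄` forces equality of `n₁` with the
other. Hence no frequency occurs both with and without a conjugate in a nonresonant term. -/
theorem nonresTerm_eq_zero (c : Fin 4 → ℤ → ℂ) {n₁ n₂ n₃ n₄ : ℤ}
    (h : n₁ = n₃ ∨ n₁ = n₄ ∨ n₂ = n₃ ∨ n₂ = n₄) : nonresTerm c n₁ n₂ n₃ n₄ = 0 := by
  rw [nonresTerm, if_neg]
  omega

/-- `∑ v_p v_q v_r` over `p, q, r ∈ I` with `q + r = a + p`. -/
def tripleSum (v : ℤ → ℝ) (I : Finset ℤ) (a : ℤ) : ℝ :=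
  ∑ p ∈ I, ∑ q ∈ I, ∑ r ∈ I, if q + r = a + p then v p * v q * v r else 0

theorem norm_triple_le {I : Finset ℤ} {f : ℤ → ℤ → ℤ → ℂ} {P : ℤ → ℤ → ℤ → Prop}
    [∀ p q r, Decidable (P p q r)] {v : ℤ → ℝ} {C : ℝ}
    (hf : ∀ p ∈ I, ∀ q ∈ I, ∀ r ∈ I, ‖f p q r‖ ≤ C * (v p * v q * v r)) :
    ‖∑ p ∈ I, ∑ q ∈ I, ∑ r ∈ I, if P p q r then f p q r else 0‖ ≤
      C * ∑ p ∈ I, ∑ q ∈ I, ∑ r ∈ I, if P p q r then v p * v q * v r else 0 := by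
  simp_rw [Finset.mul_sum]
  refine norm_sum_le_of_le _ fun p hp => norm_sum_le_of_le _ fun q hq =>
    norm_sum_le_of_le _ fun r hr => ?_
  split_ifs
  · exact hf p hp q hq r hr
  · simp

theorem norm_double_le {I : Finset ℤ} {f : ℤ → ℤ → ℂ} {P : ℤ → ℤ → Prop}
    [∀ p q, Decidable (P p q)] {v : ℤ → ℝ} {C : ℝ}
    (hf : ∀ p ∈ I, ∀ q ∈ I, ‖f p q‖ ≤ C * (v p * v q)) :
    ‖∑ p ∈ I, ∑ q ∈ I, if P p q then f p q else 0‖ ≤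
      C * ∑ p ∈ I, ∑ q ∈ I, if P p q then v p * v q else 0 := by
  simp_rw [Finset.mul_sum]
  refine norm_sum_le_of_le _ fun p hp => norm_sum_le_of_le _ fun q hq => ?_
  split_ifs
  · exact hf p hp q hq
  · simp

/-- `2 v_p v_q ≤ v_p² + v_q²`, and each index has at most one partner on the line `p + q = a`. -/
theorem sum_mul_antidiagonal_le (v : ℤ → ℝ) (I : Finset ℤ) (a : ℤ) :
    (∑ p ∈ I, ∑ q ∈ I, if p + q = a then v p * v q else 0) ≤ ∑ p ∈ I, v p ^ 2 := by
  have h1 : ∀ p ∈ I, ∀ q ∈ I, (if p + q = a then v p * v q else 0) ≤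
      (if p + q = a then v p ^ 2 / 2 else 0) + (if p + q = a then v q ^ 2 / 2 else 0) := by
    intro p _ q _
    split_ifs
    · nlinarith [sq_nonneg (v p - v q)]
    · simp
  have h2 : ∀ p ∈ I, (∑ q ∈ I, if p + q = a then v p ^ 2 / 2 else 0) ≤ v p ^ 2 / 2 := by
    intro p _
    have : ∀ q, (p + q = a) = (a - p = q) := fun q => by
      simp only [eq_iff_iff]; omega
    simp_rw [this]
    rw [Finset.sum_ite_eq]
    split_ifs
    · exact le_rfl
    · positivity
  have h3 : ∀ q ∈ I, (∑ p ∈ I, if p + q = a then v q ^ 2 / 2 else 0) ≤ v q ^ 2 / 2 := by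
    intro q _
    have : ∀ p, (p + q = a) = (a - q = p) := fun p => by
      simp only [eq_iff_iff]; omega
    simp_rw [this]
    rw [Finset.sum_ite_eq]
    split_ifs
    · exact le_rfl
    · positivity
  calc _ ≤ ∑ p ∈ I, ∑ q ∈ I, ((if p + q = a then v p ^ 2 / 2 else 0) +
        (if p + q = a then v q ^ 2 / 2 else 0)) :=
        Finset.sum_le_sum fun p hp => Finset.sum_le_sum fun q hq => h1 p hp q hq
    _ = (∑ p ∈ I, ∑ q ∈ I, if p + q = a then v p ^ 2 / 2 else 0) +
        ∑ q ∈ I, ∑ p ∈ I, if p + q = a then v q ^ 2 / 2 else 0 := by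
        simp_rw [Finset.sum_add_distrib]
        congr 1
        rw [Finset.sum_comm]
    _ ≤ (∑ p ∈ I, v p ^ 2 / 2) + ∑ q ∈ I, v q ^ 2 / 2 :=
        add_le_add (Finset.sum_le_sum h2) (Finset.sum_le_sum h3)
    _ = _ := by
        rw [← Finset.sum_add_distrib]
        exact Finset.sum_congr rfl fun p _ => by ring

/-- A term containing the new frequency `a` on both sides of `n₁ + n₂ = n₃ + n₄` is resonant, so the
dependence on `y` is holomorphic or antiholomorphic of degree at most two, without `|y|²` or cubic
terms. The factors `e i` are meant to be the indicators of `a ∈ Q i`. -/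
theorem nonresSum_insert (c : Fin 4 → ℤ → ℂ) (e : Fin 4 → ℝ) (y : ℂ) {I : Finset ℤ} {a : ℤ}
    (ha : a ∉ I) :
    nonresSum (fun i => Function.update (c i) a (e i * y)) (insert a I) = nonresSum c I +
      ((∑ p ∈ I, ∑ q ∈ I, ∑ r ∈ I, if q + r = a + p then
          (a : ℂ) * (e 0 * c 1 p * (starRingEnd ℂ) (c 2 q) * (starRingEnd ℂ) (c 3 r)) else 0) +
        (∑ p ∈ I, ∑ q ∈ I, ∑ r ∈ I, if q + r = a + p then
          (p : ℂ) * (c 0 p * e 1 * (starRingEnd ℂ) (c 2 q) * (starRingEnd ℂ) (c 3 r)) else 0)) * y +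
      (∑ p ∈ I, ∑ q ∈ I, if p + q = a + a then
          (a : ℂ) * (e 0 * e 1 * (starRingEnd ℂ) (c 2 p) * (starRingEnd ℂ) (c 3 q)) else 0) * y ^ 2 +
      ((∑ p ∈ I, ∑ q ∈ I, ∑ r ∈ I, if q + r = a + p then
          (q : ℂ) * (c 0 q * c 1 r * e 2 * (starRingEnd ℂ) (c 3 p)) else 0) +
        (∑ p ∈ I, ∑ q ∈ I, ∑ r ∈ I, if q + r = a + p then
          (q : ℂ) * (c 0 q * c 1 r * (starRingEnd ℂ) (c 2 p) * e 3) else 0)) *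
          (starRingEnd ℂ) y +
      (∑ p ∈ I, ∑ q ∈ I, if p + q = a + a then
          (p : ℂ) * (c 0 p * c 1 q * e 2 * e 3) else 0) * (starRingEnd ℂ) y ^ 2 := by
  set c' : Fin 4 → ℤ → ℂ := fun i => Function.update (c i) a (e i * y) with hc'
  have hs : ∀ i, c' i a = e i * y := fun i => by simp [hc']
  have hne : ∀ i, ∀ j ∈ I, c' i j = c i j := fun i j hj => by
    simp only [hc']
    rw [Function.update_of_ne (by rintro rfl; exact ha hj)]
  have hIa : ∀ j ∈ I, j ≠ a := by rintro j hj rfl; exact ha hj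
  have z1 : ∀ x y, nonresTerm c' a x a y = 0 := fun x y => nonresTerm_eq_zero _ (by simp)
  have z2 : ∀ x y, nonresTerm c' a x y a = 0 := fun x y => nonresTerm_eq_zero _ (by simp)
  have z3 : ∀ x y, nonresTerm c' x a a y = 0 := fun x y => nonresTerm_eq_zero _ (by simp)
  have z4 : ∀ x y, nonresTerm c' x a y a = 0 := fun x y => nonresTerm_eq_zero _ (by simp)
  -- Of the 16 ways to place `a`, the nine with `a` on both sides vanish by `z1`–`z4`; seven remain.
  have hexp : nonresSum c' (insert a I) =
      (∑ p ∈ I, ∑ q ∈ I, ∑ r ∈ I, ∑ s ∈ I, nonresTerm c' p q r s) +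
      (∑ p ∈ I, ∑ q ∈ I, ∑ r ∈ I, nonresTerm c' a p q r) +
      (∑ p ∈ I, ∑ q ∈ I, ∑ r ∈ I, nonresTerm c' p a q r) +
      (∑ q ∈ I, ∑ r ∈ I, nonresTerm c' a a q r) +
      (∑ q ∈ I, ∑ r ∈ I, ∑ p ∈ I, nonresTerm c' q r a p) +
      (∑ q ∈ I, ∑ r ∈ I, ∑ p ∈ I, nonresTerm c' q r p a) +
      (∑ p ∈ I, ∑ q ∈ I, nonresTerm c' p q a a) := by
    simp only [nonresSum, Finset.sum_insert ha, Finset.sum_add_distrib, z1, z2, z3, z4,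
      Finset.sum_const_zero, zero_add, add_zero]
    ring
  have s0 : (∑ p ∈ I, ∑ q ∈ I, ∑ r ∈ I, ∑ s ∈ I, nonresTerm c' p q r s) = nonresSum c I := by
    refine Finset.sum_congr rfl fun p hp => Finset.sum_congr rfl fun q hq =>
      Finset.sum_congr rfl fun r hr => Finset.sum_congr rfl fun s hs => ?_
    rw [nonresTerm, nonresTerm, hne 0 p hp, hne 1 q hq, hne 2 r hr, hne 3 s hs]
  have s1 : ∀ p ∈ I, ∀ q ∈ I, ∀ r ∈ I, nonresTerm c' a p q r = (if q + r = a + p then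
      (a : ℂ) * (e 0 * c 1 p * (starRingEnd ℂ) (c 2 q) * (starRingEnd ℂ) (c 3 r)) else 0) * y := by
    intro p hp q hq r hr
    have := hIa p hp; have := hIa q hq; have := hIa r hr
    rw [nonresTerm, hs, hne 1 p hp, hne 2 q hq, hne 3 r hr]
    by_cases h : q + r = a + p
    · rw [if_pos (by omega), if_pos h]; ring
    · rw [if_neg (by omega), if_neg h, zero_mul]
  have s2 : ∀ p ∈ I, ∀ q ∈ I, ∀ r ∈ I, nonresTerm c' p a q r = (if q + r = a + p then
      (p : ℂ) * (c 0 p * e 1 * (starRingEnd ℂ) (c 2 q) * (starRingEnd ℂ) (c 3 r)) else 0) * y := by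
    intro p hp q hq r hr
    have := hIa p hp; have := hIa q hq; have := hIa r hr
    rw [nonresTerm, hs, hne 0 p hp, hne 2 q hq, hne 3 r hr]
    by_cases h : q + r = a + p
    · rw [if_pos (by omega), if_pos h]; ring
    · rw [if_neg (by omega), if_neg h, zero_mul]
  have s3 : ∀ p ∈ I, ∀ q ∈ I, nonresTerm c' a a p q = (if p + q = a + a then
      (a : ℂ) * (e 0 * e 1 * (starRingEnd ℂ) (c 2 p) * (starRingEnd ℂ) (c 3 q)) else 0) * y ^ 2 := by
    intro p hp q hq
    have := hIa p hp; have := hIa q hq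
    rw [nonresTerm, hs, hs, hne 2 p hp, hne 3 q hq]
    by_cases h : p + q = a + a
    · rw [if_pos (by omega), if_pos h]; ring
    · rw [if_neg (by omega), if_neg h, zero_mul]
  have s4 : ∀ p ∈ I, ∀ q ∈ I, ∀ r ∈ I, nonresTerm c' q r a p = (if q + r = a + p then
      (q : ℂ) * (c 0 q * c 1 r * e 2 * (starRingEnd ℂ) (c 3 p)) else 0) * (starRingEnd ℂ) y := by
    intro p hp q hq r hr
    have := hIa p hp; have := hIa q hq; have := hIa r hr
    rw [nonresTerm, hs, hne 0 q hq, hne 1 r hr, hne 3 p hp]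
    by_cases h : q + r = a + p
    · rw [if_pos (by omega), if_pos h, map_mul, Complex.conj_ofReal]; ring
    · rw [if_neg (by omega), if_neg h, zero_mul]
  have s5 : ∀ p ∈ I, ∀ q ∈ I, ∀ r ∈ I, nonresTerm c' q r p a = (if q + r = a + p then
      (q : ℂ) * (c 0 q * c 1 r * (starRingEnd ℂ) (c 2 p) * e 3) else 0) * (starRingEnd ℂ) y := by
    intro p hp q hq r hr
    have := hIa p hp; have := hIa q hq; have := hIa r hr
    rw [nonresTerm, hs, hne 0 q hq, hne 1 r hr, hne 2 p hp]
    by_cases h : q + r = a + p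
    · rw [if_pos (by omega), if_pos h, map_mul, Complex.conj_ofReal]; ring
    · rw [if_neg (by omega), if_neg h, zero_mul]
  have s6 : ∀ p ∈ I, ∀ q ∈ I, nonresTerm c' p q a a = (if p + q = a + a then
      (p : ℂ) * (c 0 p * c 1 q * e 2 * e 3) else 0) * (starRingEnd ℂ) y ^ 2 := by
    intro p hp q hq
    have := hIa p hp; have := hIa q hq
    rw [nonresTerm, hs, hs, hne 0 p hp, hne 1 q hq]
    by_cases h : p + q = a + a
    · rw [if_pos (by omega), if_pos h, map_mul, map_mul, Complex.conj_ofReal,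
        Complex.conj_ofReal]; ring
    · rw [if_neg (by omega), if_neg h, zero_mul]
  have comm3 : ∀ f : ℤ → ℤ → ℤ → ℂ, (∑ q ∈ I, ∑ r ∈ I, ∑ p ∈ I, f p q r) =
      ∑ p ∈ I, ∑ q ∈ I, ∑ r ∈ I, f p q r := fun f => by
    simp_rw [Finset.sum_comm (s := I) (t := I) (f := fun r p => f p _ r)]
    rw [Finset.sum_comm]
  rw [hexp, s0, comm3 fun p q r => nonresTerm c' q r a p, comm3 fun p q r => nonresTerm c' q r p a]
  simp_rw [add_mul, Finset.sum_mul]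
  rw [Finset.sum_congr rfl fun p hp => Finset.sum_congr rfl fun q hq =>
      Finset.sum_congr rfl fun r hr => s1 p hp q hq r hr,
    Finset.sum_congr rfl fun p hp => Finset.sum_congr rfl fun q hq =>
      Finset.sum_congr rfl fun r hr => s2 p hp q hq r hr,
    Finset.sum_congr rfl fun p hp => Finset.sum_congr rfl fun q hq => s3 p hp q hq,
    Finset.sum_congr rfl fun p hp => Finset.sum_congr rfl fun q hq =>
      Finset.sum_congr rfl fun r hr => s4 p hp q hq r hr,
    Finset.sum_congr rfl fun p hp => Finset.sum_congr rfl fun q hq =>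
      Finset.sum_congr rfl fun r hr => s5 p hp q hq r hr,
    Finset.sum_congr rfl fun p hp => Finset.sum_congr rfl fun q hq => s6 p hp q hq]
  ring

/-- Under the real part the antiholomorphic terms may be conjugated, so four linear contributions
merge into `α` and two quadratic ones into `β`. The derivative weight is at most `|a|` in each
because no frequency in `I` exceeds `a` in modulus. -/
theorem exists_nonresSum_insert (c : Fin 4 → ℤ → ℂ) (e : Fin 4 → ℝ) {I : Finset ℤ} {a : ℤ}
    (ha : a ∉ I) (v : ℤ → ℝ) (hv : ∀ j, 0 ≤ v j) (hc : ∀ i, ∀ j ∈ I, ‖c i j‖ ≤ v j)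
    (he : ∀ i, |e i| ≤ 1) (hI : ∀ j ∈ I, |(j : ℝ)| ≤ |(a : ℝ)|) :
    ∃ α β : ℂ, ‖α‖ ≤ 4 * |(a : ℝ)| * tripleSum v I a ∧ ‖β‖ ≤ 2 * |(a : ℝ)| * ∑ j ∈ I, v j ^ 2 ∧
      ∀ y : ℂ, (nonresSum (fun i => Function.update (c i) a (e i * y)) (insert a I)).re =
        (nonresSum c I).re + (α * y + β * y ^ 2).re := by
  have hn : ∀ n : ℤ, ‖(n : ℂ)‖ = |(n : ℝ)| := fun n => by
    rw [← Complex.ofReal_intCast, Complex.norm_real, Real.norm_eq_abs]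
  have hee : ∀ i, ‖((e i : ℝ) : ℂ)‖ ≤ 1 := fun i => by
    rw [Complex.norm_real, Real.norm_eq_abs]; exact he i
  have b3 : ∀ (n : ℤ) (i j k l : ℂ) (s t w : ℝ), |(n : ℝ)| ≤ |(a : ℝ)| → ‖i‖ ≤ 1 → ‖j‖ ≤ s →
      ‖k‖ ≤ t → ‖l‖ ≤ w → 0 ≤ s → 0 ≤ t →
      |(n : ℝ)| * (‖i‖ * ‖j‖ * ‖k‖ * ‖l‖) ≤ |(a : ℝ)| * (s * t * w) := by
    intro n i j k l s t w h1 h2 h3 h4 h5 h6 h7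
    have : ‖i‖ * ‖j‖ * ‖k‖ * ‖l‖ ≤ 1 * s * t * w := by gcongr
    rw [one_mul] at this
    gcongr
  set A0 := ∑ p ∈ I, ∑ q ∈ I, ∑ r ∈ I, if q + r = a + p then
    (a : ℂ) * (e 0 * c 1 p * (starRingEnd ℂ) (c 2 q) * (starRingEnd ℂ) (c 3 r)) else 0 with hA0
  set A1 := ∑ p ∈ I, ∑ q ∈ I, ∑ r ∈ I, if q + r = a + p then
    (p : ℂ) * (c 0 p * e 1 * (starRingEnd ℂ) (c 2 q) * (starRingEnd ℂ) (c 3 r)) else 0 with hA1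
  set B0 := ∑ p ∈ I, ∑ q ∈ I, if p + q = a + a then
    (a : ℂ) * (e 0 * e 1 * (starRingEnd ℂ) (c 2 p) * (starRingEnd ℂ) (c 3 q)) else 0 with hB0
  set A2 := ∑ p ∈ I, ∑ q ∈ I, ∑ r ∈ I, if q + r = a + p then
    (q : ℂ) * (c 0 q * c 1 r * e 2 * (starRingEnd ℂ) (c 3 p)) else 0 with hA2
  set A3 := ∑ p ∈ I, ∑ q ∈ I, ∑ r ∈ I, if q + r = a + p then
    (q : ℂ) * (c 0 q * c 1 r * (starRingEnd ℂ) (c 2 p) * e 3) else 0 with hA3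
  set B1 := ∑ p ∈ I, ∑ q ∈ I, if p + q = a + a then
    (p : ℂ) * (c 0 p * c 1 q * e 2 * e 3) else 0 with hB1
  have nA0 : ‖A0‖ ≤ |(a : ℝ)| * tripleSum v I a := by
    refine norm_triple_le fun p hp q hq r hr => ?_
    simp only [norm_mul, RCLike.norm_conj, hn]
    exact b3 a _ _ _ _ _ _ _ le_rfl (hee 0) (hc 1 p hp) (hc 2 q hq) (hc 3 r hr) (hv p) (hv q)
  have nA1 : ‖A1‖ ≤ |(a : ℝ)| * tripleSum v I a := by
    refine norm_triple_le fun p hp q hq r hr => ?_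
    simp only [norm_mul, RCLike.norm_conj, hn]
    rw [mul_comm ‖c 0 p‖]
    exact b3 p _ _ _ _ _ _ _ (hI p hp) (hee 1) (hc 0 p hp) (hc 2 q hq) (hc 3 r hr) (hv p) (hv q)
  have nA2 : ‖A2‖ ≤ |(a : ℝ)| * tripleSum v I a := by
    refine norm_triple_le fun p hp q hq r hr => ?_
    simp only [norm_mul, RCLike.norm_conj, hn]
    have := b3 q _ _ _ _ _ _ _ (hI q hq) (hee 2) (hc 3 p hp) (hc 0 q hq) (hc 1 r hr) (hv p) (hv q)
    linarith
  have nA3 : ‖A3‖ ≤ |(a : ℝ)| * tripleSum v I a := by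
    refine norm_triple_le fun p hp q hq r hr => ?_
    simp only [norm_mul, RCLike.norm_conj, hn]
    have := b3 q _ _ _ _ _ _ _ (hI q hq) (hee 3) (hc 2 p hp) (hc 0 q hq) (hc 1 r hr) (hv p) (hv q)
    linarith
  have hW := sum_mul_antidiagonal_le v I (a + a)
  have nB0 : ‖B0‖ ≤ |(a : ℝ)| * ∑ j ∈ I, v j ^ 2 := by
    refine (norm_double_le (v := v) fun p hp q hq => ?_).trans
      (mul_le_mul_of_nonneg_left hW (abs_nonneg _))
    simp only [norm_mul, RCLike.norm_conj, hn]
    have := b3 a _ _ _ _ _ _ _ le_rfl (hee 0) (hee 1) (hc 2 p hp) (hc 3 q hq) zero_le_one (hv p)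
    linarith
  have nB1 : ‖B1‖ ≤ |(a : ℝ)| * ∑ j ∈ I, v j ^ 2 := by
    refine (norm_double_le (v := v) fun p hp q hq => ?_).trans
      (mul_le_mul_of_nonneg_left hW (abs_nonneg _))
    simp only [norm_mul, hn]
    have := b3 p _ _ _ _ _ _ _ (hI p hp) (hee 2) (hee 3) (hc 0 p hp) (hc 1 q hq) zero_le_one (hv p)
    linarith
  refine ⟨A0 + A1 + (starRingEnd ℂ) (A2 + A3), B0 + (starRingEnd ℂ) B1, ?_, ?_, fun y => ?_⟩
  · calc ‖A0 + A1 + (starRingEnd ℂ) (A2 + A3)‖ ≤ ‖A0‖ + ‖A1‖ + (‖A2‖ + ‖A3‖) := by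
          refine (norm_add_le _ _).trans (add_le_add (norm_add_le _ _) ?_)
          rw [RCLike.norm_conj]
          exact norm_add_le _ _
      _ ≤ _ := by linarith
  · calc ‖B0 + (starRingEnd ℂ) B1‖ ≤ ‖B0‖ + ‖B1‖ := by
          refine (norm_add_le _ _).trans ?_
          rw [RCLike.norm_conj]
      _ ≤ _ := by linarith
  · have hre : ∀ z w : ℂ, ((starRingEnd ℂ) z * w).re = (z * (starRingEnd ℂ) w).re := fun z w => by
      simp
    rw [nonresSum_insert c e y ha, add_mul (A0 + A1), add_mul B0]
    simp only [Complex.add_re, hre, map_pow]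
    ring

/-! ### An exponential supermartingale for the nonresonant part -/

/-- The moduli of the Fourier coefficients. -/
def amp (u : HalfMinus) (n : ℤ) : ℝ := ‖coeff u n‖

/-- The Fourier coefficients restricted to the sets `Q i`. -/
def restrCoeff (Q : Fin 4 → Set ℤ) (u : HalfMinus) (i : Fin 4) : ℤ → ℂ := (Q i).indicator (coeff u)

theorem amp_nonneg (u : HalfMinus) (n : ℤ) : 0 ≤ amp u n := norm_nonneg _

theorem measurable_amp (n : ℤ) : Measurable fun u => amp u n := (measurable_coeff_apply n).norm

theorem measurable_restrCoeff (Q : Fin 4 → Set ℤ) (i : Fin 4) (n : ℤ) :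
    Measurable fun u => restrCoeff Q u i n := measurable_indicator_coeff (Q i) n

theorem norm_restrCoeff_le (Q : Fin 4 → Set ℤ) (u : HalfMinus) (i : Fin 4) (n : ℤ) :
    ‖restrCoeff Q u i n‖ ≤ amp u n := norm_indicator_le_norm_self (coeff u) n

theorem restrCoeff_setCoeff (Q : Fin 4 → Set ℤ) (u : HalfMinus) (a : ℤ) (y : ℂ) :
    restrCoeff Q (setCoeff a y u) = fun i => Function.update (restrCoeff Q u i) a
      ((((Q i).indicator (fun _ => 1) a : ℝ) : ℂ) * y) := by
  ext i j
  by_cases h : j = a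
  · subst h
    by_cases hQ : j ∈ Q i <;> simp [restrCoeff, hQ, coeff_setCoeff]
  · rw [Function.update_of_ne h]
    by_cases hQ : j ∈ Q i <;> simp [restrCoeff, hQ, coeff_setCoeff, h]

theorem measurable_nonresSum (Q : Fin 4 → Set ℤ) (I : Finset ℤ) :
    Measurable fun u => (nonresSum (restrCoeff Q u) I).re := by
  refine Complex.measurable_re.comp (Finset.measurable_sum _ fun p _ => Finset.measurable_sum _
    fun q _ => Finset.measurable_sum _ fun r _ => Finset.measurable_sum _ fun s _ => ?_)
  simp only [nonresTerm]
  have := measurable_restrCoeff Q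
  split_ifs <;> fun_prop

theorem measurable_tripleSum (I : Finset ℤ) (a : ℤ) :
    Measurable fun u => tripleSum (amp u) I a := by
  refine Finset.measurable_sum _ fun p _ => Finset.measurable_sum _
    fun q _ => Finset.measurable_sum _ fun r _ => ?_
  have := measurable_amp
  split_ifs <;> fun_prop

theorem tripleSum_nonneg {v : ℤ → ℝ} (hv : ∀ j, 0 ≤ v j) (I : Finset ℤ) (a : ℤ) :
    0 ≤ tripleSum v I a := by
  refine Finset.sum_nonneg fun p _ => Finset.sum_nonneg fun q _ => Finset.sum_nonneg fun r _ => ?_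
  have := hv p; have := hv q; have := hv r
  split_ifs <;> positivity

theorem tripleSum_mono {v : ℤ → ℝ} (hv : ∀ j, 0 ≤ v j) {I J : Finset ℤ} (h : I ⊆ J) (a : ℤ) :
    tripleSum v I a ≤ tripleSum v J a := by
  have h0 : ∀ p q r, 0 ≤ if q + r = a + p then v p * v q * v r else 0 := fun p q r => by
    have := hv p; have := hv q; have := hv r
    split_ifs <;> positivity
  refine (Finset.sum_le_sum fun p _ => (Finset.sum_le_sum fun q _ =>
    Finset.sum_le_sum_of_subset_of_nonneg h fun r _ _ => h0 p q r).trans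
    (Finset.sum_le_sum_of_subset_of_nonneg h fun q _ _ => Finset.sum_nonneg fun r _ => h0 p q r)).trans
    (Finset.sum_le_sum_of_subset_of_nonneg h fun p _ _ =>
      Finset.sum_nonneg fun q _ => Finset.sum_nonneg fun r _ => h0 p q r)

theorem tripleSum_setCoeff {I : Finset ℤ} {n : ℤ} (hn : n ∉ I) (x : ℂ) (u : HalfMinus) (a : ℤ) :
    tripleSum (amp (setCoeff n x u)) I a = tripleSum (amp u) I a := by
  have h : ∀ j ∈ I, amp (setCoeff n x u) j = amp u j := fun j hj => by
    rw [amp, coeff_setCoeff_of_ne (by rintro rfl; exact hn hj), amp]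
  refine Finset.sum_congr rfl fun p hp => Finset.sum_congr rfl fun q hq =>
    Finset.sum_congr rfl fun r hr => ?_
  rw [h p hp, h q hq, h r hr]

/-- The mass carried by the frequencies in `I`. -/
def massIn (I : Finset ℤ) (u : HalfMinus) : ℝ := ∑ j ∈ I, amp u j ^ 2

theorem measurable_massIn (I : Finset ℤ) : Measurable (massIn I) :=
  Finset.measurable_sum _ fun j _ => (measurable_amp j).pow_const 2

theorem massIn_le_mass (I : Finset ℤ) (u : HalfMinus) : massIn I u ≤ mass u.1 := by
  rw [mass_eq_tsum]
  exact (summable_norm_sq_coeff u).sum_le_tsum I fun _ _ => by positivity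

/-- An exponential supermartingale: at each step integrate out the newest coefficient and put the
resulting Gaussian cost into `A`, which depends on older coefficients only. The fixed set `J` bounds
the running cubic sums by those over the final frequency set. -/
theorem exists_nonres_compensator (Q : Fin 4 → Set ℤ) {lam m₀ : ℝ} (hlam : 0 ≤ lam)
    (hm : 16 * lam * m₀ ≤ 1) (J I : Finset ℤ) (hIJ : I ⊆ J) :
    ∃ A : HalfMinus → ℝ, Measurable A ∧ (∀ n, n ∉ I → ∀ x u, A (setCoeff n x u) = A u) ∧
      (∀ u, A u ≤ ∑ a ∈ I, 514 * ((4 * lam * tripleSum (amp u) J a) ^ 2 +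
        (2 * lam * m₀ / bracket a) ^ 2)) ∧
      ∫⁻ u, {u | massIn I u < m₀}.indicator (fun u =>
        ENNReal.ofReal (Real.exp (lam * (nonresSum (restrCoeff Q u) I).re - A u))) u ∂mu ≤ 1 := by
  revert hIJ
  -- Revealing the frequencies by increasing modulus makes `|a|` bound every derivative weight in
  -- the increment.
  refine Finset.induction_on_max_value (fun n : ℤ => |(n : ℝ)|) I ?_ ?_
  · refine fun _ => ⟨fun _ => 0, measurable_const, fun _ _ _ _ => rfl, fun u => by simp, ?_⟩
    calc _ ≤ ∫⁻ _, 1 ∂mu := lintegral_mono fun u => by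
          refine Set.indicator_le (s := {u | massIn ∅ u < m₀}) (g := fun _ => 1) (fun u _ => ?_) u
          simp [nonresSum]
      _ = 1 := by simp
  · intro a I ha hmax ih hIJ
    obtain ⟨A, hAm, hAI, hAle, hA⟩ := ih ((Finset.subset_insert a I).trans hIJ)
    set D : HalfMinus → ℝ := fun u => 514 * ((4 * lam * tripleSum (amp u) I a) ^ 2 +
      (2 * lam * m₀ / bracket a) ^ 2) with hD
    have hDm : Measurable D := by
      have := measurable_tripleSum I a
      fun_prop
    have hDn : ∀ n, n ∉ I → ∀ x u, D (setCoeff n x u) = D u := fun n hn x u => by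
      simp only [hD, tripleSum_setCoeff hn]
    refine ⟨fun u => A u + D u, hAm.add hDm, fun n hn x u => ?_, fun u => ?_, ?_⟩
    · have hn' : n ∉ I := fun h => hn (Finset.mem_insert_of_mem h)
      exact congrArg₂ (· + ·) (hAI n hn' x u) (hDn n hn' x u)
    · rw [Finset.sum_insert ha]
      refine (add_comm (A u) (D u)).trans_le (add_le_add ?_ (hAle u))
      have h1 := tripleSum_mono (amp_nonneg u) ((Finset.subset_insert a I).trans hIJ) a
      have h0 := tripleSum_nonneg (amp_nonneg u) I a
      simp only [hD]
      gcongr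
    · have hmeas : ∀ (K : Finset ℤ) (B : HalfMinus → ℝ), Measurable B →
          Measurable ({u | massIn K u < m₀}.indicator (fun u =>
            ENNReal.ofReal (Real.exp (lam * (nonresSum (restrCoeff Q u) K).re - B u)))) := by
        intro K B hB
        have := measurable_nonresSum Q K
        refine Measurable.indicator (by fun_prop)
          (measurableSet_lt (measurable_massIn K) measurable_const)
      have hmm := hmeas (insert a I) (fun u => A u + D u) (hAm.add hDm)
      rw [lintegral_mu_resample a hmm]
      refine le_trans (lintegral_mono fun u => ?_) hA
      by_cases hu : massIn I u < m₀
      · rw [Set.indicator_of_mem (by exact hu)]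
        obtain ⟨α, β, hα, hβ, hαβ⟩ := exists_nonresSum_insert (restrCoeff Q u)
          (fun i => (Q i).indicator (fun _ => 1) a) ha (amp u) (amp_nonneg u)
          (fun i j _ => norm_restrCoeff_le Q u i j)
          (fun i => by by_cases h : a ∈ Q i <;> simp [h]) hmax
        have hb := bracket_pos a
        have hab : |(a : ℝ)| / bracket a ≤ 1 := (div_le_one hb).2 (abs_le_bracket a)
        -- The coefficients relative to the standard Gaussian `⟨a⟩ û(a)`; the divisions by `⟨a⟩`
        -- absorb the factor `|a|` in `α` and `β`.
        set α' : ℂ := lam * α / bracket a with hα'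
        set β' : ℂ := lam * β / bracket a ^ 2 with hβ'
        have hT := tripleSum_nonneg (amp_nonneg u) I a
        have hm0 : 0 ≤ massIn I u := Finset.sum_nonneg fun _ _ => by positivity
        have nα : ‖α'‖ ≤ 4 * lam * tripleSum (amp u) I a := by
          rw [hα', norm_div, norm_mul, Complex.norm_real, Complex.norm_real,
            Real.norm_of_nonneg hlam, Real.norm_of_nonneg hb.le, div_le_iff₀ hb]
          calc lam * ‖α‖ ≤ lam * (4 * bracket a * tripleSum (amp u) I a) := by
                refine mul_le_mul_of_nonneg_left (hα.trans ?_) hlam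
                gcongr
                exact abs_le_bracket a
            _ = _ := by ring
        have nβ : ‖β'‖ ≤ 2 * lam * m₀ / bracket a := by
          rw [hβ', norm_div, norm_mul, norm_pow, Complex.norm_real, Complex.norm_real,
            Real.norm_of_nonneg hlam, Real.norm_of_nonneg hb.le, div_le_div_iff₀ (by positivity) hb]
          calc lam * ‖β‖ * bracket a ≤ lam * (2 * bracket a * m₀) * bracket a := by
                gcongr
                refine hβ.trans ?_
                have := abs_le_bracket a
                change 2 * |(a : ℝ)| * massIn I u ≤ _
                gcongr
            _ = _ := by ring
        -- `16 lam m₀ ≤ 1` is exactly `2 lam m₀ ≤ 1/8`.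
        have nβ' : ‖β'‖ ≤ 1 / 8 := by
          refine nβ.trans ?_
          rw [div_le_iff₀ hb]
          linarith [one_le_bracket a]
        have key := lintegral_exp_quadratic_le α' β' nβ'
        calc ∫⁻ x, {u | massIn (insert a I) u < m₀}.indicator (fun u => ENNReal.ofReal (Real.exp
                (lam * (nonresSum (restrCoeff Q u) (insert a I)).re - (A u + D u))))
                (setCoeff a (x / (bracket a : ℂ)) u) ∂complexGaussian
            ≤ ∫⁻ x, ENNReal.ofReal (Real.exp
                (lam * (nonresSum (restrCoeff Q u) I).re - (A u + D u))) *
                ENNReal.ofReal (Real.exp ((α' * x + β' * x ^ 2).re)) ∂complexGaussian := by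
              refine lintegral_mono fun x => ?_
              refine (Set.indicator_le_self _ _ _).trans ?_
              rw [hAI a ha, hDn a ha, restrCoeff_setCoeff, hαβ,
                ← ENNReal.ofReal_mul (Real.exp_pos _).le, ← Real.exp_add]
              apply ENNReal.ofReal_le_ofReal
              rw [Real.exp_le_exp]
              have : α' * x + β' * x ^ 2 =
                  (lam : ℂ) * (α * (x / bracket a) + β * (x / bracket a) ^ 2) := by
                rw [hα', hβ']; ring
              rw [this, Complex.re_ofReal_mul]
              apply le_of_eq
              ring
          _ = ENNReal.ofReal (Real.exp
                (lam * (nonresSum (restrCoeff Q u) I).re - (A u + D u))) *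
                ∫⁻ x, ENNReal.ofReal (Real.exp ((α' * x + β' * x ^ 2).re)) ∂complexGaussian :=
              lintegral_const_mul _ (by fun_prop)
          _ ≤ ENNReal.ofReal (Real.exp
                (lam * (nonresSum (restrCoeff Q u) I).re - (A u + D u))) *
                ENNReal.ofReal (Real.exp (D u)) := by
              gcongr
              refine key.trans (ENNReal.ofReal_le_ofReal (Real.exp_le_exp.2 ?_))
              simp only [hD]
              gcongr
          _ = _ := by
              rw [← ENNReal.ofReal_mul (Real.exp_pos _).le, ← Real.exp_add]
              congr 2
              ring
      -- The mass restriction is inherited: if `I` already carries mass at least `m₀`, so does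
      -- `insert a I`, whatever the new coefficient.
      · rw [Set.indicator_of_notMem (by exact hu)]
        refine le_of_eq ((lintegral_congr fun x =>
          Set.indicator_of_notMem (fun h => hu ?_) _).trans lintegral_zero)
        refine lt_of_le_of_lt ?_ h
        rw [massIn, massIn, Finset.sum_insert ha]
        refine le_trans (le_of_eq (Finset.sum_congr rfl fun j hj => ?_))
          (le_add_of_nonneg_left (sq_nonneg _))
        rw [amp, amp, coeff_setCoeff_of_ne (by rintro rfl; exact ha hj)]

/-! ### Exponential moments of the compensator -/

theorem mul_sq_le_of_cubes {x y z : ℝ} (hx : 0 ≤ x) (hy : 0 ≤ y) (hz : 0 ≤ z) :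
    x ^ 2 * y ^ 2 * z ^ 2 ≤ (x ^ 3 * y ^ 3 + y ^ 3 * z ^ 3 + x ^ 3 * z ^ 3) / 3 := by
  have key : ∀ a b c : ℝ, 0 ≤ a → 0 ≤ b → 0 ≤ c → 3 * (a * b * c) ≤ a ^ 3 + b ^ 3 + c ^ 3 := by
    intro a b c ha hb hc
    have : 0 ≤ (a + b + c) * ((a - b) ^ 2 + (b - c) ^ 2 + (a - c) ^ 2) := by positivity
    nlinarith
  have := key (x * y) (y * z) (x * z) (by positivity) (by positivity) (by positivity)
  nlinarith

/-- Cauchy–Schwarz with weights `s_p s_q s_r`. On `q + r = a + p` two of the indices determine the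
third, so after the arithmetic–geometric inequality the weight sum is bounded by three double sums
of `s³ s³`. -/
theorem tripleSum_sq_le (v s : ℤ → ℝ) (hs : ∀ j, 0 < s j) (J : Finset ℤ)
    (a : ℤ) : tripleSum v J a ^ 2 ≤ (∑ j ∈ J, s j ^ 3) ^ 2 *
      ∑ p ∈ J, ∑ q ∈ J, ∑ r ∈ J, if q + r = a + p then
        (v p ^ 2 / s p ^ 2) * (v q ^ 2 / s q ^ 2) * (v r ^ 2 / s r ^ 2) else 0 := by
  set S := (J ×ˢ J ×ˢ J).filter fun z => z.2.1 + z.2.2 = a + z.1 with hS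
  have conv : ∀ f : ℤ → ℤ → ℤ → ℝ, (∑ p ∈ J, ∑ q ∈ J, ∑ r ∈ J,
      if q + r = a + p then f p q r else 0) = ∑ z ∈ S, f z.1 z.2.1 z.2.2 := by
    intro f
    rw [hS, Finset.sum_filter, Finset.sum_product]
    refine Finset.sum_congr rfl fun p _ => ?_
    rw [Finset.sum_product]
  rw [tripleSum, conv fun p q r => v p * v q * v r, conv fun p q r =>
    (v p ^ 2 / s p ^ 2) * (v q ^ 2 / s q ^ 2) * (v r ^ 2 / s r ^ 2)]
  have cs := Finset.sum_mul_sq_le_sq_mul_sq S (fun z => s z.1 * s z.2.1 * s z.2.2)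
    (fun z => (v z.1 / s z.1) * (v z.2.1 / s z.2.1) * (v z.2.2 / s z.2.2))
  have e1 : ∀ z : ℤ × ℤ × ℤ, s z.1 * s z.2.1 * s z.2.2 *
      ((v z.1 / s z.1) * (v z.2.1 / s z.2.1) * (v z.2.2 / s z.2.2)) = v z.1 * v z.2.1 * v z.2.2 := by
    intro z
    have := (hs z.1).ne'; have := (hs z.2.1).ne'; have := (hs z.2.2).ne'
    field_simp
  have e2 : ∀ z : ℤ × ℤ × ℤ, ((v z.1 / s z.1) * (v z.2.1 / s z.2.1) * (v z.2.2 / s z.2.2)) ^ 2 =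
      (v z.1 ^ 2 / s z.1 ^ 2) * (v z.2.1 ^ 2 / s z.2.1 ^ 2) * (v z.2.2 ^ 2 / s z.2.2 ^ 2) := by
    intro z
    simp only [mul_pow, div_pow]
  simp_rw [e1, e2] at cs
  refine cs.trans (mul_le_mul_of_nonneg_right ?_ (Finset.sum_nonneg fun z _ => by positivity))
  have h3 : ∀ j, 0 ≤ s j ^ 3 := fun j => pow_nonneg (hs j).le 3
  have pair : ∀ π : ℤ × ℤ × ℤ → ℤ × ℤ, Set.InjOn π S → (∀ z ∈ S, π z ∈ J ×ˢ J) →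
      ∑ z ∈ S, s (π z).1 ^ 3 * s (π z).2 ^ 3 ≤ (∑ j ∈ J, s j ^ 3) ^ 2 := by
    intro π hπ hm
    rw [pow_two, Finset.sum_mul_sum, ← Finset.sum_product',
      ← Finset.sum_image (f := fun y : ℤ × ℤ => s y.1 ^ 3 * s y.2 ^ 3) hπ]
    refine Finset.sum_le_sum_of_subset_of_nonneg (Finset.image_subset_iff.2 hm) fun y _ _ =>
      mul_nonneg (h3 _) (h3 _)
  have hmem : ∀ z ∈ S, (z.1 ∈ J ∧ z.2.1 ∈ J ∧ z.2.2 ∈ J) ∧ z.2.1 + z.2.2 = a + z.1 := by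
    intro z hz
    simpa [hS, and_assoc] using hz
  have p1 := pair (fun z => (z.1, z.2.1)) (by
    rintro ⟨x, y, z⟩ h1 ⟨x', y', z'⟩ h2 h
    have h1 := (hmem _ h1).2; have h2 := (hmem _ h2).2
    simp only [Prod.mk.injEq] at h h1 h2 ⊢
    omega) fun z hz => by simp [(hmem z hz).1]
  have p2 := pair (fun z => (z.2.1, z.2.2)) (by
    rintro ⟨x, y, z⟩ h1 ⟨x', y', z'⟩ h2 h
    have h1 := (hmem _ h1).2; have h2 := (hmem _ h2).2
    simp only [Prod.mk.injEq] at h h1 h2 ⊢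
    omega) fun z hz => by simp [(hmem z hz).1]
  have p3 := pair (fun z => (z.1, z.2.2)) (by
    rintro ⟨x, y, z⟩ h1 ⟨x', y', z'⟩ h2 h
    have h1 := (hmem _ h1).2; have h2 := (hmem _ h2).2
    simp only [Prod.mk.injEq] at h h1 h2 ⊢
    omega) fun z hz => by simp [(hmem z hz).1]
  calc ∑ z ∈ S, (s z.1 * s z.2.1 * s z.2.2) ^ 2
      ≤ ∑ z ∈ S, (s z.1 ^ 3 * s z.2.1 ^ 3 + s z.2.1 ^ 3 * s z.2.2 ^ 3 +
          s z.1 ^ 3 * s z.2.2 ^ 3) / 3 := by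
        refine Finset.sum_le_sum fun z _ => ?_
        rw [mul_pow, mul_pow]
        exact mul_sq_le_of_cubes (hs _).le (hs _).le (hs _).le
    _ ≤ _ := by
        rw [← Finset.sum_div, Finset.sum_add_distrib, Finset.sum_add_distrib]
        simp only at p1 p2 p3
        linarith

/-- After exchanging sums each triple `(p, q, r)` is counted for at most one `a`, so the constraint
disappears and a cube is left. -/
theorem sum_tripleSum_sq_le (v s : ℤ → ℝ) (hs : ∀ j, 0 < s j) (J : Finset ℤ) :
    ∑ a ∈ J, tripleSum v J a ^ 2 ≤ (∑ j ∈ J, s j ^ 3) ^ 2 * (∑ j ∈ J, v j ^ 2 / s j ^ 2) ^ 3 := by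
  refine (Finset.sum_le_sum fun a _ => tripleSum_sq_le v s hs J a).trans ?_
  rw [← Finset.mul_sum]
  refine mul_le_mul_of_nonneg_left ?_ (sq_nonneg _)
  set h : ℤ → ℝ := fun j => v j ^ 2 / s j ^ 2 with hh
  have h0 : ∀ j, 0 ≤ h j := fun j => by positivity
  calc ∑ a ∈ J, ∑ p ∈ J, ∑ q ∈ J, ∑ r ∈ J, (if q + r = a + p then h p * h q * h r else 0)
      = ∑ p ∈ J, ∑ q ∈ J, ∑ r ∈ J, ∑ a ∈ J, (if q + r = a + p then h p * h q * h r else 0) := by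
        rw [Finset.sum_comm]
        refine Finset.sum_congr rfl fun p _ => ?_
        rw [Finset.sum_comm]
        refine Finset.sum_congr rfl fun q _ => ?_
        rw [Finset.sum_comm]
    _ ≤ ∑ p ∈ J, ∑ q ∈ J, ∑ r ∈ J, h p * h q * h r := by
        refine Finset.sum_le_sum fun p _ => Finset.sum_le_sum fun q _ => Finset.sum_le_sum
          fun r _ => ?_
        have : ∀ a, (q + r = a + p) = (q + r - p = a) := fun a => by
          simp only [eq_iff_iff]; omega
        simp_rw [this]
        rw [Finset.sum_ite_eq]
        have := h0 p; have := h0 q; have := h0 r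
        split_ifs
        · exact le_rfl
        · positivity
    _ = (∑ j ∈ J, h j) ^ 3 := by
        rw [pow_three, Finset.sum_mul_sum, Finset.sum_mul_sum]
        refine Finset.sum_congr rfl fun p _ => ?_
        simp_rw [Finset.mul_sum]
        refine Finset.sum_congr rfl fun q _ => Finset.sum_congr rfl fun r _ => by ring

/-! ### Frequency cutoffs and the weighted tail -/

/-- `max (1, |j| / M)`. -/
def ratio (M : ℕ) (j : ℤ) : ℝ := max 1 (|(j : ℝ)| / M)

theorem one_le_ratio (M : ℕ) (j : ℤ) : 1 ≤ ratio M j := le_max_left _ _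

theorem ratio_pos (M : ℕ) (j : ℤ) : 0 < ratio M j := zero_lt_one.trans_le (one_le_ratio M j)

/-- Group the integers by `⌊|j| / M⌋`: each block has at most `2M` elements, and the block sizes
weigh a convergent series. -/
theorem exists_sum_ratio_rpow_le {b : ℝ} (hb : 1 < b) : ∃ C : ℝ, 0 < C ∧ ∀ (M : ℕ), 1 ≤ M →
    ∀ J : Finset ℤ, ∑ j ∈ J, ratio M j ^ (-b) ≤ C * M := by
  have hsum : Summable fun i : ℕ => (max 1 (i : ℝ)) ^ (-b) := by
    refine (summable_nat_add_iff 1).1 ?_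
    have := (summable_nat_add_iff 1).2 (Real.summable_nat_rpow (p := -b) |>.2 (by linarith))
    refine this.congr fun i => ?_
    rw [max_eq_right]
    push_cast
    linarith [(Nat.cast_nonneg i : (0 : ℝ) ≤ i)]
  set T := ∑' i : ℕ, (max 1 (i : ℝ)) ^ (-b) with hT
  have hpos : ∀ i : ℕ, 0 < (max 1 (i : ℝ)) ^ (-b) := fun i => by positivity
  refine ⟨2 * T, by
    have := hsum.tsum_pos (fun i => (hpos i).le) 0 (hpos 0)
    positivity, fun M hM J => ?_⟩
  have hMp : (0 : ℝ) < M := by exact_mod_cast hM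
  set R := J.image (fun j : ℤ => j.natAbs / M) with hR
  rw [← Finset.sum_fiberwise_of_maps_to (t := R) (g := fun j : ℤ => j.natAbs / M)
    fun j hj => Finset.mem_image_of_mem _ hj]
  have hfib : ∀ i ∈ R, ∑ j ∈ J with j.natAbs / M = i, ratio M j ^ (-b) ≤
      2 * M * (max 1 (i : ℝ)) ^ (-b) := by
    intro i _
    have hcard : (J.filter fun j => j.natAbs / M = i).card ≤ 2 * M := by
      have hsub : (J.filter fun j => j.natAbs / M = i) ⊆
          Finset.Ico ((i * M : ℕ) : ℤ) ((i * M + M : ℕ) : ℤ) ∪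
            Finset.Ioc (-((i * M + M : ℕ) : ℤ)) (-((i * M : ℕ) : ℤ)) := by
        intro j hj
        have h1 := (Finset.mem_filter.1 hj).2
        have h2 := Nat.div_add_mod j.natAbs M
        have h3 := Nat.mod_lt j.natAbs hM
        rw [h1, mul_comm] at h2
        simp only [Finset.mem_union, Finset.mem_Ico, Finset.mem_Ioc]
        omega
      refine (Finset.card_le_card hsub).trans ((Finset.card_union_le _ _).trans ?_)
      rw [Int.card_Ico, Int.card_Ioc]
      omega
    calc ∑ j ∈ J with j.natAbs / M = i, ratio M j ^ (-b)
        ≤ ∑ j ∈ J with j.natAbs / M = i, (max 1 (i : ℝ)) ^ (-b) := by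
          refine Finset.sum_le_sum fun j hj => ?_
          refine Real.rpow_le_rpow_of_nonpos (by positivity) ?_ (by linarith)
          refine max_le_max le_rfl ?_
          rw [le_div_iff₀ hMp, ← (Finset.mem_filter.1 hj).2, ← Int.cast_abs, Int.abs_eq_natAbs,
            Int.cast_natCast]
          exact_mod_cast Nat.div_mul_le_self _ _
      _ = ((J.filter fun j => j.natAbs / M = i).card : ℝ) * (max 1 (i : ℝ)) ^ (-b) := by
          rw [Finset.sum_const, nsmul_eq_mul]
      _ ≤ 2 * M * (max 1 (i : ℝ)) ^ (-b) := by
          refine mul_le_mul_of_nonneg_right ?_ (hpos i).le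
          exact_mod_cast hcard
  calc _ ≤ ∑ i ∈ R, 2 * M * (max 1 (i : ℝ)) ^ (-b) := Finset.sum_le_sum hfib
    _ = 2 * M * ∑ i ∈ R, (max 1 (i : ℝ)) ^ (-b) := by rw [Finset.mul_sum]
    _ ≤ 2 * M * T := by
        gcongr
        exact hsum.sum_le_tsum _ fun i _ => (hpos i).le
    _ = 2 * T * M := by ring

/-- The mass beyond the frequency `M`, weighted by `(|j| / M)^{5/6}`. -/
def weightedTail (J : Finset ℤ) (M : ℕ) (u : HalfMinus) : ℝ :=
  ∑ j ∈ J with (M : ℤ) < |j|, ratio M j ^ (5 / 6 : ℝ) * amp u j ^ 2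

theorem measurable_weightedTail (J : Finset ℤ) (M : ℕ) : Measurable (weightedTail J M) :=
  Finset.measurable_sum _ fun j _ => ((measurable_amp j).pow_const 2).const_mul _

/-- The weights `s_j = M^(-1/3) ratio^(-5/12)` make `∑ s³` bounded, while `s⁻² = M^(2/3)
ratio^(5/6)` produces `M²` after cubing. The tail exponent `5/6` has to exceed `2/3`, for this sum
to converge, and to be below 1, for the tail to have exponential moments. -/
theorem exists_sum_tripleSum_sq_le : ∃ C : ℝ, 0 < C ∧ ∀ (J : Finset ℤ) (u : HalfMinus) (M : ℕ),
    1 ≤ M → ∑ a ∈ J, tripleSum (amp u) J a ^ 2 ≤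
      C * (M : ℝ) ^ 2 * (massIn J u + weightedTail J M u) ^ 3 := by
  obtain ⟨C, hC, hCs⟩ := exists_sum_ratio_rpow_le (b := 5 / 4) (by norm_num)
  refine ⟨C ^ 2, by positivity, fun J u M hM => ?_⟩
  have hMp : (0 : ℝ) < M := by exact_mod_cast hM
  set s : ℤ → ℝ := fun j => (M : ℝ) ^ (-(1 / 3) : ℝ) * ratio M j ^ (-(5 / 12) : ℝ) with hs
  have hspos : ∀ j, 0 < s j := fun j =>
    mul_pos (Real.rpow_pos_of_pos hMp _) (Real.rpow_pos_of_pos (ratio_pos M j) _)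
  have s3 : ∀ j, s j ^ 3 = (M : ℝ)⁻¹ * ratio M j ^ (-(5 / 4) : ℝ) := fun j => by
    rw [hs, mul_pow, ← Real.rpow_natCast, ← Real.rpow_natCast, ← Real.rpow_mul hMp.le,
      ← Real.rpow_mul (ratio_pos M j).le, ← Real.rpow_neg_one]
    norm_num
  have s2 : ∀ j, (s j ^ 2)⁻¹ = (M : ℝ) ^ (2 / 3 : ℝ) * ratio M j ^ (5 / 6 : ℝ) := fun j => by
    rw [hs, mul_pow, ← Real.rpow_natCast, ← Real.rpow_natCast, ← Real.rpow_mul hMp.le,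
      ← Real.rpow_mul (ratio_pos M j).le, mul_inv, ← Real.rpow_neg hMp.le,
      ← Real.rpow_neg (ratio_pos M j).le]
    norm_num
  have b1 : ∑ j ∈ J, s j ^ 3 ≤ C := by
    simp_rw [s3]
    rw [← Finset.mul_sum]
    have := hCs M hM J
    rwa [inv_mul_le_iff₀ hMp, mul_comm]
  have b2 : ∑ j ∈ J, amp u j ^ 2 / s j ^ 2 ≤
      (M : ℝ) ^ (2 / 3 : ℝ) * (massIn J u + weightedTail J M u) := by
    have e : ∀ j, amp u j ^ 2 / s j ^ 2 = amp u j ^ 2 *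
        ((M : ℝ) ^ (2 / 3 : ℝ) * ratio M j ^ (5 / 6 : ℝ)) := fun j => by
      rw [← s2, div_eq_mul_inv]
    simp_rw [e]
    rw [massIn, weightedTail, Finset.sum_filter, ← Finset.sum_add_distrib, Finset.mul_sum]
    refine Finset.sum_le_sum fun j _ => ?_
    split_ifs with h
    · have : 0 ≤ (M : ℝ) ^ (2 / 3 : ℝ) * amp u j ^ 2 := by positivity
      nlinarith
    · have hr : ratio M j = 1 := by
        refine max_eq_left ((div_le_one hMp).2 ?_)
        rw [← Int.cast_abs]
        exact_mod_cast not_lt.1 h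
      rw [hr, Real.one_rpow, mul_one, add_zero, mul_comm]
  have hpos : 0 ≤ ∑ j ∈ J, amp u j ^ 2 / s j ^ 2 := Finset.sum_nonneg fun j _ => by positivity
  have hM2 : ((M : ℝ) ^ (2 / 3 : ℝ)) ^ 3 = (M : ℝ) ^ 2 := by
    rw [← Real.rpow_natCast, ← Real.rpow_mul hMp.le, ← Real.rpow_natCast]
    norm_num
  calc ∑ a ∈ J, tripleSum (amp u) J a ^ 2
      ≤ (∑ j ∈ J, s j ^ 3) ^ 2 * (∑ j ∈ J, amp u j ^ 2 / s j ^ 2) ^ 3 :=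
        sum_tripleSum_sq_le _ _ hspos J
    _ ≤ C ^ 2 * ((M : ℝ) ^ (2 / 3 : ℝ) * (massIn J u + weightedTail J M u)) ^ 3 := by
        have : 0 ≤ ∑ j ∈ J, s j ^ 3 := Finset.sum_nonneg fun j _ => pow_nonneg (hspos j).le 3
        gcongr
    _ = _ := by rw [mul_pow, hM2]; ring

theorem inv_one_sub_le_exp {y : ℝ} (h0 : 0 ≤ y) (h1 : y ≤ 1 / 2) : (1 - y)⁻¹ ≤ Real.exp (2 * y) := by
  rw [inv_le_iff_one_le_mul₀ (by linarith)]
  have := Real.add_one_le_exp (2 * y)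
  nlinarith

/-- For `|j| > M` the exponent in the mode `j` is at most `ratio^(-7/6) ‖g_j‖² / 2`, so every factor
is finite, and the logarithms add up to `O(M)`. -/
theorem exists_lintegral_exp_weightedTail_le : ∃ C : ℝ, 0 < C ∧ ∀ (J : Finset ℤ) (M : ℕ), 1 ≤ M →
    ∫⁻ u, ENNReal.ofReal (Real.exp ((M : ℝ) ^ 2 / 2 * weightedTail J M u)) ∂mu ≤
      ENNReal.ofReal (Real.exp (C * M)) := by
  obtain ⟨C, hC, hCs⟩ := exists_sum_ratio_rpow_le (b := 7 / 6) (by norm_num)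
  refine ⟨C, hC, fun J M hM => ?_⟩
  have hMp : (0 : ℝ) < M := by exact_mod_cast hM
  set I := J.filter fun j => (M : ℤ) < |j| with hI
  have hprod : ∀ u, ENNReal.ofReal (Real.exp ((M : ℝ) ^ 2 / 2 * weightedTail J M u)) =
      ∏ j ∈ I, ENNReal.ofReal (Real.exp ((M : ℝ) ^ 2 / 2 * ratio M j ^ (5 / 6 : ℝ) *
        ‖coeff u j‖ ^ 2)) := by
    intro u
    rw [← ENNReal.ofReal_prod_of_nonneg fun j _ => (Real.exp_pos _).le, ← Real.exp_sum,
      weightedTail, Finset.mul_sum]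
    congr 2
    exact Finset.sum_congr rfl fun j _ => by rw [amp]; ring
  simp_rw [hprod]
  rw [lintegral_mu_prod I (φ := fun j x => ENNReal.ofReal (Real.exp ((M : ℝ) ^ 2 / 2 *
    ratio M j ^ (5 / 6 : ℝ) * ‖x‖ ^ 2))) fun j => by fun_prop]
  have hfac : ∀ j ∈ I, ∫⁻ x, ENNReal.ofReal (Real.exp ((M : ℝ) ^ 2 / 2 *
      ratio M j ^ (5 / 6 : ℝ) * ‖x / (bracket j : ℂ)‖ ^ 2)) ∂complexGaussian ≤
      ENNReal.ofReal (Real.exp (ratio M j ^ (-(7 / 6) : ℝ))) := by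
    intro j hj
    have hj2 : (M : ℝ) < |(j : ℝ)| := by
      rw [← Int.cast_abs]; exact_mod_cast (Finset.mem_filter.1 hj).2
    have hr : ratio M j = |(j : ℝ)| / M := max_eq_right ((one_le_div hMp).2 hj2.le)
    have hrp := ratio_pos M j
    set y : ℝ := 1 / 2 * ratio M j ^ (-(7 / 6) : ℝ) with hy
    have hy0 : 0 ≤ y := by positivity
    have hy1 : y ≤ 1 / 2 := by
      have := Real.rpow_le_one_of_one_le_of_nonpos (one_le_ratio M j)
        (by norm_num : (-(7 / 6) : ℝ) ≤ 0)
      linarith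
    calc _ ≤ ∫⁻ x, ENNReal.ofReal (Real.exp (y * ‖x‖ ^ 2)) ∂complexGaussian := by
          refine lintegral_mono fun x => ENNReal.ofReal_le_ofReal (Real.exp_le_exp.2 ?_)
          rw [norm_sq_div_bracket, ← mul_assoc]
          refine mul_le_mul_of_nonneg_right ?_ (sq_nonneg _)
          rw [← div_eq_mul_inv, div_le_iff₀ (pow_pos (bracket_pos j) 2)]
          have e1 : ratio M j ^ (5 / 6 : ℝ) = ratio M j ^ (-(7 / 6) : ℝ) * ratio M j ^ 2 := by
            rw [← Real.rpow_natCast, ← Real.rpow_add hrp]; norm_num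
          have e2 : (M : ℝ) ^ 2 * ratio M j ^ 2 ≤ bracket j ^ 2 := by
            rw [hr, ← mul_pow, mul_div_cancel₀ _ hMp.ne', sq_abs, bracket_sq]; linarith
          rw [e1, hy]
          have : 0 ≤ ratio M j ^ (-(7 / 6) : ℝ) := by positivity
          nlinarith
      _ ≤ _ := by
          rw [lintegral_exp_mul_norm_sq (by linarith)]
          refine ENNReal.ofReal_le_ofReal ((inv_one_sub_le_exp hy0 hy1).trans ?_)
          rw [hy]
          apply le_of_eq
          congr 1
          ring
  refine (Finset.prod_le_prod' hfac).trans ?_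
  rw [← ENNReal.ofReal_prod_of_nonneg fun j _ => (Real.exp_pos _).le, ← Real.exp_sum]
  exact ENNReal.ofReal_le_ofReal (Real.exp_le_exp.2 (hCs M hM I))

theorem summable_exp_neg_sq {c C : ℝ} (hc : 0 < c) :
    Summable fun M : ℕ => Real.exp (-c * ((M : ℝ) + 1) ^ 2 + C * ((M : ℝ) + 1)) := by
  have h := (Real.summable_exp_neg_nat).mul_left (Real.exp ((C + 1) ^ 2 / (4 * c)))
  refine h.of_nonneg_of_le (fun _ => (Real.exp_pos _).le) fun M => ?_
  rw [← Real.exp_add, Real.exp_le_exp]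
  have : 0 ≤ c * ((M : ℝ) + 1 - (C + 1) / (2 * c)) ^ 2 := by positivity
  have e : c * ((M : ℝ) + 1 - (C + 1) / (2 * c)) ^ 2 =
      c * ((M : ℝ) + 1) ^ 2 - (C + 1) * ((M : ℝ) + 1) + (C + 1) ^ 2 / (4 * c) := by
    field_simp
    ring
  linarith

/-- On a small ball of `L²` the critical functional `∑ₐ T(a)²` has exponential moments. -/
theorem exists_lintegral_exp_tripleSum_le : ∃ C₀ : ℝ, 0 < C₀ ∧ ∀ κ m₀ : ℝ, 0 ≤ κ → 0 < m₀ →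
    κ * C₀ * m₀ ^ 2 ≤ 1 → ∃ K : ℝ, ∀ J : Finset ℤ,
      ∫⁻ u, {u | massIn J u < m₀}.indicator (fun u =>
        ENNReal.ofReal (Real.exp (κ * ∑ a ∈ J, tripleSum (amp u) J a ^ 2))) u ∂mu ≤
      ENNReal.ofReal K := by
  obtain ⟨C₁, hC₁, hT⟩ := exists_sum_tripleSum_sq_le
  obtain ⟨C₂, hC₂, hW⟩ := exists_lintegral_exp_weightedTail_le
  -- 128 is chosen so that smallness reads `4E ≤ m₀/4`, with `E M²` the bound for the functional at
  -- scale `M`.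
  refine ⟨128 * C₁, by positivity, fun κ m₀ hκ hm₀ hsmall => ?_⟩
  set E : ℝ := 8 * κ * C₁ * m₀ ^ 3 with hE
  have hE0 : 0 ≤ E := by positivity
  have hE1 : 4 * E ≤ m₀ / 4 := by rw [hE]; nlinarith
  have hsum := summable_exp_neg_sq (c := m₀ / 4) (C := C₂) (by positivity)
  refine ⟨Real.exp E + ∑' M : ℕ, Real.exp (-(m₀ / 4) * ((M : ℝ) + 1) ^ 2 + C₂ * ((M : ℝ) + 1)),
    fun J => ?_⟩
  -- The bound at scale `M + 2`, times the Chernoff majorant of the event that the tail beyond `M +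
  -- 1` exceeds `m₀`.
  set W : ℕ → HalfMinus → ℝ≥0∞ := fun M u => ENNReal.ofReal (Real.exp (E * ((M : ℝ) + 2) ^ 2 -
    ((M : ℝ) + 1) ^ 2 / 2 * m₀)) *
      ENNReal.ofReal (Real.exp ((((M + 1 : ℕ) : ℝ)) ^ 2 / 2 * weightedTail J (M + 1) u)) with hWd
  have hWm : ∀ M, Measurable (W M) := fun M => by
    have := measurable_weightedTail J (M + 1)
    fun_prop
  have hpt : ∀ u, {u | massIn J u < m₀}.indicator (fun u =>
      ENNReal.ofReal (Real.exp (κ * ∑ a ∈ J, tripleSum (amp u) J a ^ 2))) u ≤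
      ENNReal.ofReal (Real.exp E) + ∑' M : ℕ, W M u := by
    intro u
    by_cases hu : massIn J u < m₀
    swap
    · rw [Set.indicator_of_notMem (by exact hu)]; exact zero_le
    rw [Set.indicator_of_mem (by exact hu)]
    have hbound : ∀ M : ℕ, 1 ≤ M → weightedTail J M u ≤ m₀ →
        κ * ∑ a ∈ J, tripleSum (amp u) J a ^ 2 ≤ E * (M : ℝ) ^ 2 := by
      intro M hM hMw
      have h0 : 0 ≤ massIn J u + weightedTail J M u :=
        add_nonneg (Finset.sum_nonneg fun _ _ => by positivity)
          (Finset.sum_nonneg fun j _ =>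
            mul_nonneg (Real.rpow_nonneg (ratio_pos M j).le _) (sq_nonneg _))
      calc κ * ∑ a ∈ J, tripleSum (amp u) J a ^ 2
          ≤ κ * (C₁ * (M : ℝ) ^ 2 * (massIn J u + weightedTail J M u) ^ 3) := by
            gcongr; exact hT J u M hM
        _ ≤ κ * (C₁ * (M : ℝ) ^ 2 * (m₀ + m₀) ^ 3) := by gcongr
        _ = E * (M : ℝ) ^ 2 := by rw [hE]; ring
    -- `J` is finite, so beyond its largest frequency the tail is empty.
    have hex : ∃ M : ℕ, weightedTail J (M + 1) u ≤ m₀ := by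
      refine ⟨J.sup Int.natAbs, ?_⟩
      rw [weightedTail, Finset.filter_eq_empty_iff.2, Finset.sum_empty]
      · exact hm₀.le
      · intro j hj
        have := Finset.le_sup (f := Int.natAbs) hj
        rw [Int.abs_eq_natAbs]
        omega
    classical
    -- At the least good scale the functional is controlled; the preceding scale, if there is one,
    -- has a tail above `m₀`.
    obtain hz | ⟨M, hM⟩ := Nat.eq_zero_or_eq_succ_pred (Nat.find hex) |>.imp_right
      fun h => (⟨_, h⟩ : ∃ M, Nat.find hex = Nat.succ M)
    · have := hbound 1 le_rfl (by simpa [hz] using Nat.find_spec hex)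
      refine le_trans (ENNReal.ofReal_le_ofReal (Real.exp_le_exp.2 ?_)) le_self_add
      simpa using this
    · have h1 := Nat.find_spec hex
      rw [hM] at h1
      have h2 : m₀ < weightedTail J (M + 1) u :=
        not_le.1 (Nat.find_min hex (m := M) (by rw [hM]; exact Nat.lt_succ_self M))
      have h3 := hbound (M + 1 + 1) (by omega) h1
      refine le_trans ?_ (le_add_left (ENNReal.le_tsum M))
      rw [hWd]
      simp only
      rw [← ENNReal.ofReal_mul (Real.exp_pos _).le, ← Real.exp_add]
      refine ENNReal.ofReal_le_ofReal (Real.exp_le_exp.2 (h3.trans ?_))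
      push_cast
      have : 0 ≤ ((M : ℝ) + 1) ^ 2 / 2 * (weightedTail J (M + 1) u - m₀) :=
        mul_nonneg (by positivity) (by linarith)
      have e : ((M : ℝ) + 1 + 1) = (M : ℝ) + 2 := by ring
      rw [e]
      linarith
  refine (lintegral_mono hpt).trans ?_
  rw [lintegral_add_left measurable_const, lintegral_const, measure_univ, mul_one,
    ENNReal.ofReal_add (Real.exp_pos _).le (tsum_nonneg fun _ => (Real.exp_pos _).le),
    lintegral_tsum fun M => (hWm M).aemeasurable,
    ENNReal.ofReal_tsum_of_nonneg (fun _ => (Real.exp_pos _).le) hsum]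
  refine add_le_add le_rfl (ENNReal.tsum_le_tsum fun M => ?_)
  have hwm := measurable_weightedTail J (M + 1)
  rw [hWd]
  simp only
  rw [lintegral_const_mul _ (by fun_prop)]
  refine (mul_le_mul_right (hW J (M + 1) (by omega)) _).trans ?_
  rw [← ENNReal.ofReal_mul (Real.exp_pos _).le, ← Real.exp_add]
  refine ENNReal.ofReal_le_ofReal (Real.exp_le_exp.2 ?_)
  push_cast
  have hM0 : (0 : ℝ) ≤ M := Nat.cast_nonneg M
  -- With `4E ≤ m₀/4`, half of the gain `m₀ (M + 1)²/2` survives.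
  have h4 : E * ((M : ℝ) + 2) ^ 2 ≤ E * (4 * ((M : ℝ) + 1) ^ 2) := by
    gcongr; nlinarith
  nlinarith [mul_le_mul_of_nonneg_right hE1 (sq_nonneg ((M : ℝ) + 1))]

/-! ### The resonant part, and existence of mass thresholds -/

/-- The mass, weighted by the frequency, carried by the frequencies in `I ∩ Q`. -/
def momentumIn (I : Finset ℤ) (Q : Set ℤ) (u : HalfMinus) : ℝ :=
  ∑ n ∈ I, (n : ℝ) * Q.indicator (fun n => amp u n ^ 2) n

/-- The sum of the `n |û(n)|⁴` over the frequencies in `I ∩ Q`. -/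
def quarticIn (I : Finset ℤ) (Q : Set ℤ) (u : HalfMinus) : ℝ :=
  ∑ n ∈ I, (n : ℝ) * Q.indicator (fun n => amp u n ^ 4) n

theorem sum_sum_ite_eq (I : Finset ℤ) (a b : ℤ) (ha : a ∈ I) (hb : b ∈ I) (f : ℤ → ℤ → ℂ) :
    (∑ r ∈ I, ∑ s ∈ I, if r = a ∧ s = b then f r s else 0) = f a b := by
  rw [Finset.sum_eq_single_of_mem a ha fun r _ hr => Finset.sum_eq_zero fun s _ => by simp [hr],
    Finset.sum_eq_single_of_mem b hb fun s _ hs => by simp [hs]]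
  simp

/-- Inclusion–exclusion: the resonances are `(n₃, n₄) = (n₁, n₂)` and `(n₃, n₄) = (n₂, n₁)`, which
overlap when all four frequencies agree. -/
theorem quadSum_decomposition (c : Fin 4 → ℤ → ℂ) (I : Finset ℤ) :
    ∑ n ∈ quadruples I, (n.1 : ℂ) * (c 0 n.1 * c 1 n.2.1 * (starRingEnd ℂ) (c 2 n.2.2.1) *
      (starRingEnd ℂ) (c 3 n.2.2.2)) = nonresSum c I +
      (∑ p ∈ I, (p : ℂ) * (c 0 p * (starRingEnd ℂ) (c 2 p))) *
        (∑ q ∈ I, c 1 q * (starRingEnd ℂ) (c 3 q)) +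
      (∑ p ∈ I, (p : ℂ) * (c 0 p * (starRingEnd ℂ) (c 3 p))) *
        (∑ q ∈ I, c 1 q * (starRingEnd ℂ) (c 2 q)) -
      ∑ p ∈ I, (p : ℂ) * (c 0 p * c 1 p * (starRingEnd ℂ) (c 2 p) * (starRingEnd ℂ) (c 3 p)) := by
  set t : ℤ → ℤ → ℤ → ℤ → ℂ := fun p q r s =>
    (p : ℂ) * (c 0 p * c 1 q * (starRingEnd ℂ) (c 2 r) * (starRingEnd ℂ) (c 3 s)) with ht
  have hpt : ∀ p q r s : ℤ, (if p + q = r + s then t p q r s else 0) = nonresTerm c p q r s +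
      (if r = p ∧ s = q then t p q r s else 0) + (if r = q ∧ s = p then t p q r s else 0) -
      (if q = p then (if r = p ∧ s = p then t p q r s else 0) else 0) := by
    intro p q r s
    rw [nonresTerm]
    by_cases h : p + q = r + s
    · by_cases h1 : r = p
      · by_cases h2 : s = p
        · have h3 : q = p := by omega
          simp [h1, h2, h3]
        · have h3 : s = q := by omega
          have h4 : ¬ (r = q ∧ s = p) := by omega
          have h5 : q ≠ p := by omega
          rw [if_pos h, if_neg (by omega), if_pos ⟨h1, h3⟩, if_neg h4, if_neg h5]
          ring
      · by_cases h2 : s = p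
        · have h3 : r = q := by omega
          rw [if_pos h, if_neg (by omega), if_neg (by omega), if_pos ⟨h3, h2⟩, if_neg (by omega)]
          ring
        · have h6 : ¬ (r = p ∧ s = p) := by omega
          rw [if_pos h, if_pos (by omega), if_neg (by omega), if_neg (by omega), if_neg h6]
          simp [ht]
    · have h6 : ¬ (q = p ∧ r = p ∧ s = p) := by omega
      rw [if_neg h, if_neg (by omega), if_neg (by omega), if_neg (by omega)]
      by_cases h7 : q = p
      · rw [if_pos h7, if_neg (by omega)]; ring
      · rw [if_neg h7]; ring
  have hsum : ∑ n ∈ quadruples I, (n.1 : ℂ) * (c 0 n.1 * c 1 n.2.1 *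
      (starRingEnd ℂ) (c 2 n.2.2.1) * (starRingEnd ℂ) (c 3 n.2.2.2)) =
      ∑ p ∈ I, ∑ q ∈ I, ∑ r ∈ I, ∑ s ∈ I, (if p + q = r + s then t p q r s else 0) := by
    rw [quadruples, Finset.sum_filter]
    simp_rw [Finset.sum_product]
    rfl
  rw [hsum]
  simp_rw [hpt, Finset.sum_sub_distrib, Finset.sum_add_distrib]
  congr 1
  · congr 1
    · congr 1
      rw [Finset.sum_mul_sum]
      refine Finset.sum_congr rfl fun p hp => Finset.sum_congr rfl fun q hq => ?_
      rw [sum_sum_ite_eq I p q hp hq fun r s => t p q r s]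
      simp only [ht]; ring
    · rw [Finset.sum_mul_sum]
      refine Finset.sum_congr rfl fun p hp => Finset.sum_congr rfl fun q hq => ?_
      rw [sum_sum_ite_eq I q p hq hp fun r s => t p q r s]
      simp only [ht]; ring
  · refine Finset.sum_congr rfl fun p hp => ?_
    rw [Finset.sum_eq_single_of_mem p hp fun q _ hq => by simp [hq]]
    simp only [if_true]
    rw [sum_sum_ite_eq I p p hp hp fun r s => t p p r s]

theorem restrCoeff_mul_conj (Q : Fin 4 → Set ℤ) (u : HalfMinus) (i j : Fin 4) (n : ℤ) :
    restrCoeff Q u i n * (starRingEnd ℂ) (restrCoeff Q u j n) =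
      (((Q i ∩ Q j).indicator (fun n => amp u n ^ 2) n : ℝ) : ℂ) := by
  by_cases hi : n ∈ Q i <;> by_cases hj : n ∈ Q j <;> simp [restrCoeff, hi, hj]
  rw [Complex.mul_conj, Complex.normSq_eq_norm_sq, amp]
  push_cast; rfl

theorem quadTerm_decomposition (Q : Fin 4 → Set ℤ) (N : ℕ) (u : HalfMinus) :
    quadTerm Q N u = 3 / 2 * ((nonresSum (restrCoeff Q u) (Finset.Icc (-(N : ℤ)) N)).re +
      momentumIn (Finset.Icc (-(N : ℤ)) N) (Q 0 ∩ Q 2) u *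
        (∑ n ∈ Finset.Icc (-(N : ℤ)) N, (Q 1 ∩ Q 3).indicator (fun n => amp u n ^ 2) n) +
      momentumIn (Finset.Icc (-(N : ℤ)) N) (Q 0 ∩ Q 3) u *
        (∑ n ∈ Finset.Icc (-(N : ℤ)) N, (Q 1 ∩ Q 2).indicator (fun n => amp u n ^ 2) n) -
      quarticIn (Finset.Icc (-(N : ℤ)) N) (Q 0 ∩ Q 2 ∩ (Q 1 ∩ Q 3)) u) := by
  set I := Finset.Icc (-(N : ℤ)) N
  have h := congrArg Complex.re (quadSum_decomposition (restrCoeff Q u) I)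
  have e4 : ∀ p : ℤ, (p : ℂ) * (restrCoeff Q u 0 p * restrCoeff Q u 1 p *
      (starRingEnd ℂ) (restrCoeff Q u 2 p) * (starRingEnd ℂ) (restrCoeff Q u 3 p)) =
      (((p : ℝ) * (Q 0 ∩ Q 2 ∩ (Q 1 ∩ Q 3)).indicator (fun n => amp u n ^ 4) p : ℝ) : ℂ) := by
    intro p
    rw [show restrCoeff Q u 0 p * restrCoeff Q u 1 p * (starRingEnd ℂ) (restrCoeff Q u 2 p) *
      (starRingEnd ℂ) (restrCoeff Q u 3 p) =
      (restrCoeff Q u 0 p * (starRingEnd ℂ) (restrCoeff Q u 2 p)) *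
      (restrCoeff Q u 1 p * (starRingEnd ℂ) (restrCoeff Q u 3 p)) by ring,
      restrCoeff_mul_conj, restrCoeff_mul_conj, ← Complex.ofReal_mul]
    push_cast
    congr 1
    by_cases h1 : p ∈ Q 0 ∩ Q 2 <;> by_cases h2 : p ∈ Q 1 ∩ Q 3 <;>
      simp only [Set.mem_inter_iff, Set.indicator, h1, h2, if_true, if_false, and_self, and_true,
        and_false, mul_zero, zero_mul, Complex.ofReal_zero]
    push_cast
    ring
  simp_rw [restrCoeff_mul_conj, e4] at h
  have e2 : ∀ (p : ℤ) (x : ℝ), (p : ℂ) * (x : ℂ) = (((p : ℝ) * x : ℝ) : ℂ) := fun p x => by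
    push_cast; rfl
  simp_rw [e2, ← Complex.ofReal_sum, ← Complex.ofReal_mul] at h
  simp only [Complex.sub_re, Complex.add_re, Complex.ofReal_re] at h
  rw [quadTerm_eq_sum, momentumIn, momentumIn, quarticIn, ← h, Complex.re_sum]
  congr 1
  refine Finset.sum_congr rfl fun n _ => ?_
  rw [← Complex.ofReal_intCast, Complex.re_ofReal_mul]
  rfl

theorem inv_one_sub_le_exp_add_sq {y : ℝ} (h : |y| ≤ 1 / 2) :
    (1 - y)⁻¹ ≤ Real.exp (y + 2 * y ^ 2) := by
  have h1 := abs_le.1 h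
  rw [inv_le_iff_one_le_mul₀ (by linarith)]
  have := Real.add_one_le_exp (y + 2 * y ^ 2)
  nlinarith [sq_nonneg y, mul_nonneg (sq_nonneg y) (by linarith : 0 ≤ 1 - 2 * y)]

theorem summable_inv_bracket_sq : Summable fun n : ℤ => (bracket n ^ 2)⁻¹ := by
  refine (summable_bracket_rpow (a := 2) (by norm_num)).congr fun n => ?_
  rw [Real.rpow_neg (bracket_pos n).le, ← Real.rpow_natCast]
  norm_num

/-- `∑ₙ ⟨n⟩⁻²`. -/
def bracketSum : ℝ := ∑' n : ℤ, (bracket n ^ 2)⁻¹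

theorem sum_inv_bracket_sq_le (I : Finset ℤ) : ∑ n ∈ I, (bracket n ^ 2)⁻¹ ≤ bracketSum :=
  summable_inv_bracket_sq.sum_le_tsum I fun _ _ => inv_nonneg.2 (sq_nonneg _)

/-- The means `θ n ⟨n⟩⁻²` are not absolutely summable, but they are odd because `Q` is even, so they
cancel over the symmetric window. What remains is of second order, hence bounded by a multiple of `∑
⟨n⟩⁻²`. -/
theorem lintegral_exp_momentumIn_le (N : ℕ) {Q : Set ℤ} (hQ : ∀ n, n ∈ Q ↔ -n ∈ Q) {θ : ℝ}
    (hθ : |θ| ≤ 1 / 2) :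
    ∫⁻ u, ENNReal.ofReal (Real.exp (θ * momentumIn (Finset.Icc (-(N : ℤ)) N) Q u)) ∂mu ≤
      ENNReal.ofReal (Real.exp (2 * bracketSum)) := by
  set I := Finset.Icc (-(N : ℤ)) N with hI
  set y : ℤ → ℝ := fun n => θ * (n * Q.indicator (fun _ => (1 : ℝ)) n) * (bracket n ^ 2)⁻¹ with hy
  have hprod : ∀ u, ENNReal.ofReal (Real.exp (θ * momentumIn I Q u)) =
      ∏ n ∈ I, ENNReal.ofReal (Real.exp (θ * (n * Q.indicator (fun _ => (1 : ℝ)) n) *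
        ‖coeff u n‖ ^ 2)) := by
    intro u
    rw [← ENNReal.ofReal_prod_of_nonneg fun j _ => (Real.exp_pos _).le, ← Real.exp_sum,
      momentumIn, Finset.mul_sum]
    congr 2
    refine Finset.sum_congr rfl fun n _ => ?_
    by_cases h : n ∈ Q
    · simp [h, amp]; ring
    · simp [h]
  simp_rw [hprod]
  rw [lintegral_mu_prod I (φ := fun n x => ENNReal.ofReal (Real.exp
    (θ * (n * Q.indicator (fun _ => (1 : ℝ)) n) * ‖x‖ ^ 2))) fun n => by fun_prop]
  have hyabs : ∀ n, |y n| ≤ 1 / 2 * (bracket n)⁻¹ := by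
    intro n
    have hb := bracket_pos n
    have h1 : |Q.indicator (fun _ => (1 : ℝ)) n| ≤ 1 := by by_cases h : n ∈ Q <;> simp [h]
    rw [hy]
    simp only [abs_mul]
    rw [abs_of_pos (by positivity : 0 < (bracket n ^ 2)⁻¹)]
    calc |θ| * (|(n : ℝ)| * |Q.indicator (fun _ => (1 : ℝ)) n|) * (bracket n ^ 2)⁻¹
        ≤ 1 / 2 * (bracket n * 1) * (bracket n ^ 2)⁻¹ := by
          gcongr
          exact abs_le_bracket n
      _ = 1 / 2 * (bracket n)⁻¹ := by field_simp
  have hfac : ∀ n ∈ I, ∫⁻ x, ENNReal.ofReal (Real.exp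
      (θ * (n * Q.indicator (fun _ => (1 : ℝ)) n) * ‖x / (bracket n : ℂ)‖ ^ 2)) ∂complexGaussian ≤
      ENNReal.ofReal (Real.exp (y n + 2 * (bracket n ^ 2)⁻¹)) := by
    intro n _
    have hb := one_le_bracket n
    have hb0 := bracket_pos n
    have h1 : |y n| ≤ 1 / 2 := (hyabs n).trans (by
      have := inv_le_one_of_one_le₀ hb; linarith)
    have e : ∀ x : ℂ, θ * (n * Q.indicator (fun _ => (1 : ℝ)) n) * ‖x / (bracket n : ℂ)‖ ^ 2 =
        y n * ‖x‖ ^ 2 := fun x => by rw [norm_sq_div_bracket, hy]; ring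
    simp_rw [e]
    rw [lintegral_exp_mul_norm_sq (by linarith [(abs_le.1 h1).2])]
    refine ENNReal.ofReal_le_ofReal ((inv_one_sub_le_exp_add_sq h1).trans (Real.exp_le_exp.2 ?_))
    have h2 : y n ^ 2 ≤ (bracket n ^ 2)⁻¹ := by
      rw [← sq_abs, ← inv_pow]
      have := inv_pos.2 hb0
      exact pow_le_pow_left₀ (abs_nonneg _) ((hyabs n).trans (by linarith)) 2
    linarith
  refine (Finset.prod_le_prod' hfac).trans ?_
  rw [← ENNReal.ofReal_prod_of_nonneg fun j _ => (Real.exp_pos _).le, ← Real.exp_sum]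
  refine ENNReal.ofReal_le_ofReal (Real.exp_le_exp.2 ?_)
  have hodd : ∑ n ∈ I, y n = 0 := by
    have h1 : ∑ n ∈ I, y n = ∑ n ∈ I, y (-n) :=
      Finset.sum_equiv (Equiv.neg ℤ) (fun n => by simp [hI]; omega) fun n _ => by simp
    have h2 : ∀ n, y (-n) = -y n := fun n => by
      have : Q.indicator (fun _ => (1 : ℝ)) (-n) = Q.indicator (fun _ => (1 : ℝ)) n := by
        by_cases h : n ∈ Q
        · rw [Set.indicator_of_mem h, Set.indicator_of_mem ((hQ n).1 h)]
        · rw [Set.indicator_of_notMem h, Set.indicator_of_notMem (fun h' => h ((hQ n).2 h'))]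
      simp only [hy]
      rw [this, bracket_neg]
      push_cast
      ring
    simp_rw [h2] at h1
    rw [Finset.sum_neg_distrib] at h1
    linarith
  rw [Finset.sum_add_distrib, hodd, zero_add, ← Finset.mul_sum]
  linarith [sum_inv_bracket_sq_le I]

/-- On the ball `‖û(n)‖² < m₀`, so one factor can be bounded to leave an exponent at most
`‖g_n‖²/4`. The exponent is also at most `lam ⟨n⟩⁻² ‖g_n‖⁴`, which makes the factors `1 + O(lam
⟨n⟩⁻²)`. -/
theorem lintegral_exp_quarticIn_le (I : Finset ℤ) (Q : Set ℤ) {lam m₀ : ℝ} (hlam : 0 ≤ lam)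
    (hm : lam * m₀ ≤ 1 / 4) :
    ∫⁻ u, {u | massIn I u < m₀}.indicator (fun u =>
      ENNReal.ofReal (Real.exp (-(lam * quarticIn I Q u)))) u ∂mu ≤
      ENNReal.ofReal (Real.exp (256 * lam * bracketSum)) := by
  classical
  set φ : ℤ → ℂ → ℝ≥0∞ := fun n x => {x : ℂ | ‖x‖ ^ 2 < m₀}.indicator (fun x =>
    ENNReal.ofReal (Real.exp (lam * |(n : ℝ)| * ‖x‖ ^ 4))) x with hφ
  have hφm : ∀ n, Measurable (φ n) := fun n =>
    Measurable.indicator (by fun_prop) (measurableSet_lt (by fun_prop) measurable_const)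
  have hpt : ∀ u, {u | massIn I u < m₀}.indicator (fun u =>
      ENNReal.ofReal (Real.exp (-(lam * quarticIn I Q u)))) u ≤ ∏ n ∈ I, φ n (coeff u n) := by
    intro u
    by_cases hu : massIn I u < m₀
    swap
    · rw [Set.indicator_of_notMem (by exact hu)]; exact zero_le
    rw [Set.indicator_of_mem (by exact hu)]
    have h1 : ∀ n ∈ I, φ n (coeff u n) =
        ENNReal.ofReal (Real.exp (lam * |(n : ℝ)| * amp u n ^ 4)) := by
      intro n hn
      have : amp u n ^ 2 < m₀ :=
        (Finset.single_le_sum (f := fun n => amp u n ^ 2) (fun _ _ => sq_nonneg _) hn).trans_lt hu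
      exact Set.indicator_of_mem (s := {x : ℂ | ‖x‖ ^ 2 < m₀}) this _
    rw [Finset.prod_congr rfl h1, ← ENNReal.ofReal_prod_of_nonneg fun j _ => (Real.exp_pos _).le,
      ← Real.exp_sum]
    refine ENNReal.ofReal_le_ofReal (Real.exp_le_exp.2 ?_)
    rw [quarticIn, Finset.mul_sum, ← Finset.sum_neg_distrib]
    refine Finset.sum_le_sum fun n _ => ?_
    have h4 : 0 ≤ amp u n ^ 4 := by positivity
    by_cases h : n ∈ Q
    · rw [Set.indicator_of_mem h]
      have := neg_abs_le (n : ℝ)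
      nlinarith [mul_nonneg hlam h4]
    · rw [Set.indicator_of_notMem h]
      simp only [mul_zero, neg_zero]
      positivity
  refine (lintegral_mono hpt).trans ?_
  rw [lintegral_mu_prod I hφm]
  have hfac : ∀ n ∈ I, ∫⁻ x, φ n (x / (bracket n : ℂ)) ∂complexGaussian ≤
      ENNReal.ofReal (Real.exp (256 * lam * (bracket n ^ 2)⁻¹)) := by
    intro n _
    have hb := one_le_bracket n
    have hb0 := bracket_pos n
    set D : ℝ := 128 * lam * (bracket n ^ 2)⁻¹ with hD
    have hD0 : 0 ≤ D := by positivity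
    calc ∫⁻ x, φ n (x / (bracket n : ℂ)) ∂complexGaussian
        ≤ ∫⁻ x, ENNReal.ofReal (1 + D * Real.exp (1 / 2 * ‖x‖ ^ 2)) ∂complexGaussian := by
          refine lintegral_mono fun x => ?_
          simp only [hφ]
          by_cases hx : ‖x / (bracket n : ℂ)‖ ^ 2 < m₀
          swap
          · rw [Set.indicator_of_notMem (by exact hx)]; exact zero_le
          rw [Set.indicator_of_mem (by exact hx)]
          apply ENNReal.ofReal_le_ofReal
          set r := ‖x / (bracket n : ℂ)‖ ^ 2 with hr
          have hr0 : 0 ≤ r := by positivity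
          have hr2 : r = (bracket n ^ 2)⁻¹ * ‖x‖ ^ 2 := norm_sq_div_bracket n x
          have e4 : ‖x / (bracket n : ℂ)‖ ^ 4 = r ^ 2 := by rw [hr]; ring
          rw [e4]
          set z := lam * |(n : ℝ)| * r ^ 2 with hz
          have hz0 : 0 ≤ z := by positivity
          have hnb : |(n : ℝ)| ≤ bracket n ^ 2 := by nlinarith [abs_le_bracket n]
          have hnr : |(n : ℝ)| * r ≤ ‖x‖ ^ 2 := by
            rw [hr2]
            calc |(n : ℝ)| * ((bracket n ^ 2)⁻¹ * ‖x‖ ^ 2)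
                ≤ bracket n ^ 2 * ((bracket n ^ 2)⁻¹ * ‖x‖ ^ 2) := by gcongr
              _ = ‖x‖ ^ 2 := by field_simp
          have z1 : z ≤ 1 / 4 * ‖x‖ ^ 2 := by
            calc z = lam * r * (|(n : ℝ)| * r) := by rw [hz]; ring
              _ ≤ 1 / 4 * ‖x‖ ^ 2 := by
                gcongr
                exact (mul_le_mul_of_nonneg_left hx.le hlam).trans hm
          have z2 : z ≤ lam * (bracket n ^ 2)⁻¹ * ‖x‖ ^ 4 := by
            calc z = lam * (|(n : ℝ)| * r) * r := by rw [hz]; ring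
              _ ≤ lam * ‖x‖ ^ 2 * r := by gcongr
              _ = _ := by rw [hr2]; ring
          have h1 : Real.exp z ≤ 1 + z * Real.exp z := by
            have h := Real.add_one_le_exp (-z)
            have h' : Real.exp (-z) * Real.exp z = 1 := by rw [← Real.exp_add]; simp
            nlinarith [Real.exp_pos z]
          refine h1.trans (add_le_add le_rfl ?_)
          calc z * Real.exp z ≤ lam * (bracket n ^ 2)⁻¹ * (128 * Real.exp (1 / 8 * ‖x‖ ^ 2)) *
                Real.exp (1 / 4 * ‖x‖ ^ 2) := by
                gcongr
                exact z2.trans (by gcongr; exact norm_pow_four_le_exp x)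
            _ = D * Real.exp (1 / 8 * ‖x‖ ^ 2 + 1 / 4 * ‖x‖ ^ 2) := by
                rw [hD, Real.exp_add]; ring
            _ ≤ D * Real.exp (1 / 2 * ‖x‖ ^ 2) := by
                gcongr
                nlinarith [sq_nonneg ‖x‖]
      _ = ENNReal.ofReal (1 + D * 2) := by
          have hint : Integrable (fun x : ℂ => 1 + D * Real.exp (1 / 2 * ‖x‖ ^ 2)) complexGaussian :=
            (integrable_const 1).add (integrable_exp_half_norm_sq.const_mul D)
          rw [← ofReal_integral_eq_lintegral_ofReal hint (ae_of_all _ fun x => by positivity), integral_add (integrable_const 1)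
            (integrable_exp_half_norm_sq.const_mul D), integral_const_mul,
            integral_exp_half_norm_sq]
          simp
      _ ≤ _ := by
          refine ENNReal.ofReal_le_ofReal ?_
          have := Real.add_one_le_exp (256 * lam * (bracket n ^ 2)⁻¹)
          rw [hD]
          linarith
  refine (Finset.prod_le_prod' hfac).trans ?_
  rw [← ENNReal.ofReal_prod_of_nonneg fun j _ => (Real.exp_pos _).le, ← Real.exp_sum,
    ← Finset.mul_sum]
  refine ENNReal.ofReal_le_ofReal (Real.exp_le_exp.2 ?_)
  exact mul_le_mul_of_nonneg_left (sum_inv_bracket_sq_le I) (by positivity)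

theorem exp_abs_le (x : ℝ) : Real.exp |x| ≤ Real.exp x + Real.exp (-x) := by
  rcases abs_cases x with ⟨h, -⟩ | ⟨h, -⟩ <;> rw [h] <;>
    linarith [Real.exp_pos x, Real.exp_pos (-x)]

/-- The mass factor is replaced by its bound `m₀`. As the momentum has no sign, exponents `θ` and
`-θ` are both needed. -/
theorem lintegral_exp_momentum_mul_le (N : ℕ) {Q Q' : Set ℤ} (hQ : ∀ n, n ∈ Q ↔ -n ∈ Q)
    {lam m₀ : ℝ} (hlam : 0 ≤ lam) (hm₀ : 0 ≤ m₀) (hm : lam * m₀ ≤ 1 / 4) :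
    ∫⁻ u, {u | massIn (Finset.Icc (-(N : ℤ)) N) u < m₀}.indicator (fun u => ENNReal.ofReal
      (Real.exp (lam * (momentumIn (Finset.Icc (-(N : ℤ)) N) Q u *
        ∑ n ∈ Finset.Icc (-(N : ℤ)) N, Q'.indicator (fun n => amp u n ^ 2) n)))) u ∂mu ≤
      ENNReal.ofReal (2 * Real.exp (2 * bracketSum)) := by
  set I := Finset.Icc (-(N : ℤ)) N with hI
  set θ := lam * m₀ with hθ
  have hθ0 : 0 ≤ θ := by positivity
  have hmom : Measurable (momentumIn I Q) := by
    refine Finset.measurable_sum _ fun n _ => Measurable.const_mul ?_ _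
    by_cases h : n ∈ Q
    · simpa [h] using (measurable_amp n).pow_const 2
    · simp [h]
  have hpt : ∀ u, {u | massIn I u < m₀}.indicator (fun u => ENNReal.ofReal
      (Real.exp (lam * (momentumIn I Q u * ∑ n ∈ I, Q'.indicator (fun n => amp u n ^ 2) n)))) u ≤
      ENNReal.ofReal (Real.exp (θ * momentumIn I Q u)) +
        ENNReal.ofReal (Real.exp (-θ * momentumIn I Q u)) := by
    intro u
    by_cases hu : massIn I u < m₀
    swap
    · rw [Set.indicator_of_notMem (by exact hu)]; exact zero_le
    rw [Set.indicator_of_mem (by exact hu), ← ENNReal.ofReal_add (Real.exp_pos _).le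
      (Real.exp_pos _).le]
    refine ENNReal.ofReal_le_ofReal ?_
    rw [neg_mul]
    refine le_trans (Real.exp_le_exp.2 ?_) (exp_abs_le _)
    set B := ∑ n ∈ I, Q'.indicator (fun n => amp u n ^ 2) n with hB
    have hB0 : 0 ≤ B := Finset.sum_nonneg fun n _ => Set.indicator_nonneg (fun _ _ => sq_nonneg _) n
    have hB1 : B ≤ m₀ := (Finset.sum_le_sum fun n _ =>
      Set.indicator_le_self' (fun _ _ => sq_nonneg _) n).trans hu.le
    rw [abs_mul, abs_of_nonneg hθ0, hθ]
    calc lam * (momentumIn I Q u * B) ≤ lam * (|momentumIn I Q u| * m₀) := by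
          gcongr
          exact le_abs_self _
      _ = _ := by ring
  refine (lintegral_mono hpt).trans ?_
  rw [lintegral_add_left (by fun_prop), two_mul, ENNReal.ofReal_add (Real.exp_pos _).le
      (Real.exp_pos _).le]
  exact add_le_add (lintegral_exp_momentumIn_le N hQ (by rw [abs_of_nonneg hθ0]; linarith))
    (lintegral_exp_momentumIn_le N hQ (by rw [abs_neg, abs_of_nonneg hθ0]; linarith))

theorem exp_half_add_le (x y : ℝ) : Real.exp ((x + y) / 2) ≤ Real.exp x + Real.exp y := by
  rcases le_total x y with h | h
  · exact (Real.exp_le_exp.2 (by linarith)).trans (le_add_of_nonneg_left (Real.exp_pos x).le)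
  · exact (Real.exp_le_exp.2 (by linarith)).trans (le_add_of_nonneg_right (Real.exp_pos y).le)

/-- A substitute for Hölder's inequality when separating the four parts of the quartic form. -/
theorem exp_average_le (a b c d : ℝ) :
    Real.exp ((a + b + c + d) / 4) ≤ Real.exp a + Real.exp b + Real.exp c + Real.exp d := by
  have h := exp_half_add_le ((a + b) / 2) ((c + d) / 2)
  rw [show ((a + b) / 2 + (c + d) / 2) / 2 = (a + b + c + d) / 4 by ring] at h
  linarith [exp_half_add_le a b, exp_half_add_le c d]

/-- Mass thresholds exist for every exponent. -/
theorem exists_isThreshold {q : ℝ} (hq : 0 ≤ q) : ∃ m₀ : ℝ, IsThreshold q m₀ ∧ m₀ / 2 < 1 := by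
  obtain ⟨C₀, hC₀, hT⟩ := exists_lintegral_exp_tripleSum_le
  -- `12 = 3/2 · 4 · 2`: the prefactor of the form, its four parts, and the further split of the
  -- nonresonant part into supermartingale and compensator.
  set lam : ℝ := 12 * q with hlam
  have hlam0 : 0 ≤ lam := by positivity
  set κ : ℝ := 514 * (4 * lam) ^ 2 with hκ
  have hκ0 : 0 ≤ κ := by positivity
  -- The three summands yield, in turn, `m₀ ≤ 1`, the bound on `β`, and the smallness required for
  -- the cubic sums.
  set m₀ : ℝ := (1 + 16 * lam + κ * C₀)⁻¹ with hm₀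
  have hden : 0 < 1 + 16 * lam + κ * C₀ := by positivity
  have hmpos : 0 < m₀ := inv_pos.2 hden
  have hmden : m₀ * (1 + 16 * lam + κ * C₀) = 1 := inv_mul_cancel₀ hden.ne'
  have hκC : 0 ≤ m₀ * (κ * C₀) := by positivity
  have hml : 0 ≤ m₀ * lam := by positivity
  have hm1 : m₀ ≤ 1 := by nlinarith
  have hm2 : 16 * lam * m₀ ≤ 1 := by nlinarith
  have hm3 : κ * C₀ * m₀ ^ 2 ≤ 1 := by nlinarith
  have hm4 : 6 * q * m₀ ≤ 1 / 4 := by rw [hlam] at hm2; nlinarith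
  obtain ⟨K, hK⟩ := hT κ m₀ hκ0 hmpos hm3
  set E : ℝ := 514 * (2 * lam * m₀) ^ 2 * bracketSum with hE
  refine ⟨m₀, ⟨hmpos, 1 + Real.exp E * max K 0 + 2 * Real.exp (2 * bracketSum) +
    2 * Real.exp (2 * bracketSum) + Real.exp (256 * (6 * q) * bracketSum), ?_⟩, by linarith⟩
  intro N Q hQ
  set I := Finset.Icc (-(N : ℤ)) N with hI
  obtain ⟨A, hAm, -, hAle, hA⟩ := exists_nonres_compensator Q hlam0 hm2 I I subset_rfl
  set S := {u : HalfMinus | massIn I u < m₀} with hS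
  have hSm : MeasurableSet S := measurableSet_lt (measurable_massIn I) measurable_const
  have hQ2 : ∀ i j n, n ∈ Q i ∩ Q j ↔ -n ∈ Q i ∩ Q j := fun i j n => by
    rw [Set.mem_inter_iff, Set.mem_inter_iff, hQ i n, hQ j n]
  set F1 : HalfMinus → ℝ≥0∞ := S.indicator fun u => ENNReal.ofReal
    (Real.exp (6 * q * (nonresSum (restrCoeff Q u) I).re)) with hF1
  set F2 : HalfMinus → ℝ≥0∞ := S.indicator fun u => ENNReal.ofReal
    (Real.exp (6 * q * (momentumIn I (Q 0 ∩ Q 2) u *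
        ∑ n ∈ I, (Q 1 ∩ Q 3).indicator (fun n => amp u n ^ 2) n))) with hF2
  set F3 : HalfMinus → ℝ≥0∞ := S.indicator fun u => ENNReal.ofReal
    (Real.exp (6 * q * (momentumIn I (Q 0 ∩ Q 3) u *
        ∑ n ∈ I, (Q 1 ∩ Q 2).indicator (fun n => amp u n ^ 2) n))) with hF3
  set F4 : HalfMinus → ℝ≥0∞ := S.indicator fun u => ENNReal.ofReal
    (Real.exp (-(6 * q * quarticIn I (Q 0 ∩ Q 2 ∩ (Q 1 ∩ Q 3)) u))) with hF4
  have hind : ∀ (Q' : Set ℤ) (k : ℕ) (j : ℤ), Measurable fun u =>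
      Q'.indicator (fun n => amp u n ^ k) j := fun Q' k j => by
    by_cases h : j ∈ Q'
    · simpa [h] using (measurable_amp j).pow_const k
    · simp [h]
  have hmom : ∀ Q', Measurable (momentumIn I Q') := fun Q' =>
    Finset.measurable_sum _ fun n _ => Measurable.const_mul (hind Q' 2 n) _
  have hF1m : Measurable F1 := by
    have := measurable_nonresSum Q I
    exact Measurable.indicator (by fun_prop) hSm
  have hF2m : Measurable F2 := by
    refine Measurable.indicator (Measurable.ennreal_ofReal (Real.measurable_exp.comp
      (Measurable.const_mul ((hmom _).mul (Finset.measurable_sum _ fun n _ => hind _ 2 n)) _))) hSm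
  have hF3m : Measurable F3 := by
    refine Measurable.indicator (Measurable.ennreal_ofReal (Real.measurable_exp.comp
      (Measurable.const_mul ((hmom _).mul (Finset.measurable_sum _ fun n _ => hind _ 2 n)) _))) hSm
  have hsub : {u : HalfMinus | mass u.1 < m₀} ⊆ S := fun u hu =>
    (massIn_le_mass I u).trans_lt hu
  have hpt : ∀ u, S.indicator (fun u => ENNReal.ofReal (Real.exp (q * quadTerm Q N u))) u ≤
      F1 u + F2 u + F3 u + F4 u := by
    intro u
    by_cases hu : u ∈ S
    swap
    · rw [Set.indicator_of_notMem hu]; exact zero_le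
    simp only [hF1, hF2, hF3, hF4, Set.indicator_of_mem hu]
    rw [← ENNReal.ofReal_add (by positivity) (by positivity),
      ← ENNReal.ofReal_add (by positivity) (by positivity),
      ← ENNReal.ofReal_add (by positivity) (by positivity)]
    refine ENNReal.ofReal_le_ofReal (le_trans (le_of_eq ?_) (exp_average_le _ _ _ _))
    rw [quadTerm_decomposition]
    congr 1
    ring
  have hbs : 0 ≤ bracketSum := tsum_nonneg fun _ => by positivity
  have hAE : ∀ u, A u ≤ κ * ∑ a ∈ I, tripleSum (amp u) I a ^ 2 + E := by
    intro u
    refine (hAle u).trans ?_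
    rw [← Finset.mul_sum, Finset.sum_add_distrib]
    simp_rw [mul_pow (4 * lam), div_pow, div_eq_mul_inv]
    rw [← Finset.mul_sum, ← Finset.mul_sum, mul_add, hκ, hE, ← mul_assoc, ← mul_assoc]
    refine add_le_add le_rfl ?_
    refine le_trans (le_of_eq ?_) (mul_le_mul_of_nonneg_left (sum_inv_bracket_sq_le I)
      (by positivity : 0 ≤ 514 * (2 * lam * m₀) ^ 2))
    ring
  have b1 : ∫⁻ u, F1 u ∂mu ≤ ENNReal.ofReal (1 + Real.exp E * max K 0) := by
    have hp : ∀ u, F1 u ≤ S.indicator (fun u => ENNReal.ofReal (Real.exp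
        (lam * (nonresSum (restrCoeff Q u) I).re - A u))) u + ENNReal.ofReal (Real.exp E) *
        S.indicator (fun u => ENNReal.ofReal (Real.exp
          (κ * ∑ a ∈ I, tripleSum (amp u) I a ^ 2))) u := by
      intro u
      by_cases hu : u ∈ S
      swap
      · simp only [hF1, Set.indicator_of_notMem hu]; exact zero_le
      simp only [hF1, Set.indicator_of_mem hu]
      rw [← ENNReal.ofReal_mul (Real.exp_pos _).le, ← Real.exp_add,
        ← ENNReal.ofReal_add (Real.exp_pos _).le (Real.exp_pos _).le]
      refine ENNReal.ofReal_le_ofReal ?_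
      set X := lam * (nonresSum (restrCoeff Q u) I).re - A u with hX
      set Y := E + κ * ∑ a ∈ I, tripleSum (amp u) I a ^ 2 with hY
      have h1 : 6 * q * (nonresSum (restrCoeff Q u) I).re ≤ (X + Y) / 2 := by
        have := hAE u
        rw [hX, hY, hlam]
        linarith
      have h2 := (Real.exp_le_exp.2 h1).trans (exp_half_add_le X Y)
      linarith
    refine (lintegral_mono hp).trans ?_
    have hm1 : Measurable (S.indicator (fun u => ENNReal.ofReal (Real.exp
        (lam * (nonresSum (restrCoeff Q u) I).re - A u)))) := by
      have := measurable_nonresSum Q I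
      exact Measurable.indicator (by fun_prop) hSm
    have hm2 : Measurable (S.indicator (fun u => ENNReal.ofReal (Real.exp
          (κ * ∑ a ∈ I, tripleSum (amp u) I a ^ 2)))) := by
      have := fun a => measurable_tripleSum I a
      exact Measurable.indicator (by fun_prop) hSm
    rw [lintegral_add_left hm1, lintegral_const_mul _ hm2,
      ENNReal.ofReal_add zero_le_one (by positivity), ENNReal.ofReal_one,
      ENNReal.ofReal_mul (Real.exp_pos _).le]
    refine add_le_add hA (mul_le_mul_right ((hK I).trans ?_) _)
    exact ENNReal.ofReal_le_ofReal (le_max_left _ _)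
  have b2 := lintegral_exp_momentum_mul_le N (Q' := Q 1 ∩ Q 3) (hQ2 0 2) (by positivity : 0 ≤ 6 * q)
    hmpos.le hm4
  have b3 := lintegral_exp_momentum_mul_le N (Q' := Q 1 ∩ Q 2) (hQ2 0 3) (by positivity : 0 ≤ 6 * q)
    hmpos.le hm4
  have b4 := lintegral_exp_quarticIn_le I (Q 0 ∩ Q 2 ∩ (Q 1 ∩ Q 3)) (by positivity : 0 ≤ 6 * q) hm4
  calc ∫⁻ u in {u : HalfMinus | mass u.1 < m₀}, ENNReal.ofReal (Real.exp (q * quadTerm Q N u)) ∂mu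
      ≤ ∫⁻ u in S, ENNReal.ofReal (Real.exp (q * quadTerm Q N u)) ∂mu := lintegral_mono_set hsub
    _ = ∫⁻ u, S.indicator (fun u => ENNReal.ofReal (Real.exp (q * quadTerm Q N u))) u ∂mu := by
        rw [lintegral_indicator hSm]
    _ ≤ ∫⁻ u, (F1 u + F2 u + F3 u + F4 u) ∂mu := lintegral_mono hpt
    _ = ∫⁻ u, F1 u ∂mu + ∫⁻ u, F2 u ∂mu + ∫⁻ u, F3 u ∂mu + ∫⁻ u, F4 u ∂mu := by
        rw [lintegral_add_left (f := fun u => F1 u + F2 u + F3 u) ((hF1m.add hF2m).add hF3m),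
          lintegral_add_left (f := fun u => F1 u + F2 u) (hF1m.add hF2m), lintegral_add_left hF1m]
    _ ≤ _ := by
        rw [ENNReal.ofReal_add (by positivity) (by positivity),
          ENNReal.ofReal_add (by positivity) (by positivity),
          ENNReal.ofReal_add (by positivity) (by positivity)]
        exact add_le_add (add_le_add (add_le_add b1 b2) b3) b4

/-! ### The mass carried by a set of frequencies -/

/-- The mass carried by the frequencies in `S`. -/
def massSet (S : Set ℤ) (u : HalfMinus) : ℝ := ∑' n, S.indicator (fun n => ‖coeff u n‖ ^ 2) n

theorem summable_indicator_norm_sq (S : Set ℤ) (u : HalfMinus) :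
    Summable (S.indicator fun n => ‖coeff u n‖ ^ 2) := (summable_norm_sq_coeff u).indicator S

theorem measurable_massSet (S : Set ℤ) : Measurable (massSet S) := by
  refine Measurable.tsum fun n => ?_
  by_cases h : n ∈ S
  · simpa [h] using (measurable_coeff_apply n).norm.pow_const 2
  · simp [h]

theorem massSet_nonneg (S : Set ℤ) (u : HalfMinus) : 0 ≤ massSet S u :=
  tsum_nonneg fun _ => Set.indicator_nonneg (fun _ _ => by positivity) _

theorem massSet_mono {S T : Set ℤ} (h : S ⊆ T) (u : HalfMinus) : massSet S u ≤ massSet T u :=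
  (summable_indicator_norm_sq S u).tsum_le_tsum
    (Set.indicator_le_indicator_of_subset h fun _ => by positivity)
    (summable_indicator_norm_sq T u)

theorem massSet_univ (u : HalfMinus) : massSet Set.univ u = mass u.1 := by
  rw [massSet, Set.indicator_univ, mass_eq_tsum]
  rfl

theorem massSet_off (k : ℕ) (u : HalfMinus) : massSet {n | |n| ≠ (k : ℤ)} u = massOff k u :=
  (tsum_subtype {n : ℤ | |n| ≠ (k : ℤ)} fun n => ‖coeff u n‖ ^ 2).symm

theorem massSet_finset (I : Finset ℤ) (u : HalfMinus) :
    massSet I u = ∑ n ∈ I, ‖coeff u n‖ ^ 2 := by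
  rw [massSet, ← sum_eq_tsum_indicator]

theorem massSet_on (k : ℕ) (u : HalfMinus) :
    massSet (({(k : ℤ), -(k : ℤ)} : Finset ℤ) : Set ℤ) u = massOn k u :=
  massSet_finset _ u

theorem massSet_congr {S : Set ℤ} {u v : HalfMinus} (h : ∀ n ∈ S, coeff u n = coeff v n) :
    massSet S u = massSet S v := by
  refine tsum_congr fun n => ?_
  by_cases hn : n ∈ S
  · simp [hn, h n hn]
  · simp [hn]

theorem massSet_eq_diff_add {S : Set ℤ} {n : ℤ} (hn : n ∈ S) (u : HalfMinus) :
    massSet S u = massSet (S \ {n}) u + ‖coeff u n‖ ^ 2 := by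
  have h : ‖coeff u n‖ ^ 2 = massSet {n} u := by
    have := massSet_finset {n} u
    rw [Finset.coe_singleton, Finset.sum_singleton] at this
    exact this.symm
  rw [h, massSet, massSet, massSet, ← (summable_indicator_norm_sq _ u).tsum_add
    (summable_indicator_norm_sq _ u)]
  refine tsum_congr fun j => ?_
  by_cases hj : j = n
  · subst hj; simp [hn]
  · by_cases hS : j ∈ S <;> simp [hj, hS]

theorem massSet_setCoeff_of_notMem {S : Set ℤ} {n : ℤ} (hn : n ∉ S) (x : ℂ) (u : HalfMinus) :
    massSet S (setCoeff n x u) = massSet S u :=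
  massSet_congr fun _ hj => coeff_setCoeff_of_ne (by rintro rfl; exact hn hj) x u

theorem massSet_setCoeff {S : Set ℤ} {n : ℤ} (hn : n ∈ S) (x : ℂ) (u : HalfMinus) :
    massSet S (setCoeff n x u) = massSet (S \ {n}) u + ‖x‖ ^ 2 := by
  rw [massSet_eq_diff_add hn, coeff_setCoeff_self, massSet_setCoeff_of_notMem (by simp)]

/-- The law of `‖û(n)‖²` under `μ`: the exponential law of rate `⟨n⟩²`. -/
def modeLaw (n : ℤ) : Measure ℝ :=
  (volume.restrict (Set.Ioi 0)).withDensity fun r =>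
    ENNReal.ofReal (bracket n ^ 2 * Real.exp (-(bracket n ^ 2 * r)))

theorem lintegral_modeLaw (n : ℤ) {h : ℝ → ℝ≥0∞} (hh : Measurable h) :
    ∫⁻ r, h r ∂modeLaw n = ∫⁻ r in Set.Ioi (0 : ℝ),
      ENNReal.ofReal (bracket n ^ 2 * Real.exp (-(bracket n ^ 2 * r))) * h r := by
  rw [modeLaw, lintegral_withDensity_eq_lintegral_mul _ (by fun_prop) hh]
  rfl

theorem modeLaw_apply (n : ℤ) {A : Set ℝ} (hA : MeasurableSet A) :
    modeLaw n A = ∫⁻ r in A ∩ Set.Ioi 0,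
      ENNReal.ofReal (bracket n ^ 2 * Real.exp (-(bracket n ^ 2 * r))) := by
  rw [modeLaw, withDensity_apply _ hA, Measure.restrict_restrict hA]

theorem lintegral_norm_sq_div_bracket (n : ℤ) {h : ℝ → ℝ≥0∞} (hh : Measurable h) :
    ∫⁻ x, h (‖x / (bracket n : ℂ)‖ ^ 2) ∂complexGaussian = ∫⁻ r, h r ∂modeLaw n := by
  have hb : 0 < bracket n ^ 2 := pow_pos (bracket_pos n) 2
  rw [lintegral_modeLaw n hh]
  simp_rw [norm_sq_div_bracket]
  rw [lintegral_complexGaussian_norm_sq (h := fun r => h ((bracket n ^ 2)⁻¹ * r)) (by fun_prop)]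
  have himg : (fun r : ℝ => bracket n ^ 2 * r) '' Set.Ioi 0 = Set.Ioi 0 := by
    rw [Set.image_mul_left_Ioi hb, mul_zero]
  conv_lhs => rw [← himg]
  rw [lintegral_image_eq_lintegral_abs_deriv_mul measurableSet_Ioi (f' := fun _ => bracket n ^ 2 * 1)
    (fun x _ => ((hasDerivAt_id' x).const_mul (bracket n ^ 2)).hasDerivWithinAt)
    (fun x _ y _ hxy => mul_left_cancel₀ hb.ne' hxy)]
  refine lintegral_congr fun r => ?_
  rw [mul_one, abs_of_pos hb, inv_mul_cancel_left₀ hb.ne', ENNReal.ofReal_mul hb.le, mul_assoc]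

instance (n : ℤ) : IsProbabilityMeasure (modeLaw n) := by
  have h := lintegral_norm_sq_div_bracket n (h := fun _ => 1) measurable_const
  refine ⟨?_⟩
  simpa using h.symm

theorem modeLaw_absolutelyContinuous (n : ℤ) : modeLaw n ≪ volume :=
  (withDensity_absolutelyContinuous _ _).trans Measure.restrict_le_self.absolutelyContinuous

theorem modeLaw_le (n : ℤ) {A : Set ℝ} (hA : MeasurableSet A) :
    modeLaw n A ≤ ENNReal.ofReal (bracket n ^ 2) * volume A := by
  rw [modeLaw_apply n hA]
  calc _ ≤ ∫⁻ r in A ∩ Set.Ioi 0, ENNReal.ofReal (bracket n ^ 2) := by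
        refine setLIntegral_mono measurable_const fun r hr => ENNReal.ofReal_le_ofReal ?_
        have hb : 0 ≤ bracket n ^ 2 := sq_nonneg _
        refine mul_le_of_le_one_right hb (Real.exp_le_one_iff.2 ?_)
        exact neg_nonpos.2 (mul_nonneg hb hr.2.le)
    _ ≤ _ := by
        rw [setLIntegral_const]
        gcongr
        exact Set.inter_subset_left

theorem le_modeLaw (n : ℤ) {A : Set ℝ} (hA : MeasurableSet A) {β : ℝ}
    (hβ : A ⊆ Set.Ioc 0 β) :
    ENNReal.ofReal (bracket n ^ 2 * Real.exp (-(bracket n ^ 2 * β))) * volume A ≤ modeLaw n A := by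
  have h : A ∩ Set.Ioi 0 = A := Set.inter_eq_left.2 fun r hr => (hβ hr).1
  rw [modeLaw_apply n hA, h, ← setLIntegral_const]
  refine setLIntegral_mono (by fun_prop) fun r hr => ENNReal.ofReal_le_ofReal ?_
  have := (hβ hr).2
  gcongr

theorem modeLaw_Ioo_pos (n : ℤ) {α β : ℝ} (hα : 0 ≤ α) (h : α < β) :
    modeLaw n (Set.Ioo α β) ≠ 0 := by
  have h1 := le_modeLaw n (measurableSet_Ioo (a := α) (b := β)) (β := β)
    fun r hr => ⟨hα.trans_lt hr.1, hr.2.le⟩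
  intro h0
  rw [h0, nonpos_iff_eq_zero, mul_eq_zero, Real.volume_Ioo] at h1
  have := bracket_pos n
  rcases h1 with h1 | h1
  · rw [ENNReal.ofReal_eq_zero] at h1
    exact absurd h1 (not_le.2 (by positivity))
  · rw [ENNReal.ofReal_eq_zero] at h1
    linarith

/-- Given the other coefficients, `‖û(n)‖²` is exponentially distributed with rate `⟨n⟩²`. -/
theorem lintegral_mu_massSet {S : Set ℤ} {n : ℤ} (hn : n ∈ S) {Φ : HalfMinus → ℝ → ℝ≥0∞}
    (hm : Measurable (Function.uncurry Φ)) (hΦ : ∀ x u, Φ (setCoeff n x u) = Φ u) :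
    ∫⁻ u, Φ u (massSet S u) ∂mu =
      ∫⁻ u, ∫⁻ r, Φ u (massSet (S \ {n}) u + r) ∂modeLaw n ∂mu := by
  rw [lintegral_mu_resample n (Φ := fun u => Φ u (massSet S u))
    (hm.comp (measurable_id.prodMk (measurable_massSet S)))]
  refine lintegral_congr fun u => ?_
  simp_rw [hΦ, massSet_setCoeff hn]
  exact lintegral_norm_sq_div_bracket n (h := fun r => Φ u (massSet (S \ {n}) u + r))
    (hm.comp (measurable_const.prodMk (measurable_id.const_add _)))

theorem mu_massSet_preimage {S : Set ℤ} {n : ℤ} (hn : n ∈ S) {A : Set ℝ} (hA : MeasurableSet A) :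
    mu (massSet S ⁻¹' A) =
      ∫⁻ u, modeLaw n ((fun r => massSet (S \ {n}) u + r) ⁻¹' A) ∂mu := by
  have h := lintegral_mu_massSet hn (Φ := fun _ => A.indicator 1)
    ((measurable_one.indicator hA).comp measurable_snd) (fun _ _ => rfl)
  rw [← lintegral_indicator_one (measurable_massSet S hA)]
  refine h.trans (lintegral_congr fun u => ?_)
  rw [← lintegral_indicator_one ((measurable_const_add (massSet (S \ {n}) u)) hA)]
  rfl

theorem measurable_modeLaw_preimage (S : Set ℤ) (n : ℤ) {A : Set ℝ} (hA : MeasurableSet A) :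
    Measurable fun u => modeLaw n ((fun r => massSet S u + r) ⁻¹' A) := by
  have h : Measurable fun c : ℝ => modeLaw n ((fun r => c + r) ⁻¹' A) := by
    have h1 : MeasurableSet {z : ℝ × ℝ | z.1 + z.2 ∈ A} := measurable_add hA
    exact measurable_measure_prodMk_left h1
  exact h.comp (measurable_massSet S)

theorem massSet_tendsto_zero (u : HalfMinus) :
    Tendsto (fun I : Finset ℤ => massSet (I : Set ℤ)ᶜ u) atTop (𝓝 0) := by
  have h := tendsto_tsum_compl_atTop_zero fun n => ‖coeff u n‖ ^ 2
  refine h.congr fun I => ?_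
  rw [massSet, ← tsum_subtype]
  rfl

/-- Tail masses tend to zero, so some cofinite set of frequencies has mass below `δ` with positive
probability. The missing frequencies are restored one at a time: an exponential law charges every
interval `(0, ε)`. -/
theorem mu_massSet_lt_pos (S : Set ℤ) {δ : ℝ} (hδ : 0 < δ) : mu {u | massSet S u < δ} ≠ 0 := by
  have h1 : ∃ I : Finset ℤ, mu {u | massSet (I : Set ℤ)ᶜ u < δ} ≠ 0 := by
    by_contra! h
    have h2 : (⋃ I : Finset ℤ, {u | massSet (I : Set ℤ)ᶜ u < δ}) = Set.univ := by
      refine Set.eq_univ_of_forall fun u => ?_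
      obtain ⟨I, hI⟩ := ((massSet_tendsto_zero u).eventually_lt_const hδ).exists
      exact Set.mem_iUnion.2 ⟨I, hI⟩
    have h3 := measure_iUnion_null h
    rw [h2, measure_univ] at h3
    exact one_ne_zero h3
  have h2 : ∀ I : Finset ℤ, mu {u | massSet (I : Set ℤ)ᶜ u < δ} ≠ 0 →
      mu {u | massSet Set.univ u < δ} ≠ 0 := by
    intro I
    induction I using Finset.induction_on with
    | empty => simp
    | insert n I hn ih =>
      intro h
      refine ih fun h0 => h ?_
      have hset : ((insert n I : Finset ℤ) : Set ℤ)ᶜ = (I : Set ℤ)ᶜ \ {n} := by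
        ext j; simp [and_comm]
      have key := mu_massSet_preimage (S := (I : Set ℤ)ᶜ) (n := n) (by simpa using hn)
        (measurableSet_Iio (a := δ))
      have h3 : mu (massSet (I : Set ℤ)ᶜ ⁻¹' Set.Iio δ) = 0 := h0
      rw [h3, eq_comm, lintegral_eq_zero_iff (measurable_modeLaw_preimage _ n measurableSet_Iio)]
        at key
      rw [hset]
      refine measure_mono_null (fun u hu => ?_) key
      have hu' : massSet ((I : Set ℤ)ᶜ \ {n}) u < δ := hu
      refine fun hz => modeLaw_Ioo_pos n le_rfl (sub_pos.2 hu') (measure_mono_null ?_ hz)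
      intro r hr
      simp only [Set.mem_preimage, Set.mem_Iio]
      linarith [hr.2]
  obtain ⟨I, hI⟩ := h1
  intro h
  exact h2 I hI (measure_mono_null
    (fun u hu => lt_of_le_of_lt (massSet_mono (Set.subset_univ S) u) hu) h)

/-! ### The measure of a shell -/

theorem indicator_one_congr {α β : Type*} {S : Set α} {T : Set β} {a : α} {b : β}
    (h : a ∈ S ↔ b ∈ T) : S.indicator (1 : α → ℝ≥0∞) a = T.indicator 1 b := by
  by_cases ha : a ∈ S
  · simp [ha, h.1 ha]
  · simp [ha, mt h.2 ha]

theorem massOff_setCoeff {k : ℕ} {n : ℤ} (hn : |n| = k) (x : ℂ) (u : HalfMinus) :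
    massOff k (setCoeff n x u) = massOff k u := by
  rw [← massSet_off, ← massSet_off]
  exact massSet_setCoeff_of_notMem (by simpa using hn) x u

theorem massOn_setCoeff {k : ℕ} {n : ℤ} (hn : |n| ≠ k) (x : ℂ) (u : HalfMinus) :
    massOn k (setCoeff n x u) = massOn k u := by
  rw [← massSet_on, ← massSet_on]
  exact massSet_setCoeff_of_notMem (by rwa [Finset.mem_coe, mem_pm_iff]) x u

/-- The mass away from the frequencies `±k` and `n`. -/
def massRest (k : ℕ) (n : ℤ) (u : HalfMinus) : ℝ := massSet ({j | |j| ≠ (k : ℤ)} \ {n}) u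

theorem measurable_massRest (k : ℕ) (n : ℤ) : Measurable (massRest k n) := measurable_massSet _

theorem lintegral_mu_massOff {k : ℕ} {n : ℤ} (hn : |n| ≠ k) {Φ : HalfMinus → ℝ → ℝ≥0∞}
    (hm : Measurable (Function.uncurry Φ)) (hΦ : ∀ x u, Φ (setCoeff n x u) = Φ u) :
    ∫⁻ u, Φ u (massOff k u) ∂mu =
      ∫⁻ u, ∫⁻ r, Φ u (massRest k n u + r) ∂modeLaw n ∂mu := by
  have h := lintegral_mu_massSet (S := {j | |j| ≠ (k : ℤ)}) (n := n) hn hm hΦ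
  simp_rw [massSet_off] at h
  exact h

theorem measurableSet_shell_slice (m s : ℝ) : MeasurableSet
    {z : (ℝ × ℝ) | m < z.1 + s ^ 2 * z.2 ∧ z.1 + (1 / s) ^ 2 * z.2 ≤ m} := by
  have h1 : Measurable fun z : ℝ × ℝ => z.1 + s ^ 2 * z.2 := by fun_prop
  have h2 : Measurable fun z : ℝ × ℝ => z.1 + (1 / s) ^ 2 * z.2 := by fun_prop
  exact (measurableSet_lt measurable_const h1).inter (measurableSet_le h2 measurable_const)

/-- The scaling leaves `û(n)` alone. With the other coefficients fixed, the shell is therefore an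
interval for `‖û(n)‖²`, of length `(s² - s⁻²) massOn k u`. -/
theorem mu_shell_inter {k : ℕ} {n : ℤ} (hn : |n| ≠ k) (m s : ℝ) {E : Set HalfMinus}
    (hE : MeasurableSet E) (hEn : ∀ x u, setCoeff n x u ∈ E ↔ u ∈ E) :
    mu (shell k m s ∩ E) = ∫⁻ u in E, modeLaw n (Set.Ioc (m - massRest k n u - s ^ 2 * massOn k u)
      (m - massRest k n u - (1 / s) ^ 2 * massOn k u)) ∂mu := by
  let T : Set (HalfMinus × ℝ) := {z | z.1 ∈ E ∧
    m < z.2 + s ^ 2 * massOn k z.1 ∧ z.2 + (1 / s) ^ 2 * massOn k z.1 ≤ m}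
  have hT : MeasurableSet T := by
    have h1 : Measurable fun z : HalfMinus × ℝ => (z.2, massOn k z.1) :=
      measurable_snd.prodMk ((measurable_massOn k).comp measurable_fst)
    exact (measurable_fst hE).inter (h1 (measurableSet_shell_slice m s))
  have h := lintegral_mu_massOff hn (Φ := fun u r => T.indicator 1 (u, r))
    (measurable_one.indicator hT) (fun x u => by
      funext r
      refine indicator_one_congr ?_
      simp only [T, Set.mem_ofPred_eq, hEn, massOn_setCoeff hn])
  have h1 : mu (shell k m s ∩ E) = ∫⁻ u, T.indicator 1 (u, massOff k u) ∂mu := by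
    rw [← lintegral_indicator_one ((measurableSet_shell k m s).inter hE)]
    refine lintegral_congr fun u => ?_
    refine indicator_one_congr ?_
    simp only [T, Set.mem_ofPred_eq, Set.mem_inter_iff, mem_shell_iff]
    tauto
  rw [h1, h, ← lintegral_indicator hE]
  refine lintegral_congr fun u => ?_
  by_cases hu : u ∈ E
  · rw [Set.indicator_of_mem hu, ← lintegral_indicator_one measurableSet_Ioc]
    refine lintegral_congr fun r => ?_
    refine indicator_one_congr ?_
    simp only [T, Set.mem_ofPred_eq, hu, true_and, Set.mem_Ioc]
    constructor <;> rintro ⟨h1, h2⟩ <;> constructor <;> linarith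
  · simp [T, hu]

theorem lintegral_norm_sq_coeff_le (n : ℤ) :
    ∫⁻ u, ENNReal.ofReal (‖coeff u n‖ ^ 2) ∂mu ≤ ENNReal.ofReal (4 / bracket n ^ 2) := by
  have hb : 0 < bracket n ^ 2 := pow_pos (bracket_pos n) 2
  have h := lintegral_mu_prod {n} (φ := fun _ x => ENNReal.ofReal (‖x‖ ^ 2)) (fun _ => by fun_prop)
  simp only [Finset.prod_singleton, norm_sq_div_bracket] at h
  rw [h]
  simp_rw [ENNReal.ofReal_mul (inv_nonneg.2 hb.le)]
  rw [lintegral_const_mul _ (by fun_prop), div_eq_inv_mul, ENNReal.ofReal_mul (inv_nonneg.2 hb.le)]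
  gcongr
  simpa using lintegral_norm_sq_complexGaussian_le

theorem lintegral_massOn_le (k : ℕ) :
    ∫⁻ u, ENNReal.ofReal (massOn k u) ∂mu ≤ ENNReal.ofReal (8 / bracket k ^ 2) := by
  have hb : 0 < bracket k ^ 2 := pow_pos (bracket_pos k) 2
  simp_rw [massOn]
  simp_rw [ENNReal.ofReal_sum_of_nonneg fun (n : ℤ) _ => sq_nonneg _]
  rw [lintegral_finsetSum _ fun n _ => ((measurable_coeff_apply n).norm.pow_const 2).ennreal_ofReal]
  calc _ ≤ ∑ n ∈ ({(k : ℤ), -(k : ℤ)} : Finset ℤ), ENNReal.ofReal (4 / bracket k ^ 2) := by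
        refine Finset.sum_le_sum fun n hn => (lintegral_norm_sq_coeff_le n).trans (le_of_eq ?_)
        rw [Finset.mem_insert, Finset.mem_singleton] at hn
        rcases hn with rfl | rfl
        · rfl
        · rw [bracket_neg]
    _ ≤ 2 * ENNReal.ofReal (4 / bracket k ^ 2) := by
        rw [Finset.sum_const, nsmul_eq_mul]
        gcongr
        exact_mod_cast Finset.card_le_two
    _ = _ := by
        rw [← ENNReal.ofReal_ofNat 2, ← ENNReal.ofReal_mul (by norm_num)]
        congr 1
        ring

/-- A low mode away from `±k`, whose squared modulus has density at most 2 uniformly in `k`. -/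
theorem exists_abs_ne (k : ℕ) : ∃ n : ℤ, |n| ≠ k ∧ bracket n ^ 2 ≤ 2 := by
  rcases Nat.eq_zero_or_pos k with rfl | hk
  · exact ⟨1, by simp, by rw [bracket_sq]; norm_num⟩
  · exact ⟨0, by rw [abs_zero]; exact_mod_cast hk.ne, by rw [bracket_sq]; norm_num⟩

theorem shell_width_le {k : ℕ} {n : ℤ} (m : ℝ) {s : ℝ} (u : HalfMinus) :
    modeLaw n (Set.Ioc (m - massRest k n u - s ^ 2 * massOn k u)
      (m - massRest k n u - (1 / s) ^ 2 * massOn k u)) ≤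
      ENNReal.ofReal (bracket n ^ 2) * ENNReal.ofReal ((s ^ 2 - (1 / s) ^ 2) * massOn k u) := by
  refine (modeLaw_le n measurableSet_Ioc).trans (le_of_eq ?_)
  rw [Real.volume_Ioc]
  congr 2
  ring

/-- A density at most 2 on an interval of length `(s² - s⁻²) massOn k u`, together with the mean of
`massOn k`, at most `8/⟨k⟩²`. -/
theorem mu_shell_le (k : ℕ) (m : ℝ) {s : ℝ} (hs : 1 ≤ s) :
    mu (shell k m s) ≤ ENNReal.ofReal ((s ^ 2 - (1 / s) ^ 2) * (16 / bracket k ^ 2)) := by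
  obtain ⟨n, hn, hb⟩ := exists_abs_ne k
  have hk : 0 ≤ s ^ 2 - (1 / s) ^ 2 := by
    have : 1 / s ≤ 1 := by rw [div_le_one (by linarith)]; exact hs
    have h0 : 0 ≤ 1 / s := by positivity
    nlinarith
  have h := mu_shell_inter hn m s MeasurableSet.univ (by simp)
  rw [Set.inter_univ, setLIntegral_univ] at h
  rw [h]
  calc _ ≤ ∫⁻ u, ENNReal.ofReal (2 * (s ^ 2 - (1 / s) ^ 2)) * ENNReal.ofReal (massOn k u) ∂mu := by
        refine lintegral_mono fun u => (shell_width_le m u).trans ?_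
        rw [ENNReal.ofReal_mul hk, ENNReal.ofReal_mul (by norm_num), mul_assoc]
        gcongr
    _ ≤ _ := by
        rw [lintegral_const_mul _ (measurable_massOn k).ennreal_ofReal]
        refine (mul_le_mul_right (lintegral_massOn_le k) _).trans (le_of_eq ?_)
        rw [← ENNReal.ofReal_mul (by positivity)]
        congr 1
        ring

theorem le_modeLaw_Ioc (n : ℤ) {α : ℝ} (hα : 0 ≤ α) (β : ℝ) :
    ENNReal.ofReal (bracket n ^ 2 * Real.exp (-(bracket n ^ 2 * β)) * (β - α)) ≤
      modeLaw n (Set.Ioc α β) := by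
  have h1 := le_modeLaw n (measurableSet_Ioc (a := α) (b := β)) (β := β)
    fun r hr => ⟨hα.trans_lt hr.1, hr.2⟩
  rwa [Real.volume_Ioc, ← ENNReal.ofReal_mul (by positivity)] at h1

/-- Restrict the first variable to `(0, α]`; then the second must lie in an interval of length `β -
α` on the positive axis. The extra factor `α` reflects the vanishing at 0 of the density of a sum of
two exponentials. -/
theorem le_modeLaw_conv (n : ℤ) {α β : ℝ} (hα : 0 ≤ α) (h : α ≤ β) :
    ENNReal.ofReal (bracket n ^ 2 * Real.exp (-(bracket n ^ 2 * α)) * α *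
      (bracket n ^ 2 * Real.exp (-(bracket n ^ 2 * β)) * (β - α))) ≤
    ∫⁻ r', ∫⁻ r, (Set.Ioc α β).indicator 1 (r' + r) ∂modeLaw n ∂modeLaw n := by
  have hb : 0 ≤ bracket n ^ 2 := sq_nonneg _
  have h1 := le_modeLaw_Ioc n le_rfl α
  rw [sub_zero] at h1
  rw [ENNReal.ofReal_mul (by positivity), mul_comm]
  refine (mul_le_mul_right h1 _).trans ?_
  rw [← setLIntegral_const]
  refine (setLIntegral_mono' measurableSet_Ioc fun r' hr' => ?_).trans (setLIntegral_le_lintegral _ _)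
  have h2 := le_modeLaw_Ioc n (sub_nonneg.2 hr'.2) (β - r')
  rw [sub_sub_sub_cancel_right] at h2
  refine (ENNReal.ofReal_le_ofReal ?_).trans (h2.trans (le_of_eq ?_))
  · have := hr'.1.le
    have : 0 ≤ β - α := sub_nonneg.2 h
    gcongr
    linarith
  · rw [← lintegral_indicator_one measurableSet_Ioc]
    refine lintegral_congr fun r => indicator_one_congr ?_
    simp only [Set.mem_Ioc]
    constructor <;> rintro ⟨h1, h2⟩ <;> constructor <;> linarith

theorem massSet_empty (u : HalfMinus) : massSet ∅ u = 0 := by simp [massSet]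

theorem lintegral_mu_massOn_zero {Φ : HalfMinus → ℝ → ℝ≥0∞} (hm : Measurable (Function.uncurry Φ))
    (hΦ : ∀ x u, Φ (setCoeff 0 x u) = Φ u) :
    ∫⁻ u, Φ u (massOn 0 u) ∂mu = ∫⁻ u, ∫⁻ r, Φ u r ∂modeLaw 0 ∂mu := by
  have h := lintegral_mu_massSet (S := ((({((0 : ℕ) : ℤ), -((0 : ℕ) : ℤ)} : Finset ℤ)) : Set ℤ))
    (n := 0) (by simp) hm hΦ
  simp_rw [massSet_on] at h
  rw [h]
  simp [massSet_empty]

theorem lintegral_mu_massOn_pos {k : ℕ} (hk : 0 < k) {Φ : HalfMinus → ℝ → ℝ≥0∞}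
    (hm : Measurable (Function.uncurry Φ)) (hΦ : ∀ n x u, |n| = (k : ℤ) → Φ (setCoeff n x u) = Φ u) :
    ∫⁻ u, Φ u (massOn k u) ∂mu = ∫⁻ u, ∫⁻ r', ∫⁻ r, Φ u (r' + r) ∂modeLaw k ∂modeLaw k ∂mu := by
  have hne : -(k : ℤ) ≠ k := by omega
  have h := lintegral_mu_massSet (S := (({(k : ℤ), -(k : ℤ)} : Finset ℤ) : Set ℤ))
    (n := k) (by simp) hm (fun x u => hΦ k x u (by simp))
  have hS : (({(k : ℤ), -(k : ℤ)} : Finset ℤ) : Set ℤ) \ {(k : ℤ)} = {-(k : ℤ)} := by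
    ext j
    simp only [Finset.coe_insert, Finset.coe_singleton, Set.mem_sdiff, Set.mem_insert_iff,
      Set.mem_singleton_iff]
    omega
  have hlaw : modeLaw (-k) = modeLaw k := by simp only [modeLaw, bracket_neg]
  have hm2 : Measurable (Function.uncurry fun u z => ∫⁻ r, Φ u (z + r) ∂modeLaw k) := by
    have h3 : Measurable fun z : (HalfMinus × ℝ) × ℝ => Φ z.1.1 (z.1.2 + z.2) :=
      hm.comp ((measurable_fst.comp measurable_fst).prodMk
        ((measurable_snd.comp measurable_fst).add measurable_snd))
    exact h3.lintegral_prod_right'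
  simp_rw [massSet_on, hS] at h
  rw [h, lintegral_mu_massSet (S := {-(k : ℤ)}) (n := -k) (by simp) hm2
    (fun x u => by simp_rw [hΦ (-k) x u (by simp)])]
  simp [massSet_empty, hlaw]

/-- Here the modes `±k` are integrated out. With `w = m - massOff k u` the shell is `massOn k u ∈
(s⁻² w, s² w]`. The window for `massOff` makes `⟨k⟩² w` lie in `[m/2, m]`, where the law of `massOn`
has density at least of the order needed. -/
theorem mu_shell_ge (k : ℕ) {m s : ℝ} (hm : 0 < m) (hm2 : m ≤ 2) (hs : 1 < s) :
    ENNReal.ofReal ((s ^ 2 - (1 / s) ^ 2) * ((1 / s) ^ 2 * Real.exp (-(2 * (m * s ^ 2))) *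
      (m ^ 2 / 4))) * mu (massOff k ⁻¹' Set.Ioc (m - m / bracket k ^ 2) (m - m / 2 / bracket k ^ 2))
      ≤ mu (shell k m s) := by
  set b := bracket k ^ 2 with hbdef
  have hb : 0 < b := pow_pos (bracket_pos k) 2
  set q := (1 / s) ^ 2 with hq
  have hq0 : 0 < q := by positivity
  have hs1 : 1 < s ^ 2 := by nlinarith
  have hqs : q * s ^ 2 = 1 := by rw [hq]; field_simp
  have hq1 : q ≤ 1 := by nlinarith
  let Φ : HalfMinus → ℝ → ℝ≥0∞ := fun u y =>
    {z : (ℝ × ℝ) | m < z.1 + s ^ 2 * z.2 ∧ z.1 + q * z.2 ≤ m}.indicator 1 (massOff k u, y)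
  have hΦm : Measurable (Function.uncurry Φ) :=
    (measurable_one.indicator (measurableSet_shell_slice m s)).comp
      (((measurable_massOff k).comp measurable_fst).prodMk measurable_snd)
  have hΦi : ∀ n x u, |n| = (k : ℤ) → Φ (setCoeff n x u) = Φ u := fun n x u hn => by
    simp only [Φ, massOff_setCoeff hn]
  have hshell : mu (shell k m s) = ∫⁻ u, Φ u (massOn k u) ∂mu := by
    rw [← lintegral_indicator_one (measurableSet_shell k m s)]
    exact lintegral_congr fun u => indicator_one_congr (mem_shell_iff k m s u)
  have hΦeq : ∀ u y, Φ u y = (Set.Ioc (q * (m - massOff k u)) (s ^ 2 * (m - massOff k u))).indicator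
      1 y := by
    intro u y
    refine indicator_one_congr ?_
    simp only [Set.mem_ofPred_eq, Set.mem_Ioc]
    have e1 : s ^ 2 * y = s ^ 2 * (y - q * (m - massOff k u)) + (m - massOff k u) := by
      linear_combination (m - massOff k u) * hqs
    have e2 : q * y = q * (y - s ^ 2 * (m - massOff k u)) + (m - massOff k u) := by
      linear_combination (m - massOff k u) * hqs
    have p1 : 0 < s ^ 2 * (y - q * (m - massOff k u)) ↔ 0 < y - q * (m - massOff k u) :=
      mul_pos_iff_of_pos_left (by positivity)
    have p2 : 0 < q * (y - s ^ 2 * (m - massOff k u)) ↔ 0 < y - s ^ 2 * (m - massOff k u) :=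
      mul_pos_iff_of_pos_left hq0
    rw [e1, e2]
    constructor
    · rintro ⟨h1, h2⟩
      exact ⟨by linarith [p1.1 (by linarith)], by
        by_contra h3; linarith [p2.2 (by linarith)]⟩
    · rintro ⟨h1, h2⟩
      exact ⟨by linarith [p1.2 (by linarith)], by
        by_contra h3; linarith [p2.1 (by linarith)]⟩
  set P := massOff k ⁻¹' Set.Ioc (m - m / b) (m - m / 2 / b) with hP
  have hPm : MeasurableSet P := measurable_massOff k measurableSet_Ioc
  have hPw : ∀ u ∈ P, m / 2 ≤ b * (m - massOff k u) ∧ b * (m - massOff k u) ≤ m := by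
    intro u hu
    have h1 : m - m / b < massOff k u := hu.1
    have h2 : massOff k u ≤ m - m / 2 / b := hu.2
    constructor
    · have : m / 2 / b ≤ m - massOff k u := by linarith
      rwa [div_le_iff₀' hb] at this
    · have : m - massOff k u ≤ m / b := by linarith
      rwa [le_div_iff₀' hb] at this
  have hw0 : ∀ u ∈ P, 0 ≤ m - massOff k u := fun u hu =>
    nonneg_of_mul_nonneg_right (by linarith [(hPw u hu).1] : 0 ≤ b * (m - massOff k u)) hb
  have hαβ : ∀ u ∈ P, q * (m - massOff k u) ≤ s ^ 2 * (m - massOff k u) := fun u hu =>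
    mul_le_mul_of_nonneg_right (by linarith) (hw0 u hu)
  rw [hshell, ← setLIntegral_const]
  rcases Nat.eq_zero_or_pos k with h0 | hk
  · subst h0
    have hb1 : b = 1 := by rw [hbdef, bracket_sq]; simp
    rw [lintegral_mu_massOn_zero hΦm (fun x u => hΦi 0 x u (by simp))]
    refine (setLIntegral_mono' hPm fun u hu => ?_).trans (setLIntegral_le_lintegral _ _)
    simp_rw [hΦeq]
    rw [lintegral_indicator_one measurableSet_Ioc]
    refine le_trans (ENNReal.ofReal_le_ofReal ?_)
      (le_modeLaw_Ioc 0 (mul_nonneg hq0.le (hw0 u hu)) _)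
    have e : bracket 0 ^ 2 = 1 := hb1
    obtain ⟨w1, w2⟩ := hPw u hu
    rw [e, one_mul, one_mul]
    rw [hb1, one_mul] at w1 w2
    have hx : Real.exp (-(2 * (m * s ^ 2))) ≤ Real.exp (-(s ^ 2 * (m - massOff 0 u))) := by
      refine Real.exp_le_exp.2 ?_
      nlinarith
    -- A single mode gives only the first power of `w ≥ m/2`; `m ≤ 2` is what makes it dominate
    -- `m²/4`.
    calc _ ≤ (s ^ 2 - q) * (1 * Real.exp (-(s ^ 2 * (m - massOff 0 u))) * (m - massOff 0 u)) := by
          have : 0 ≤ s ^ 2 - q := by linarith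
          gcongr
          nlinarith
      _ = _ := by ring
  · rw [lintegral_mu_massOn_pos hk hΦm hΦi]
    refine (setLIntegral_mono' hPm fun u hu => ?_).trans (setLIntegral_le_lintegral _ _)
    simp_rw [hΦeq]
    refine le_trans (ENNReal.ofReal_le_ofReal ?_)
      (le_modeLaw_conv k (mul_nonneg hq0.le (hw0 u hu)) (hαβ u hu))
    rw [← hbdef]
    obtain ⟨w1, w2⟩ := hPw u hu
    set w := m - massOff k u
    have hx : Real.exp (-(2 * (m * s ^ 2))) ≤ Real.exp (-(b * (q * w))) * Real.exp (-(b * (s ^ 2 * w)))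
        := by
      rw [← Real.exp_add]
      refine Real.exp_le_exp.2 ?_
      have h1 : q * (b * w) ≤ s ^ 2 * m := by
        have := hw0 u hu
        exact mul_le_mul (by linarith) w2 (by positivity) (by positivity)
      have h2 : s ^ 2 * (b * w) ≤ s ^ 2 * m := by gcongr
      nlinarith
    calc _ ≤ (s ^ 2 - q) * (q * (Real.exp (-(b * (q * w))) * Real.exp (-(b * (s ^ 2 * w)))) *
          (b * w) ^ 2) := by
          have : 0 ≤ s ^ 2 - q := by linarith
          gcongr
          nlinarith
      _ = _ := by ring

/-! ### The density of the mass away from the frequencies `±k` -/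

theorem hasPDF_massOff (k : ℕ) : HasPDF (massOff k) mu volume := by
  rw [Real.hasPDF_iff_of_aemeasurable (measurable_massOff k).aemeasurable]
  refine Measure.AbsolutelyContinuous.mk fun A hA h0 => ?_
  obtain ⟨n, hn, -⟩ := exists_abs_ne k
  rw [Measure.map_apply (measurable_massOff k) hA]
  have h := mu_massSet_preimage (S := {j | |j| ≠ (k : ℤ)}) (n := n) hn hA
  rw [funext (massSet_off k)] at h
  rw [h, lintegral_eq_zero_iff (measurable_modeLaw_preimage _ n hA)]
  refine Eventually.of_forall fun u => modeLaw_absolutelyContinuous n ?_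
  rw [measure_preimage_add]
  exact h0

/-- The substitution `y ↦ m - y/⟨k⟩²` identifies the integral in the final bound with the
probability that occurs in `mu_shell_ge`. -/
theorem integral_density_eq (k : ℕ) {m : ℝ} (hm : 0 < m) :
    ∫ y in (m / 2)..m, density k (m - y / bracket k ^ 2) = bracket k ^ 2 *
      mu.real (massOff k ⁻¹' Set.Ioc (m - m / bracket k ^ 2) (m - m / 2 / bracket k ^ 2)) := by
  have hb : 0 < bracket k ^ 2 := pow_pos (bracket_pos k) 2
  have := hasPDF_massOff k
  rw [intervalIntegral.integral_comp_sub_div (density k) hb.ne' m, smul_eq_mul,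
    intervalIntegral.integral_of_le (by gcongr; linarith)]
  congr 1
  simp_rw [density]
  rw [integral_toReal (measurable_pdf _ _ _).aemeasurable.restrict
    (ae_restrict_of_ae pdf.ae_lt_top), ← map_eq_setLIntegral_pdf _ _ _ measurableSet_Ioc,
    Measure.map_apply (measurable_massOff k) measurableSet_Ioc]
  rfl

theorem mu_massOff_Ioc_ne_zero (k : ℕ) {α β : ℝ} (hα : 0 ≤ α) (h : α < β) :
    mu (massOff k ⁻¹' Set.Ioc α β) ≠ 0 := by
  obtain ⟨n, hn, -⟩ := exists_abs_ne k
  have h1 := mu_massSet_preimage (S := {j | |j| ≠ (k : ℤ)}) (n := n) hn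
    (measurableSet_Ioc (a := α) (b := β))
  rw [funext (massSet_off k)] at h1
  rw [h1]
  intro h0
  rw [lintegral_eq_zero_iff (measurable_modeLaw_preimage _ n measurableSet_Ioc)] at h0
  refine mu_massSet_lt_pos ({j | |j| ≠ (k : ℤ)} \ {n}) (sub_pos.2 h)
    (measure_mono_null (fun u hu => ?_) h0)
  intro hz
  have hu' : massSet ({j | |j| ≠ (k : ℤ)} \ {n}) u < β - α := hu
  have hnn := massSet_nonneg ({j | |j| ≠ (k : ℤ)} \ {n}) u
  refine modeLaw_Ioo_pos n hα (lt_sub_iff_add_lt'.2 (by linarith :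
    massSet ({j | |j| ≠ (k : ℤ)} \ {n}) u + α < β)) (measure_mono_null (fun r hr => ?_) hz)
  rw [Set.mem_preimage, Set.mem_Ioc]
  constructor <;> linarith [hr.1, hr.2]

theorem mu_massBall_ne_zero {m : ℝ} (hm : 0 < m) : mu (massBall m) ≠ 0 := by
  intro h
  refine mu_massSet_lt_pos Set.univ hm (measure_mono_null (fun u hu => ?_) h)
  have : massSet Set.univ u < m := hu
  rw [massSet_univ] at this
  exact this.le

/-! ### Splitting off the frequencies `±k` -/

/-- The frequencies `±k`, or their complement. -/
def pmSplit (k : ℕ) (e : Bool) : Set ℤ := {n | (|n| = (k : ℤ)) ↔ e = true}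

theorem neg_mem_pmSplit (k : ℕ) (e : Bool) (n : ℤ) : n ∈ pmSplit k e ↔ -n ∈ pmSplit k e := by
  simp [pmSplit]

theorem indicator_pmSplit_dilate (k : ℕ) (e : Bool) (σ : ℝ) (u : HalfMinus) (n : ℤ) :
    (pmSplit k e).indicator (coeff (dilate k σ u)) n =
      ((σ ^ e.toNat : ℝ) : ℂ) * (pmSplit k e).indicator (coeff u) n := by
  by_cases h : n ∈ pmSplit k e
  · rw [Set.indicator_of_mem h, Set.indicator_of_mem h, coeff_dilate]
    cases e
    · have : |n| ≠ (k : ℤ) := by simpa [pmSplit] using h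
      simp [this]
    · have : |n| = (k : ℤ) := by simpa [pmSplit] using h
      simp [this]
  · simp [h]

/-- After the split every factor contains only the frequencies `±k` or none of them, so each piece
is homogeneous of degree the number of `true` entries. -/
theorem quadTerm_dilate (k : ℕ) (e : Fin 4 → Bool) (N : ℕ) (σ : ℝ) (u : HalfMinus) :
    quadTerm (fun i => pmSplit k (e i)) N (dilate k σ u) =
      σ ^ (∑ i, (e i).toNat) * quadTerm (fun i => pmSplit k (e i)) N u := by
  rw [quadTerm_eq_sum, quadTerm_eq_sum, mul_left_comm]
  congr 1
  rw [Finset.mul_sum]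
  refine Finset.sum_congr rfl fun n _ => ?_
  simp only [indicator_pmSplit_dilate, map_mul, Complex.conj_ofReal]
  rw [mul_left_comm (σ ^ ∑ i, (e i).toNat)]
  congr 1
  rw [← Complex.re_ofReal_mul]
  congr 1
  rw [Fin.sum_univ_four, pow_add, pow_add, pow_add]
  push_cast
  ring

theorem sum_toNat_le (e : Fin 4 → Bool) : ∑ i, (e i).toNat ≤ 4 := by
  calc _ ≤ ∑ _i : Fin 4, 1 := Finset.sum_le_sum fun i _ => Bool.toNat_le _
    _ = 4 := by simp

/-- For a given quadruple of frequencies exactly one pattern `e` has all four indicators nonzero. -/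
theorem energyTerm_eq_sum (k N : ℕ) (u : HalfMinus) :
    energyTerm N u = ∑ e : Fin 4 → Bool, quadTerm (fun i => pmSplit k (e i)) N u := by
  rw [energyTerm_eq_quadTerm]
  simp_rw [quadTerm_eq_sum]
  rw [← Finset.mul_sum, Finset.sum_comm]
  congr 1
  refine Finset.sum_congr rfl fun n _ => ?_
  let v : Fin 4 → ℤ := ![n.1, n.2.1, n.2.2.1, n.2.2.2]
  have hmem : ∀ (i : Fin 4) (e : Fin 4 → Bool), v i ∈ pmSplit k (e i) ↔
      e i = decide (|v i| = (k : ℤ)) := by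
    intro i e
    simp only [pmSplit, Set.mem_ofPred_eq]
    cases e i <;> simp
  rw [Finset.sum_eq_single fun i => decide (|v i| = (k : ℤ))]
  · have h := fun i => (hmem i fun i => decide (|v i| = (k : ℤ))).2 rfl
    have h0 := h 0
    have h1 := h 1
    have h2 := h 2
    have h3 := h 3
    simp only [v, Matrix.cons_val] at h0 h1 h2 h3
    simp only [v, Matrix.cons_val, Set.indicator_of_mem h0, Set.indicator_of_mem h1,
      Set.indicator_of_mem h2, Set.indicator_of_mem h3, Set.indicator_univ]
  · intro e _ he
    obtain ⟨i, hi⟩ := Function.ne_iff.1 he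
    have hz : (pmSplit k (e i)).indicator (coeff u) (v i) = 0 :=
      Set.indicator_of_notMem (fun h => hi ((hmem i e).1 h)) _
    fin_cases i <;> simp only [v, Fin.zero_eta, Fin.mk_one, Fin.reduceFinMk, Matrix.cons_val] at hz <;>
      simp [hz]
  · simp

theorem exp_sum_le {ι : Type*} [Fintype ι] [Nonempty ι] (x : ι → ℝ) :
    Real.exp (∑ i, x i) ≤ ∑ i, Real.exp (Fintype.card ι * x i) := by
  obtain ⟨j, -, hj⟩ := Finset.exists_max_image Finset.univ x Finset.univ_nonempty
  calc _ ≤ Real.exp (Fintype.card ι * x j) := by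
        refine Real.exp_le_exp.2 ?_
        have := Finset.sum_le_card_nsmul Finset.univ x (x j) hj
        simpa using this
    _ ≤ _ := Finset.single_le_sum (f := fun i => Real.exp (Fintype.card ι * x i))
        (fun i _ => (Real.exp_pos _).le) (Finset.mem_univ j)

theorem exp_energyTerm_le (k N : ℕ) (p : ℝ) (u : HalfMinus) :
    Real.exp (p * energyTerm N u) ≤
      ∑ e : Fin 4 → Bool, Real.exp (16 * p * quadTerm (fun i => pmSplit k (e i)) N u) := by
  rw [energyTerm_eq_sum k, Finset.mul_sum]
  refine (exp_sum_le _).trans (le_of_eq ?_)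
  refine Finset.sum_congr rfl fun e _ => ?_
  simp [mul_assoc]

/-- The degree is at most 4 and `(3/5)⁴ ≥ 1/10`, so a tenfold exponent compensates the contraction
where the piece is positive; where it is negative, the summand 1 suffices. -/
theorem exp_le_one_add_exp_dilate {p : ℝ} (hp : 0 ≤ p) (k N : ℕ) (e : Fin 4 → Bool) {σ : ℝ}
    (hσ : 3 / 5 ≤ σ) (hσ1 : σ ≤ 1) (u : HalfMinus) :
    Real.exp (48 * p * quadTerm (fun i => pmSplit k (e i)) N u) ≤
      1 + Real.exp (480 * p * quadTerm (fun i => pmSplit k (e i)) N (dilate k σ u)) := by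
  rw [quadTerm_dilate]
  set f := quadTerm (fun i => pmSplit k (e i)) N u
  set j := ∑ i, (e i).toNat
  have hj : (1 / 10 : ℝ) ≤ σ ^ j := by
    calc (1 / 10 : ℝ) ≤ (3 / 5) ^ 4 := by norm_num
      _ ≤ σ ^ 4 := by gcongr
      _ ≤ σ ^ j := pow_le_pow_of_le_one (by linarith) hσ1 (sum_toNat_le e)
  rcases le_total f 0 with hf | hf
  · have : Real.exp (48 * p * f) ≤ 1 := Real.exp_le_one_iff.2 (by
      exact mul_nonpos_of_nonneg_of_nonpos (by positivity) hf)
    linarith [Real.exp_pos (480 * p * (σ ^ j * f))]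
  · have : Real.exp (48 * p * f) ≤ Real.exp (480 * p * (σ ^ j * f)) := by
      refine Real.exp_le_exp.2 ?_
      have := mul_le_mul_of_nonneg_right hj (mul_nonneg hp hf)
      nlinarith
    linarith

theorem dilate_dilate_inv (k : ℕ) {σ : ℝ} (hσ : σ ≠ 0) (u : HalfMinus) :
    dilate k σ (dilate k σ⁻¹ u) = u := by
  apply coeff_injective
  ext n
  have h : (σ : ℂ) ≠ 0 := by exact_mod_cast hσ
  simp only [coeff_dilate]
  split_ifs
  · push_cast
    rw [mul_inv_cancel_left₀ h]
  · rfl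

theorem pmCard_le (k : ℕ) : pmCard k ≤ 2 := Finset.card_le_two

theorem lintegral_inv_Ico {a b : ℝ} (ha : 0 < a) (hab : a ≤ b) :
    ∫⁻ σ in Set.Ico a b, ENNReal.ofReal σ⁻¹ = ENNReal.ofReal (Real.log (b / a)) := by
  rw [← integral_inv_of_pos ha (ha.trans_le hab), intervalIntegral.integral_of_le hab,
    ← integral_Ico_eq_integral_Ioc, ofReal_integral_eq_lintegral_ofReal]
  · have hc : ContinuousOn (fun x : ℝ => x⁻¹) (Set.Icc a b) :=
      continuousOn_inv₀.mono fun x hx => (ha.trans_le hx.1).ne'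
    exact hc.integrableOn_Icc.mono_set Set.Ico_subset_Icc_self
  · refine (ae_restrict_iff' measurableSet_Ico).2 (Eventually.of_forall fun x hx => ?_)
    exact inv_nonneg.2 (ha.le.trans hx.1)

/-! ### Exponential moments on a shell -/

theorem mem_shell_dilate_iff (k : ℕ) (m s t : ℝ) (u : HalfMinus) : dilate k t u ∈ shell k m s ↔
    m < massOff k u + s ^ 2 * (t ^ 2 * massOn k u) ∧
      massOff k u + (1 / s) ^ 2 * (t ^ 2 * massOn k u) ≤ m := by
  rw [mem_shell_iff, massOff_dilate, massOn_dilate]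

theorem massOff_lt_of_mem_shell {k : ℕ} {m s : ℝ} {u : HalfMinus} (hu : u ∈ shell k m s) :
    massOff k u < m ∧ 0 < massOn k u := by
  obtain ⟨h1, h2⟩ := (mem_shell_iff k m s u).1 hu
  have hY := massOn_nonneg k u
  have h3 : 0 < massOn k u := by
    rcases hY.eq_or_lt with h | h
    · rw [← h] at h1 h2
      linarith
    · exact h
  refine ⟨?_, h3⟩
  -- For `s = 0` also `1 / s = 0`, and the two shell conditions contradict each other.
  by_cases hs : s = 0
  · subst hs; simp at h1 h2; linarith
  · have : 0 < (1 / s) ^ 2 * massOn k u := by positivity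
    linarith

/-- Solving the shell inequalities for `σ` gives the interval `[c/s, cs)` around the ratio `c` that
carries the sphere of mass `m` to `u`. -/
theorem mem_Ico_of_dilate_inv_mem_shell {k : ℕ} {m s σ : ℝ} (hs : 0 < s) (hσ : 0 < σ)
    {u : HalfMinus} (hu : dilate k σ⁻¹ u ∈ shell k m s) :
    0 < massOn k u ∧ massOff k u < m ∧ σ ∈ Set.Ico (√(massOn k u / (m - massOff k u)) / s)
      (√(massOn k u / (m - massOff k u)) * s) := by
  obtain ⟨h3, h4⟩ := massOff_lt_of_mem_shell hu
  rw [massOff_dilate] at h3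
  rw [massOn_dilate] at h4
  have hY : 0 < massOn k u := pos_of_mul_pos_right h4 (sq_nonneg _)
  obtain ⟨h1, h2⟩ := (mem_shell_dilate_iff k m s σ⁻¹ u).1 hu
  set Y := massOn k u
  set w := m - massOff k u with hw
  have hw0 : 0 < w := by linarith
  refine ⟨hY, h3, ?_, ?_⟩
  · rw [div_le_iff₀ hs]
    refine Real.sqrt_le_iff.2 ⟨by positivity, ?_⟩
    rw [div_le_iff₀ hw0]
    have h5 : (1 / s) ^ 2 * (σ⁻¹ ^ 2 * Y) ≤ w := by linarith
    calc Y = (σ * s) ^ 2 * ((1 / s) ^ 2 * (σ⁻¹ ^ 2 * Y)) := by field_simp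
      _ ≤ _ := by gcongr
  · rw [← div_lt_iff₀ hs]
    refine Real.lt_sqrt_of_sq_lt ?_
    rw [lt_div_iff₀ hw0]
    have h5 : w < s ^ 2 * (σ⁻¹ ^ 2 * Y) := by linarith
    calc (σ / s) ^ 2 * w < (σ / s) ^ 2 * (s ^ 2 * (σ⁻¹ ^ 2 * Y)) := by gcongr
      _ = Y := by field_simp

theorem mass_le_of_dilate_inv_mem_shell {k : ℕ} {m s σ : ℝ} (hs : 1 ≤ s) (hσ : 0 < σ) (hσ1 : σ ≤ 1)
    {u : HalfMinus} (hu : dilate k σ⁻¹ u ∈ shell k m s) : mass u.1 ≤ s ^ 2 * m := by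
  obtain ⟨-, h2⟩ := (mem_shell_dilate_iff k m s σ⁻¹ u).1 hu
  rw [mass_eq k]
  have hX := massOff_nonneg k u
  have hY := massOn_nonneg k u
  have h3 : 1 ≤ σ⁻¹ ^ 2 := one_le_pow₀ ((one_le_inv₀ hσ).2 hσ1)
  have h4 : 1 ≤ s ^ 2 := one_le_pow₀ hs
  calc massOff k u + massOn k u ≤ s ^ 2 * massOff k u + σ⁻¹ ^ 2 * massOn k u := by
        gcongr
        · nlinarith
        · nlinarith
    _ = s ^ 2 * (massOff k u + (1 / s) ^ 2 * (σ⁻¹ ^ 2 * massOn k u)) := by field_simp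
    _ ≤ _ := by gcongr

/-- `dσ/σ` is invariant under dilation, so the interval `[c/s, cs)` has length `2 log s`
irrespective of `u`. -/
theorem lintegral_inv_shell_le (k : ℕ) {m m₀ s : ℝ} (hs : 1 < s) (hsm : s ^ 2 * m < m₀)
    (u : HalfMinus) :
    ∫⁻ σ in Set.Ico (3 / 5 : ℝ) 1, ENNReal.ofReal σ⁻¹ *
      (shell k m s).indicator 1 (dilate k σ⁻¹ u) ≤
      ENNReal.ofReal (2 * Real.log s) * {u : HalfMinus | mass u.1 < m₀}.indicator 1 u := by
  by_cases h : ∃ σ ∈ Set.Ico (3 / 5 : ℝ) 1, dilate k σ⁻¹ u ∈ shell k m s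
  · obtain ⟨σ₀, hσ₀, hu⟩ := h
    have h0 : 0 < σ₀ := by linarith [hσ₀.1]
    have hmass := (mass_le_of_dilate_inv_mem_shell hs.le h0 hσ₀.2.le hu).trans_lt hsm
    rw [Set.indicator_of_mem (s := {u : HalfMinus | mass u.1 < m₀}) hmass, Pi.one_apply, mul_one]
    obtain ⟨hY, hX, -⟩ := mem_Ico_of_dilate_inv_mem_shell (by linarith) h0 hu
    set c := √(massOn k u / (m - massOff k u)) with hc
    have hc0 : 0 < c := Real.sqrt_pos.2 (div_pos hY (by linarith))
    have hlog : Real.log (c * s / (c / s)) = 2 * Real.log s := by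
      have : c * s / (c / s) = s ^ 2 := by field_simp
      rw [this, Real.log_pow]
      norm_num
    rw [← hlog, ← lintegral_inv_Ico (by positivity) (by
      rw [div_le_iff₀ (by linarith)]; nlinarith [mul_pos hc0 (by linarith : 0 < s)]),
      ← lintegral_indicator measurableSet_Ico, ← lintegral_indicator measurableSet_Ico]
    refine lintegral_mono fun σ => ?_
    by_cases hσ : σ ∈ Set.Ico (3 / 5 : ℝ) 1
    · rw [Set.indicator_of_mem hσ]
      by_cases hd : dilate k σ⁻¹ u ∈ shell k m s
      · have h2 := (mem_Ico_of_dilate_inv_mem_shell (by linarith) (by linarith [hσ.1]) hd).2.2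
        rw [Set.indicator_of_mem hd, Set.indicator_of_mem h2, Pi.one_apply, mul_one]
      · rw [Set.indicator_of_notMem hd, mul_zero]
        exact zero_le
    · rw [Set.indicator_of_notMem hσ]
      exact zero_le
  · push Not at h
    rw [setLIntegral_congr_fun (g := fun _ => 0) measurableSet_Ico fun σ hσ => by
      simp only [Set.indicator_of_notMem (h σ hσ), mul_zero]]
    simp

/-- Change of variables by `σ⁻¹ ≥ 1`: the Gaussian factor is then at most 1, and the Jacobian is at
most `(5/3)⁴` as there are at most two modes. -/
theorem lintegral_shell_dilate_le (k : ℕ) (m s : ℝ) {σ : ℝ} (hσ : 3 / 5 ≤ σ) (hσ1 : σ ≤ 1)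
    {F : HalfMinus → ℝ≥0∞} (hF : Measurable F) :
    ∫⁻ u in shell k m s, F (dilate k σ u) ∂mu ≤ ENNReal.ofReal ((5 / 3) ^ 4) *
      ∫⁻ u, (shell k m s).indicator 1 (dilate k σ⁻¹ u) * F u ∂mu := by
  have h0 : 0 < σ := by linarith
  have hsh := measurableSet_shell k m s
  have hd : ∀ t : ℝ, Measurable fun u => dilate k t u := fun t =>
    (measurable_dilate k).comp (measurable_id.prodMk measurable_const)
  have h1 : Measurable ((shell k m s).indicator fun u => F (dilate k σ u)) :=
    (hF.comp (hd σ)).indicator hsh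
  have h2 : Measurable fun u => (shell k m s).indicator 1 (dilate k σ⁻¹ u) * F u :=
    ((measurable_one.indicator hsh).comp (hd σ⁻¹)).mul hF
  rw [← lintegral_indicator hsh, lintegral_mu_dilate k (inv_pos.2 h0) h1,
    ← lintegral_const_mul _ h2]
  refine lintegral_mono fun u => ?_
  by_cases hu : dilate k σ⁻¹ u ∈ shell k m s
  · rw [Set.indicator_of_mem hu, Set.indicator_of_mem hu, Pi.one_apply, one_mul,
      dilate_dilate_inv k h0.ne', mul_comm]
    gcongr
    have h1 : 1 ≤ σ⁻¹ := (one_le_inv₀ h0).2 hσ1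
    have h2 : σ⁻¹ ≤ 5 / 3 := by
      rw [inv_le_comm₀ h0 (by norm_num)]
      linarith
    have h3 : (σ⁻¹ ^ 2) ^ pmCard k ≤ (5 / 3) ^ 4 := by
      calc (σ⁻¹ ^ 2) ^ pmCard k ≤ (σ⁻¹ ^ 2) ^ 2 :=
            pow_le_pow_right₀ (one_le_pow₀ h1) (pmCard_le k)
        _ = σ⁻¹ ^ 4 := by ring
        _ ≤ _ := by gcongr
    have h4 : Real.exp (-(σ⁻¹ ^ 2 - 1) * (bracket k ^ 2 * massOn k u)) ≤ 1 := by
      refine Real.exp_le_one_iff.2 (mul_nonpos_of_nonpos_of_nonneg ?_ ?_)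
      · linarith [one_le_pow₀ (n := 2) h1]
      · exact mul_nonneg (sq_nonneg _) (massOn_nonneg k u)
    calc _ ≤ (5 / 3 : ℝ) ^ 4 * 1 := by gcongr
      _ = _ := mul_one _
  · rw [Set.indicator_of_notMem hu, zero_mul]
    exact zero_le

/-- The threshold controls an integral over a ball, not over a thin shell. Average the dilation
bound over `σ` against `dσ/σ`, of total mass `log(5/3)`, and exchange integrals: the dilated shells
stay in the ball and cover each point for time at most `2 log s`, so the thinness of the shell is
retained. -/
theorem lintegral_shell_exp_le {p m₀ K : ℝ} (hp : 0 ≤ p) (N k : ℕ) (e : Fin 4 → Bool)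
    (hK : ∫⁻ u in {u : HalfMinus | mass u.1 < m₀}, ENNReal.ofReal (Real.exp (480 * p *
      quadTerm (fun i => pmSplit k (e i)) N u)) ∂mu ≤ ENNReal.ofReal K)
    {m s : ℝ} (hs : 1 < s) (hsm : s ^ 2 * m < m₀) :
    ∫⁻ u in shell k m s, ENNReal.ofReal (Real.exp (48 * p *
      quadTerm (fun i => pmSplit k (e i)) N u)) ∂mu ≤ mu (shell k m s) +
      ENNReal.ofReal ((5 / 3) ^ 4 * (2 * Real.log s) / Real.log (5 / 3)) * ENNReal.ofReal K := by
  set f := quadTerm (fun i => pmSplit k (e i)) N with hf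
  have hfm : Measurable f := measurable_quadTerm _ N
  set F : HalfMinus → ℝ≥0∞ := fun u => ENNReal.ofReal (Real.exp (480 * p * f u)) with hF
  have hFm : Measurable F := by fun_prop
  set I := ∫⁻ u in shell k m s, ENNReal.ofReal (Real.exp (48 * p * f u)) ∂mu with hI
  have hsh := measurableSet_shell k m s
  have hlog : 0 < Real.log (5 / 3) := Real.log_pos (by norm_num)
  have hlogs : 0 ≤ Real.log s := Real.log_nonneg hs.le
  set c := ENNReal.ofReal ((5 / 3) ^ 4)
  set B : ℝ → ℝ≥0∞ := fun σ => ∫⁻ u, (shell k m s).indicator 1 (dilate k σ⁻¹ u) * F u ∂mu with hB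
  have hσ : ∀ σ ∈ Set.Ico (3 / 5 : ℝ) 1, I ≤ mu (shell k m s) + c * B σ := by
    intro σ hσ
    calc I ≤ ∫⁻ u in shell k m s, (1 + F (dilate k σ u)) ∂mu := by
          refine lintegral_mono fun u => ?_
          have h1 := exp_le_one_add_exp_dilate hp k N e hσ.1 hσ.2.le u
          calc _ ≤ ENNReal.ofReal (1 + Real.exp (480 * p * f (dilate k σ u))) :=
                ENNReal.ofReal_le_ofReal h1
            _ = _ := by rw [ENNReal.ofReal_add zero_le_one (Real.exp_pos _).le, ENNReal.ofReal_one]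
      _ = mu (shell k m s) + ∫⁻ u in shell k m s, F (dilate k σ u) ∂mu := by
          rw [lintegral_add_left measurable_const, setLIntegral_one]
      _ ≤ _ := by
          gcongr
          exact lintegral_shell_dilate_le k m s hσ.1 hσ.2.le hFm
  have hL : ∫⁻ σ in Set.Ico (3 / 5 : ℝ) 1, ENNReal.ofReal σ⁻¹ = ENNReal.ofReal (Real.log (5 / 3)) := by
    rw [lintegral_inv_Ico (by norm_num) (by norm_num)]
    norm_num
  have hinv : Measurable fun σ : ℝ => ENNReal.ofReal σ⁻¹ := by fun_prop
  have hjoint : Measurable fun z : ℝ × HalfMinus => ENNReal.ofReal z.1⁻¹ *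
      ((shell k m s).indicator 1 (dilate k z.1⁻¹ z.2) * F z.2) := by
    refine (hinv.comp measurable_fst).mul (Measurable.mul ?_ (hFm.comp measurable_snd))
    exact (measurable_one.indicator hsh).comp ((measurable_dilate k).comp
      (measurable_snd.prodMk measurable_fst.inv))
  have hBint : ∫⁻ σ in Set.Ico (3 / 5 : ℝ) 1, ENNReal.ofReal σ⁻¹ * B σ ≤
      ENNReal.ofReal (2 * Real.log s) * ENNReal.ofReal K := by
    calc _ = ∫⁻ σ in Set.Ico (3 / 5 : ℝ) 1, ∫⁻ u, ENNReal.ofReal σ⁻¹ *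
            ((shell k m s).indicator 1 (dilate k σ⁻¹ u) * F u) ∂mu := by
          refine lintegral_congr fun σ => ?_
          rw [lintegral_const_mul' _ _ ENNReal.ofReal_ne_top]
      _ = ∫⁻ u, (∫⁻ σ in Set.Ico (3 / 5 : ℝ) 1, ENNReal.ofReal σ⁻¹ *
            ((shell k m s).indicator 1 (dilate k σ⁻¹ u) * F u)) ∂mu :=
          lintegral_lintegral_swap hjoint.aemeasurable
      _ ≤ ∫⁻ u, ENNReal.ofReal (2 * Real.log s) *
            {u : HalfMinus | mass u.1 < m₀}.indicator F u ∂mu := by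
          refine lintegral_mono fun u => ?_
          have hm1 : Measurable fun σ : ℝ => ENNReal.ofReal σ⁻¹ *
              (shell k m s).indicator 1 (dilate k σ⁻¹ u) :=
            hinv.mul ((measurable_one.indicator hsh).comp ((measurable_dilate k).comp
              (measurable_const.prodMk measurable_inv)))
          simp_rw [← mul_assoc]
          rw [lintegral_mul_const _ hm1]
          refine (mul_le_mul_left (lintegral_inv_shell_le k hs hsm u) _).trans (le_of_eq ?_)
          rw [mul_assoc]
          congr 1
          by_cases hu : u ∈ {u : HalfMinus | mass u.1 < m₀}
          · simp only [Set.indicator_of_mem hu, Pi.one_apply, one_mul]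
          · simp only [Set.indicator_of_notMem hu, zero_mul]
      _ ≤ _ := by
          have hms : MeasurableSet {u : HalfMinus | mass u.1 < m₀} :=
            measurable_mass measurableSet_Iio
          rw [lintegral_const_mul _ (hFm.indicator hms), lintegral_indicator hms]
          gcongr
  have hmul : ENNReal.ofReal (Real.log (5 / 3)) * I ≤ ENNReal.ofReal (Real.log (5 / 3)) *
      (mu (shell k m s) + ENNReal.ofReal ((5 / 3) ^ 4 * (2 * Real.log s) / Real.log (5 / 3)) *
        ENNReal.ofReal K) := by
    calc ENNReal.ofReal (Real.log (5 / 3)) * I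
        = ∫⁻ σ in Set.Ico (3 / 5 : ℝ) 1, ENNReal.ofReal σ⁻¹ * I := by
          rw [lintegral_mul_const _ hinv, hL]
      _ ≤ ∫⁻ σ in Set.Ico (3 / 5 : ℝ) 1, (ENNReal.ofReal σ⁻¹ * mu (shell k m s) +
            c * (ENNReal.ofReal σ⁻¹ * B σ)) := by
          refine setLIntegral_mono' measurableSet_Ico fun σ h => ?_
          rw [mul_left_comm c, ← mul_add]
          exact mul_le_mul_right (hσ σ h) _
      _ = ENNReal.ofReal (Real.log (5 / 3)) * mu (shell k m s) +
            c * ∫⁻ σ in Set.Ico (3 / 5 : ℝ) 1, ENNReal.ofReal σ⁻¹ * B σ := by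
          rw [lintegral_add_left (hinv.mul_const _), lintegral_mul_const _ hinv, hL,
            lintegral_const_mul' _ _ ENNReal.ofReal_ne_top]
      _ ≤ ENNReal.ofReal (Real.log (5 / 3)) * mu (shell k m s) +
            c * (ENNReal.ofReal (2 * Real.log s) * ENNReal.ofReal K) := by gcongr
      _ = _ := by
          rw [mul_add, ← mul_assoc c, ← mul_assoc, ← ENNReal.ofReal_mul (by positivity),
            ← ENNReal.ofReal_mul hlog.le]
          congr 3
          field_simp
  exact (ENNReal.mul_le_mul_iff_right (by simpa using hlog) ENNReal.ofReal_ne_top).1 hmul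

/-! ### Interpolation between the shell measure and the higher moment -/

theorem two_log_le {s : ℝ} (hs : 1 ≤ s) : 2 * Real.log s ≤ s ^ 2 - (1 / s) ^ 2 := by
  have h1 : Real.log (s ^ 2) ≤ s ^ 2 - 1 := Real.log_le_sub_one_of_pos (by positivity)
  rw [Real.log_pow] at h1
  have h2 : (1 / s) ^ 2 ≤ 1 := pow_le_one₀ (by positivity) (by
    rw [div_le_one (by linarith)]; exact hs)
  push_cast at h1
  linarith

theorem exp_le_add_mul_exp {R : ℝ} (hR : 0 < R) (x : ℝ) :
    Real.exp (16 * x) ≤ R + (R ^ 2)⁻¹ * Real.exp (48 * x) := by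
  have h : Real.exp (48 * x) = Real.exp (16 * x) ^ 3 := by
    rw [← Real.exp_nat_mul]; congr 1; push_cast; ring
  rw [h]
  set y := Real.exp (16 * x)
  have hy : 0 < y := Real.exp_pos _
  rcases le_total y R with h1 | h1
  · have : 0 ≤ (R ^ 2)⁻¹ * y ^ 3 := by positivity
    linarith
  · have : y ≤ (R ^ 2)⁻¹ * y ^ 3 := by
      rw [inv_mul_eq_div, le_div_iff₀ (by positivity)]
      have : R ^ 2 ≤ y ^ 2 := by gcongr
      nlinarith
    linarith

/-- The moment of order `48p` carries no decay in `k`, whereas the measure of the shell decays like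
`⟨k⟩⁻²`. Cutting `exp(16p f)` at height `R` transfers part of that decay to the moment of order
`16p`. -/
theorem lintegral_shell_exp_split_le {p m₀ K : ℝ} (hp : 0 ≤ p) (hK0 : 0 ≤ K) (N k : ℕ)
    (e : Fin 4 → Bool)
    (hK : ∫⁻ u in {u : HalfMinus | mass u.1 < m₀}, ENNReal.ofReal (Real.exp (480 * p *
      quadTerm (fun i => pmSplit k (e i)) N u)) ∂mu ≤ ENNReal.ofReal K)
    {m s : ℝ} (hs : 1 < s) (hsm : s ^ 2 * m < m₀) :
    ∫⁻ u in shell k m s, ENNReal.ofReal (Real.exp (16 * p *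
      quadTerm (fun i => pmSplit k (e i)) N u)) ∂mu ≤
      ENNReal.ofReal ((s ^ 2 - (1 / s) ^ 2) * ((32 + (5 / 3) ^ 4 * K / Real.log (5 / 3)) *
        bracket k ^ (-(21 / 20) : ℝ))) := by
  set f := quadTerm (fun i => pmSplit k (e i)) N with hf
  have hfm : Measurable f := measurable_quadTerm _ N
  set B := bracket k with hB
  have hB1 : 1 ≤ B := one_le_bracket k
  have hB0 : 0 < B := bracket_pos k
  -- Then `R B⁻² = B^(-21/20)` and `R⁻² = B^(-19/10)` is smaller still.
  set R := B ^ (19 / 20 : ℝ) with hR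
  have hR0 : 0 < R := Real.rpow_pos_of_pos hB0 _
  set κ := s ^ 2 - (1 / s) ^ 2 with hκ
  have hlog : 0 < Real.log (5 / 3) := Real.log_pos (by norm_num)
  have hlogs : 0 ≤ Real.log s := Real.log_nonneg hs.le
  have hκs : 2 * Real.log s ≤ κ := two_log_le hs.le
  have hκ0 : 0 ≤ κ := by linarith
  set L := (5 / 3) ^ 4 * K / Real.log (5 / 3) with hL
  have hL0 : 0 ≤ L := by positivity
  have h48 : ∫⁻ u in shell k m s, ENNReal.ofReal (Real.exp (48 * p * f u)) ∂mu ≤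
      ENNReal.ofReal (κ * (16 + L)) := by
    refine (lintegral_shell_exp_le hp N k e hK hs hsm).trans ?_
    rw [mul_add, ENNReal.ofReal_add (by positivity) (by positivity)]
    refine add_le_add ((mu_shell_le k m hs.le).trans (ENNReal.ofReal_le_ofReal ?_)) ?_
    · have : 16 / bracket k ^ 2 ≤ 16 := div_le_self (by norm_num) (one_le_pow₀ hB1)
      gcongr
    · rw [← ENNReal.ofReal_mul (by positivity)]
      refine ENNReal.ofReal_le_ofReal ?_
      rw [hL]
      calc _ = 2 * Real.log s * ((5 / 3) ^ 4 * K / Real.log (5 / 3)) := by ring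
        _ ≤ _ := by gcongr
  have hpt : ∀ u, ENNReal.ofReal (Real.exp (16 * p * f u)) ≤ ENNReal.ofReal R +
      ENNReal.ofReal (R ^ 2)⁻¹ * ENNReal.ofReal (Real.exp (48 * p * f u)) := by
    intro u
    rw [← ENNReal.ofReal_mul (by positivity), ← ENNReal.ofReal_add hR0.le (by positivity)]
    refine ENNReal.ofReal_le_ofReal ?_
    simpa only [mul_assoc] using exp_le_add_mul_exp hR0 (p * f u)
  have e1 : R * (16 / B ^ 2) = 16 * B ^ (-(21 / 20) : ℝ) := by
    have : (-(21 / 20) : ℝ) = 19 / 20 - (2 : ℕ) := by norm_num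
    rw [this, Real.rpow_sub_natCast hB0.ne']
    ring
  have e2 : (R ^ 2)⁻¹ ≤ B ^ (-(21 / 20) : ℝ) := by
    rw [hR, ← Real.rpow_mul_natCast hB0.le, ← Real.rpow_neg hB0.le]
    exact Real.rpow_le_rpow_of_exponent_le hB1 (by norm_num)
  calc _ ≤ ∫⁻ u in shell k m s, (ENNReal.ofReal R +
        ENNReal.ofReal (R ^ 2)⁻¹ * ENNReal.ofReal (Real.exp (48 * p * f u))) ∂mu :=
        lintegral_mono fun u => hpt u
    _ = ENNReal.ofReal R * mu (shell k m s) + ENNReal.ofReal (R ^ 2)⁻¹ *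
        ∫⁻ u in shell k m s, ENNReal.ofReal (Real.exp (48 * p * f u)) ∂mu := by
        rw [lintegral_add_left measurable_const, setLIntegral_const,
          lintegral_const_mul' _ _ ENNReal.ofReal_ne_top]
    _ ≤ ENNReal.ofReal R * ENNReal.ofReal (κ * (16 / B ^ 2)) + ENNReal.ofReal (R ^ 2)⁻¹ *
        ENNReal.ofReal (κ * (16 + L)) := by
        gcongr
        exact mu_shell_le k m hs.le
    _ = ENNReal.ofReal (κ * (R * (16 / B ^ 2) + (R ^ 2)⁻¹ * (16 + L))) := by
        rw [← ENNReal.ofReal_mul hR0.le, ← ENNReal.ofReal_mul (by positivity),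
          ← ENNReal.ofReal_add (by positivity) (by positivity)]
        congr 1
        ring
    _ ≤ _ := by
        refine ENNReal.ofReal_le_ofReal (mul_le_mul_of_nonneg_left ?_ hκ0)
        rw [e1]
        have := mul_le_mul_of_nonneg_right e2 (by linarith : 0 ≤ 16 + L)
        linarith

/-- Exponential moments of `f_N` on the shells, uniformly in `N` and `k`. -/
theorem exists_lintegral_shell_energyTerm_le {p m₀ : ℝ} (hp : 0 ≤ p)
    (h : IsThreshold (480 * p) m₀) : ∃ C : ℝ, 0 ≤ C ∧ ∀ (k N : ℕ) (m s : ℝ), 1 < s →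
      s ^ 2 * m < m₀ → ∫⁻ u in shell k m s, ENNReal.ofReal (Real.exp (p * energyTerm N u)) ∂mu ≤
        ENNReal.ofReal ((s ^ 2 - (1 / s) ^ 2) * (C * bracket k ^ (-(21 / 20) : ℝ))) := by
  obtain ⟨-, K, hK⟩ := h
  have hlog : 0 < Real.log (5 / 3) := Real.log_pos (by norm_num)
  set C₁ := 32 + (5 / 3) ^ 4 * max K 0 / Real.log (5 / 3) with hC₁
  have hC₁0 : 0 ≤ C₁ := by positivity
  refine ⟨16 * C₁, by positivity, fun k N m s hs hsm => ?_⟩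
  calc _ ≤ ∫⁻ u in shell k m s, ∑ e : Fin 4 → Bool, ENNReal.ofReal (Real.exp (16 * p *
        quadTerm (fun i => pmSplit k (e i)) N u)) ∂mu := by
        refine lintegral_mono fun u => ?_
        rw [← ENNReal.ofReal_sum_of_nonneg fun _ _ => (Real.exp_pos _).le]
        exact ENNReal.ofReal_le_ofReal (exp_energyTerm_le k N p u)
    _ = ∑ e : Fin 4 → Bool, ∫⁻ u in shell k m s, ENNReal.ofReal (Real.exp (16 * p *
        quadTerm (fun i => pmSplit k (e i)) N u)) ∂mu := by
        refine lintegral_finsetSum _ fun e _ => ?_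
        have := measurable_quadTerm (fun i => pmSplit k (e i)) N
        fun_prop
    _ ≤ ∑ _e : Fin 4 → Bool, ENNReal.ofReal ((s ^ 2 - (1 / s) ^ 2) *
        (C₁ * bracket k ^ (-(21 / 20) : ℝ))) := by
        refine Finset.sum_le_sum fun e _ => lintegral_shell_exp_split_le hp (le_max_right K 0) N k e
          ?_ hs hsm
        exact (hK N _ fun i n => neg_mem_pmSplit k (e i) n).trans
          (ENNReal.ofReal_le_ofReal (le_max_left K 0))
    _ = _ := by
        rw [Finset.sum_const, nsmul_eq_mul]
        have : ((Finset.univ : Finset (Fin 4 → Bool)).card : ℝ≥0∞) = ENNReal.ofReal 16 := by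
          simp
        rw [this, ← ENNReal.ofReal_mul (by norm_num)]
        congr 1
        ring

/-! ### The measures of thin shells -/

/-- The density of `modeLaw n`. -/
def modeDensity (n : ℤ) (r : ℝ) : ℝ≥0∞ :=
  (Set.Ioi 0).indicator
    (fun r => ENNReal.ofReal (bracket n ^ 2 * Real.exp (-(bracket n ^ 2 * r)))) r

theorem measurable_modeDensity (n : ℤ) : Measurable (modeDensity n) :=
  Measurable.indicator (by fun_prop) measurableSet_Ioi

theorem lintegral_modeLaw_eq (n : ℤ) {h : ℝ → ℝ≥0∞} (hh : Measurable h) :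
    ∫⁻ r, h r ∂modeLaw n = ∫⁻ r, modeDensity n r * h r := by
  rw [lintegral_modeLaw n hh, ← lintegral_indicator measurableSet_Ioi]
  refine lintegral_congr fun r => ?_
  by_cases hr : r ∈ Set.Ioi (0 : ℝ)
  · simp only [modeDensity, Set.indicator_of_mem hr]
  · simp only [modeDensity, Set.indicator_of_notMem hr, zero_mul]

theorem modeLaw_Ioc_le (n : ℤ) (α β : ℝ) : modeLaw n (Set.Ioc α β) ≤
    ENNReal.ofReal (bracket n ^ 2 * Real.exp (-(bracket n ^ 2 * α)) * (β - α)) := by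
  rw [modeLaw_apply n measurableSet_Ioc, ENNReal.ofReal_mul (by positivity), ← Real.volume_Ioc,
    ← setLIntegral_const]
  refine (lintegral_mono_set Set.inter_subset_left).trans
    (setLIntegral_mono' measurableSet_Ioc fun r hr => ENNReal.ofReal_le_ofReal ?_)
  have := hr.1
  gcongr

theorem tendsto_width : Tendsto (fun s : ℝ => s ^ 2) (𝓝[>] 1) (𝓝 1) ∧
    Tendsto (fun s : ℝ => (1 / s) ^ 2) (𝓝[>] 1) (𝓝 1) := by
  constructor
  · have : ContinuousAt (fun s : ℝ => s ^ 2) 1 := by fun_prop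
    simpa using this.tendsto.mono_left nhdsWithin_le_nhds
  · have : ContinuousAt (fun s : ℝ => (1 / s) ^ 2) 1 := by
      have h : ContinuousAt (fun s : ℝ => 1 / s) 1 := continuousAt_const.div continuousAt_id one_ne_zero
      exact h.pow 2
    simpa using this.tendsto.mono_left nhdsWithin_le_nhds

theorem width_pos {s : ℝ} (hs : 1 < s) : 0 < s ^ 2 - (1 / s) ^ 2 := by
  have := Real.log_pos hs
  linarith [two_log_le hs.le]

/-- The intervals shrink to `c - Y` and have length `(s² - s⁻²) Y`. The exponential density is
continuous away from its jump at 0, which `hc` avoids. -/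
theorem tendsto_modeLaw_div (n : ℤ) {c Y : ℝ} (hY : 0 ≤ Y) (hc : c - Y ≠ 0) :
    Tendsto (fun s : ℝ => modeLaw n (Set.Ioc (c - s ^ 2 * Y) (c - (1 / s) ^ 2 * Y)) /
      ENNReal.ofReal (s ^ 2 - (1 / s) ^ 2)) (𝓝[>] 1)
      (𝓝 (ENNReal.ofReal Y * modeDensity n (c - Y))) := by
  obtain ⟨t1, t2⟩ := tendsto_width
  have a1 : Tendsto (fun s : ℝ => c - s ^ 2 * Y) (𝓝[>] 1) (𝓝 (c - Y)) := by
    simpa using tendsto_const_nhds.sub (t1.mul_const Y)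
  have a2 : Tendsto (fun s : ℝ => c - (1 / s) ^ 2 * Y) (𝓝[>] 1) (𝓝 (c - Y)) := by
    simpa only [one_mul] using tendsto_const_nhds.sub (t2.mul_const Y)
  rcases lt_or_gt_of_ne hc with h | h
  · rw [modeDensity, Set.indicator_of_notMem (by simpa using h.le), mul_zero]
    refine Tendsto.congr' ?_ tendsto_const_nhds
    filter_upwards [a2.eventually_lt_const h] with s hs
    have : Set.Ioc (c - s ^ 2 * Y) (c - (1 / s) ^ 2 * Y) ∩ Set.Ioi 0 = ∅ := by
      ext r
      simp only [Set.mem_inter_iff, Set.mem_Ioc, Set.mem_Ioi, Set.mem_empty_iff_false, iff_false]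
      rintro ⟨⟨-, h1⟩, h2⟩
      linarith
    rw [modeLaw_apply n measurableSet_Ioc, this]
    simp
  · rw [modeDensity, Set.indicator_of_mem (by simpa using h), ← ENNReal.ofReal_mul hY, mul_comm Y]
    have hlim : ∀ {g : ℝ → ℝ}, Tendsto g (𝓝[>] 1) (𝓝 (c - Y)) →
        Tendsto (fun s => ENNReal.ofReal (bracket n ^ 2 * Real.exp (-(bracket n ^ 2 * g s)) * Y))
          (𝓝[>] 1) (𝓝 (ENNReal.ofReal (bracket n ^ 2 *
            Real.exp (-(bracket n ^ 2 * (c - Y))) * Y))) := by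
      intro g hg
      refine ENNReal.tendsto_ofReal ((Tendsto.const_mul _ ?_).mul_const _)
      exact (Real.continuous_exp.tendsto _).comp (hg.const_mul _).neg
    have hmul : ∀ {s : ℝ}, 1 < s → ∀ x : ℝ, 0 ≤ x →
        ENNReal.ofReal (x * (c - (1 / s) ^ 2 * Y - (c - s ^ 2 * Y))) /
          ENNReal.ofReal (s ^ 2 - (1 / s) ^ 2) = ENNReal.ofReal (x * Y) := by
      intro s hs x hx
      have hw := width_pos hs
      rw [← ENNReal.ofReal_div_of_pos hw]
      congr 1
      rw [div_eq_iff hw.ne']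
      ring
    refine tendsto_of_tendsto_of_tendsto_of_le_of_le' (hlim a2) (hlim a1) ?_ ?_
    · filter_upwards [self_mem_nhdsWithin, a1.eventually_const_lt h] with s hs h0
      rw [← hmul hs _ (by positivity)]
      gcongr
      exact le_modeLaw_Ioc n h0.le _
    · filter_upwards [self_mem_nhdsWithin] with s hs
      rw [← hmul hs _ (by positivity)]
      gcongr
      exact modeLaw_Ioc_le n _ _

theorem massSet_union {S T : Set ℤ} (h : Disjoint S T) (u : HalfMinus) :
    massSet (S ∪ T) u = massSet S u + massSet T u := by
  rw [massSet, massSet, massSet, ← (summable_indicator_norm_sq _ u).tsum_add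
    (summable_indicator_norm_sq _ u), Set.indicator_union_of_disjoint h]

theorem massRest_add_massOn {k : ℕ} {n : ℤ} (hn : |n| ≠ k) (u : HalfMinus) :
    massRest k n u + massOn k u = massSet {n}ᶜ u := by
  rw [massRest, ← massSet_on, ← massSet_union]
  · congr 1
    ext j
    have := mem_pm_iff k j
    simp only [Set.mem_union, Set.mem_sdiff, Set.mem_ofPred_eq, Set.mem_singleton_iff,
      Finset.mem_coe, this, Set.mem_compl_iff]
    constructor
    · rintro (h | h)
      · exact h.2
      · rintro rfl; exact hn h
    · tauto
  · rw [Set.disjoint_left]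
    intro j hj hj2
    exact hj.1 ((mem_pm_iff k j).1 hj2)

/-- The exceptional event fixes the mass of all modes other than `n`; among these is the mode `k`,
whose law has no atoms. -/
theorem ae_massRest_add_massOn_ne {k : ℕ} {n : ℤ} (hn : |n| ≠ k) (m : ℝ) :
    ∀ᵐ u ∂mu, m - massRest k n u - massOn k u ≠ 0 := by
  have hk : (k : ℤ) ∈ ({n}ᶜ : Set ℤ) := by
    rintro rfl
    simp at hn
  have h := mu_massSet_preimage hk (measurableSet_singleton m)
  have h0 : mu (massSet {n}ᶜ ⁻¹' {m}) = 0 := by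
    rw [h, lintegral_eq_zero_iff (measurable_modeLaw_preimage _ _ (measurableSet_singleton m))]
    refine Eventually.of_forall fun u => modeLaw_absolutelyContinuous _ ?_
    rw [measure_preimage_add]
    exact measure_singleton m
  rw [ae_iff]
  refine measure_mono_null (fun u hu => ?_) h0
  have hu' : m - massRest k n u - massOn k u = 0 := not_not.1 hu
  rw [Set.mem_preimage, Set.mem_singleton_iff, ← massRest_add_massOn hn]
  linarith

theorem measurable_modeLaw_Ioc {α : Type*} [MeasurableSpace α] (n : ℤ) {f g : α → ℝ}
    (hf : Measurable f) (hg : Measurable g) :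
    Measurable fun x => modeLaw n (Set.Ioc (f x) (g x)) := by
  have h1 : Measurable fun z : ℝ × ℝ => modeLaw n (Set.Ioc z.1 z.2) := by
    have h2 : MeasurableSet ({z : (ℝ × ℝ) × ℝ | z.1.1 < z.2} ∩ {z : (ℝ × ℝ) × ℝ | z.2 ≤ z.1.2}) :=
      (measurableSet_lt measurable_fst.fst measurable_snd).inter
        (measurableSet_le measurable_snd measurable_fst.snd)
    have h3 := measurable_measure_prodMk_left (ν := modeLaw n) h2
    have h4 : ∀ z : ℝ × ℝ, Prod.mk z ⁻¹' ({z : (ℝ × ℝ) × ℝ | z.1.1 < z.2} ∩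
        {z : (ℝ × ℝ) × ℝ | z.2 ≤ z.1.2}) = Set.Ioc z.1 z.2 := by
      intro z
      ext r
      simp
    simpa only [h4] using h3
  simpa only [Function.comp_def] using h1.comp (hf.prodMk hg)

/-- Dominated convergence in the slice formula, with the integrable majorant `⟨n⟩² massOn k`. -/
theorem tendsto_mu_shell_inter {k : ℕ} {n : ℤ} (hn : |n| ≠ k) (m : ℝ) {E : Set HalfMinus}
    (hE : MeasurableSet E) (hEn : ∀ x u, setCoeff n x u ∈ E ↔ u ∈ E) :
    Tendsto (fun s : ℝ => mu (shell k m s ∩ E) / ENNReal.ofReal (s ^ 2 - (1 / s) ^ 2)) (𝓝[>] 1)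
      (𝓝 (∫⁻ u in E, ENNReal.ofReal (massOn k u) *
        modeDensity n (m - massRest k n u - massOn k u) ∂mu)) := by
  have hX := measurable_massRest k n
  have hY := measurable_massOn k
  have hmeas : ∀ s : ℝ, Measurable fun u => modeLaw n (Set.Ioc
      (m - massRest k n u - s ^ 2 * massOn k u) (m - massRest k n u - (1 / s) ^ 2 * massOn k u)) := by
    intro s
    exact measurable_modeLaw_Ioc n ((hX.const_sub m).sub (hY.const_mul _))
      ((hX.const_sub m).sub (hY.const_mul _))
  have hrw : ∀ s : ℝ, mu (shell k m s ∩ E) / ENNReal.ofReal (s ^ 2 - (1 / s) ^ 2) =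
      ∫⁻ u in E, modeLaw n (Set.Ioc (m - massRest k n u - s ^ 2 * massOn k u)
        (m - massRest k n u - (1 / s) ^ 2 * massOn k u)) /
          ENNReal.ofReal (s ^ 2 - (1 / s) ^ 2) ∂mu := by
    intro s
    rw [mu_shell_inter hn m s hE hEn]
    simp_rw [ENNReal.div_eq_inv_mul]
    rw [lintegral_const_mul _ (hmeas s)]
  simp_rw [hrw]
  refine tendsto_lintegral_filter_of_dominated_convergence
    (fun u => ENNReal.ofReal (bracket n ^ 2) * ENNReal.ofReal (massOn k u)) ?_ ?_ ?_ ?_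
  · exact Eventually.of_forall fun s => (hmeas s).div_const _
  · filter_upwards [self_mem_nhdsWithin] with s hs
    refine Eventually.of_forall fun u => ?_
    have hw := width_pos hs
    refine ENNReal.div_le_of_le_mul ((shell_width_le m u).trans (le_of_eq ?_))
    rw [ENNReal.ofReal_mul hw.le]
    ring
  · rw [lintegral_const_mul _ hY.ennreal_ofReal]
    refine ENNReal.mul_ne_top ENNReal.ofReal_ne_top (ne_top_of_le_ne_top ENNReal.ofReal_ne_top
      ((setLIntegral_le_lintegral _ _).trans (lintegral_massOn_le k)))
  · refine ae_restrict_of_ae ?_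
    filter_upwards [ae_massRest_add_massOn_ne hn m] with u hu
    exact tendsto_modeLaw_div n (massOn_nonneg k u) hu

/-! ### The surface measure on functions of fixed mass -/

/-- The weight, in terms of the mass `x` away from `±k`, of the dilation onto the sphere of mass
`m`. -/
def sphereWeight (k : ℕ) (m : ℝ) (u : HalfMinus) (x : ℝ) : ℝ≥0∞ :=
  (Set.Ioc 1 4).indicator 1 (massOn k u) * ((Set.Iio m).indicator 1 x *
    ENNReal.ofReal (1 / 2 * (((m - x) / massOn k u) ^ pmCard k *
      Real.exp (-(m - x - massOn k u) * bracket k ^ 2))))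

/-- The surface measure on the functions of mass `m`, obtained by dilating the frequencies `±k`. -/
def sphereMeasure (k : ℕ) (m : ℝ) : Measure HalfMinus :=
  (mu.withDensity fun u => sphereWeight k m u (massOff k u)).map
    fun u => dilate k √((m - massOff k u) / massOn k u) u

theorem measurable_sphereWeight (k : ℕ) (m : ℝ) :
    Measurable (Function.uncurry (sphereWeight k m)) := by
  have h1 : Measurable fun z : HalfMinus × ℝ => massOn k z.1 :=
    (measurable_massOn k).comp measurable_fst
  refine ((measurable_one.indicator measurableSet_Ioc).comp h1).mul
    (((measurable_one.indicator measurableSet_Iio).comp measurable_snd).mul ?_)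
  fun_prop

theorem measurable_dilate_sqrt (k : ℕ) (m : ℝ) : Measurable (Function.uncurry
    fun (u : HalfMinus) (x : ℝ) => dilate k √((m - x) / massOn k u) u) := by
  have h1 : Measurable fun z : HalfMinus × ℝ => massOn k z.1 :=
    (measurable_massOn k).comp measurable_fst
  exact (measurable_dilate k).comp (measurable_fst.prodMk
    (by fun_prop : Measurable fun z : HalfMinus × ℝ => √((m - z.2) / massOn k z.1)))

theorem measurable_uncurry_graph {α β γ : Type*} [MeasurableSpace α] [MeasurableSpace β]
    [MeasurableSpace γ] {f : α → β → γ} (hf : Measurable (Function.uncurry f)) {g : α → β}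
    (hg : Measurable g) : Measurable fun x => f x (g x) :=
  hf.comp (measurable_id.prodMk hg)

theorem sphereMeasure_apply (k : ℕ) (m : ℝ) {E : Set HalfMinus} (hE : MeasurableSet E) :
    sphereMeasure k m E = ∫⁻ u, sphereWeight k m u (massOff k u) *
      E.indicator 1 (dilate k √((m - massOff k u) / massOn k u) u) ∂mu := by
  have hd : Measurable fun u => dilate k √((m - massOff k u) / massOn k u) u :=
    measurable_uncurry_graph (measurable_dilate_sqrt k m) (measurable_massOff k)
  have hw : Measurable fun u => sphereWeight k m u (massOff k u) :=
    measurable_uncurry_graph (measurable_sphereWeight k m) (measurable_massOff k)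
  have hi : Measurable fun u =>
      E.indicator (1 : HalfMinus → ℝ≥0∞) (dilate k √((m - massOff k u) / massOn k u) u) :=
    (measurable_one.indicator hE).comp hd
  rw [sphereMeasure, ← lintegral_indicator_one hE, lintegral_map (measurable_one.indicator hE) hd,
    lintegral_withDensity_eq_lintegral_mul _ hw hi]
  rfl

theorem dilate_setCoeff {k : ℕ} {n : ℤ} (hn : |n| ≠ k) (t : ℝ) (x : ℂ) (u : HalfMinus) :
    dilate k t (setCoeff n x u) = setCoeff n x (dilate k t u) := by
  apply coeff_injective
  ext j
  simp only [coeff_dilate, coeff_setCoeff]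
  by_cases hj : j = n
  · subst hj; simp [hn]
  · simp [hj]

theorem massRest_dilate (k : ℕ) (n : ℤ) (t : ℝ) (u : HalfMinus) :
    massRest k n (dilate k t u) = massRest k n u :=
  massSet_congr fun j hj => by rw [coeff_dilate, if_neg hj.1]

theorem lintegral_Ioi_comp_sq_mul {Y : ℝ} (hY : 0 < Y) (g : ℝ → ℝ≥0∞) :
    ∫⁻ w in Set.Ioi 0, g w = ∫⁻ t in Set.Ioi 0, ENNReal.ofReal (2 * t * Y) * g (t ^ 2 * Y) := by
  have himg : (fun t : ℝ => t ^ 2 * Y) '' Set.Ioi 0 = Set.Ioi 0 := by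
    ext w
    simp only [Set.mem_image, Set.mem_Ioi]
    constructor
    · rintro ⟨t, ht, rfl⟩
      positivity
    · intro hw
      refine ⟨√(w / Y), Real.sqrt_pos.2 (by positivity), ?_⟩
      rw [Real.sq_sqrt (by positivity)]
      field_simp
  conv_lhs => rw [← himg]
  rw [lintegral_image_eq_lintegral_abs_deriv_mul measurableSet_Ioi (f' := fun t => 2 * t * Y)]
  · refine setLIntegral_congr_fun measurableSet_Ioi fun t ht => ?_
    have : (0 : ℝ) < t := ht
    simp only [abs_of_pos (by positivity : 0 < 2 * t * Y)]
  · intro t _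
    have := (hasDerivAt_pow 2 t).mul_const Y
    simpa using this.hasDerivWithinAt
  · intro t ht t' ht' h
    have h2 : t ^ 2 = t' ^ 2 := mul_right_cancel₀ hY.ne' h
    exact (pow_left_inj₀ (le_of_lt ht) (le_of_lt ht') two_ne_zero).1 h2

/-- The condition on `t` is `√Y/2 ≤ t < √Y`. The result does not depend on `Y`, so the cutoff in
`sphereWeight` selects the same logarithmic proportion of every dilation orbit. -/
theorem lintegral_inv_indicator {Y : ℝ} (hY : 0 < Y) :
    ∫⁻ t in Set.Ioi (0 : ℝ), ENNReal.ofReal t⁻¹ * (Set.Ioc (1 : ℝ) 4).indicator 1 (Y / t ^ 2) =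
      ENNReal.ofReal (Real.log 2) := by
  have hs : 0 < √Y := Real.sqrt_pos.2 hY
  have hlog : √Y / (√Y / 2) = 2 := by field_simp
  have h := lintegral_inv_Ico (a := √Y / 2) (b := √Y) (by positivity) (by linarith)
  rw [hlog] at h
  rw [← h, ← lintegral_indicator measurableSet_Ioi, ← lintegral_indicator measurableSet_Ico]
  refine lintegral_congr fun t => ?_
  by_cases ht : 0 < t
  · rw [Set.indicator_of_mem (Set.mem_Ioi.2 ht)]
    have hiff : Y / t ^ 2 ∈ Set.Ioc (1 : ℝ) 4 ↔ t ∈ Set.Ico (√Y / 2) √Y := by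
      rw [Set.mem_Ioc, Set.mem_Ico, one_lt_div (by positivity), div_le_iff₀ (by positivity),
        Real.lt_sqrt ht.le, div_le_iff₀ two_pos, Real.sqrt_le_left (by positivity), and_comm]
      refine and_congr ?_ Iff.rfl
      rw [show (t * 2) ^ 2 = 4 * t ^ 2 by ring]
    by_cases hm : t ∈ Set.Ico (√Y / 2) √Y
    · rw [Set.indicator_of_mem hm, Set.indicator_of_mem (hiff.2 hm), Pi.one_apply, mul_one]
    · rw [Set.indicator_of_notMem hm, Set.indicator_of_notMem (mt hiff.1 hm), mul_zero]
  · rw [Set.indicator_of_notMem (by simpa using ht), Set.indicator_of_notMem]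
    intro hm
    exact ht (lt_of_lt_of_le (by positivity) hm.1)

/-- The left side knows nothing of `n`, so this shows that the shell limits computed with different
auxiliary modes come from one measure. Integrate out `‖û(n)‖²`, replace it by the dilation parameter
`t` through `m - massOff = t² massOn`, undo the dilation by quasi-invariance, and evaluate the
remaining integral of the cutoff against `dt/t`. -/
theorem sphereMeasure_eq {k : ℕ} {n : ℤ} (hn : |n| ≠ k) (m : ℝ) {E : Set HalfMinus}
    (hE : MeasurableSet E) (hEn : ∀ x u, setCoeff n x u ∈ E ↔ u ∈ E) :
    sphereMeasure k m E = ENNReal.ofReal (Real.log 2) * ∫⁻ u in E, ENNReal.ofReal (massOn k u) *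
      modeDensity n (m - massRest k n u - massOn k u) ∂mu := by
  have hX := measurable_massRest k n
  have hY := measurable_massOn k
  have hmd := measurable_modeDensity n
  have hE1 : Measurable (E.indicator (1 : HalfMinus → ℝ≥0∞)) := measurable_one.indicator hE
  have hχ : Measurable ((Set.Ioc (1 : ℝ) 4).indicator (1 : ℝ → ℝ≥0∞)) :=
    measurable_one.indicator measurableSet_Ioc
  set Φ : HalfMinus → ℝ → ℝ≥0∞ := fun u x => sphereWeight k m u x *
    E.indicator 1 (dilate k √((m - x) / massOn k u) u) with hΦ
  have hΦm : Measurable (Function.uncurry Φ) :=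
    (measurable_sphereWeight k m).mul (hE1.comp (measurable_dilate_sqrt k m))
  have hΦn : ∀ x u, Φ (setCoeff n x u) = Φ u := by
    intro x u
    funext y
    simp only [hΦ, sphereWeight, massOn_setCoeff hn, dilate_setCoeff hn]
    congr 1
    exact indicator_one_congr (hEn x _)
  set G : HalfMinus → ℝ≥0∞ := fun u => E.indicator 1 u *
    (ENNReal.ofReal (massOn k u) * modeDensity n (m - massRest k n u - massOn k u)) with hG
  have hGm : Measurable G := hE1.mul (hY.ennreal_ofReal.mul (hmd.comp ((hX.const_sub m).sub hY)))
  have hleft : ∀ v, ∫⁻ r, Φ v (massRest k n v + r) ∂modeLaw n = ∫⁻ t in Set.Ioi (0 : ℝ),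
      ENNReal.ofReal (2 * t * massOn k v) * (modeDensity n (m - massRest k n v - t ^ 2 * massOn k v) *
        Φ v (m - t ^ 2 * massOn k v)) := by
    intro v
    have hΦv : Measurable (Φ v) := hΦm.of_uncurry_left
    by_cases hYv : massOn k v ∈ Set.Ioc 1 4
    swap
    · have h0 : ∀ x, Φ v x = 0 := fun x => by
        simp only [hΦ, sphereWeight, Set.indicator_of_notMem hYv, zero_mul]
      simp [h0]
    have hYpos : 0 < massOn k v := by linarith [hYv.1]
    have hΦc : Measurable fun r => Φ v (massRest k n v + r) :=
      hΦv.comp (measurable_const_add _)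
    rw [lintegral_modeLaw_eq n hΦc,
      ← lintegral_Ioi_comp_sq_mul hYpos fun w => modeDensity n (m - massRest k n v - w) *
        Φ v (m - w),
      ← lintegral_sub_left_eq_self _ (m - massRest k n v), ← lintegral_indicator measurableSet_Ioi]
    refine lintegral_congr fun w => ?_
    have e : massRest k n v + (m - massRest k n v - w) = m - w := by ring
    by_cases hw : w ∈ Set.Ioi (0 : ℝ)
    · rw [Set.indicator_of_mem hw, e]
    · rw [Set.indicator_of_notMem hw, e]
      have hw' : m - w ∉ Set.Iio m := by
        have : w ≤ 0 := by simpa using hw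
        simpa using this
      simp only [hΦ, sphereWeight, Set.indicator_of_notMem hw', zero_mul, mul_zero]
  have hpt : ∀ v, ∀ t ∈ Set.Ioi (0 : ℝ), ENNReal.ofReal (2 * t * massOn k v) *
      (modeDensity n (m - massRest k n v - t ^ 2 * massOn k v) * Φ v (m - t ^ 2 * massOn k v)) =
      ENNReal.ofReal t⁻¹ * ((Set.Ioc (1 : ℝ) 4).indicator 1 (massOn k v) * G (dilate k t v) *
        ENNReal.ofReal ((t ^ 2) ^ pmCard k *
          Real.exp (-(t ^ 2 - 1) * (bracket k ^ 2 * massOn k v)))) := by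
    intro v t ht
    have ht0 : 0 < t := ht
    by_cases hYv : massOn k v ∈ Set.Ioc 1 4
    swap
    · simp only [hΦ, sphereWeight, Set.indicator_of_notMem hYv, zero_mul, mul_zero]
    have hYpos : 0 < massOn k v := by linarith [hYv.1]
    have e1 : m - (m - t ^ 2 * massOn k v) = t ^ 2 * massOn k v := by ring
    have e2 : t ^ 2 * massOn k v / massOn k v = t ^ 2 := by field_simp
    have e3 : m - t ^ 2 * massOn k v ∈ Set.Iio m := by
      have : 0 < t ^ 2 * massOn k v := by positivity
      simpa using this
    have e4 : -(t ^ 2 * massOn k v - massOn k v) * bracket k ^ 2 =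
      -(t ^ 2 - 1) * (bracket k ^ 2 * massOn k v) := by ring
    simp only [hΦ, hG, sphereWeight, Set.indicator_of_mem hYv, Set.indicator_of_mem e3,
      Pi.one_apply, one_mul, e1, e2, Real.sqrt_sq ht0.le, massOn_dilate, massRest_dilate, e4]
    set D := (t ^ 2) ^ pmCard k * Real.exp (-(t ^ 2 - 1) * (bracket k ^ 2 * massOn k v)) with hD
    have hD0 : 0 ≤ D := by positivity
    -- The Jacobian `2t · massOn` of the substitution meets the `1/2` in the weight, leaving `dt/t`
    -- times the mass on `±k` after dilation.
    have key : ENNReal.ofReal (2 * t * massOn k v) * ENNReal.ofReal (1 / 2 * D) =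
        ENNReal.ofReal t⁻¹ * (ENNReal.ofReal (t ^ 2 * massOn k v) * ENNReal.ofReal D) := by
      rw [← ENNReal.ofReal_mul (by positivity), ← ENNReal.ofReal_mul (by positivity),
        ← ENNReal.ofReal_mul (by positivity)]
      congr 1
      field_simp
    calc _ = ENNReal.ofReal (2 * t * massOn k v) * ENNReal.ofReal (1 / 2 * D) *
          (modeDensity n (m - massRest k n v - t ^ 2 * massOn k v) *
            E.indicator 1 (dilate k t v)) := by ring
      _ = _ := by rw [key]; ring
  have hχt : ∀ t ∈ Set.Ioi (0 : ℝ), ∫⁻ v, (Set.Ioc (1 : ℝ) 4).indicator 1 (massOn k v) *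
      G (dilate k t v) * ENNReal.ofReal ((t ^ 2) ^ pmCard k *
          Real.exp (-(t ^ 2 - 1) * (bracket k ^ 2 * massOn k v))) ∂mu =
      ∫⁻ u, (Set.Ioc (1 : ℝ) 4).indicator 1 (massOn k u / t ^ 2) * G u ∂mu := by
    intro t ht
    have ht0 : 0 < t := ht
    rw [lintegral_mu_dilate k ht0 (Φ := fun u =>
      (Set.Ioc (1 : ℝ) 4).indicator 1 (massOn k u / t ^ 2) * G u)
      ((hχ.comp (hY.div_const _)).mul hGm)]
    refine lintegral_congr fun v => ?_
    rw [massOn_dilate, mul_div_cancel_left₀ _ (by positivity)]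
  have hinv : Measurable fun t : ℝ => ENNReal.ofReal t⁻¹ := by fun_prop
  rw [sphereMeasure_apply k m hE, lintegral_mu_massOff hn hΦm hΦn]
  calc ∫⁻ v, ∫⁻ r, Φ v (massRest k n v + r) ∂modeLaw n ∂mu
      = ∫⁻ v, (∫⁻ t in Set.Ioi (0 : ℝ), ENNReal.ofReal t⁻¹ *
        ((Set.Ioc (1 : ℝ) 4).indicator 1 (massOn k v) * G (dilate k t v) *
        ENNReal.ofReal ((t ^ 2) ^ pmCard k *
          Real.exp (-(t ^ 2 - 1) * (bracket k ^ 2 * massOn k v))))) ∂mu := by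
        refine lintegral_congr fun v => ?_
        rw [hleft v]
        exact setLIntegral_congr_fun measurableSet_Ioi (hpt v)
    _ = ∫⁻ t in Set.Ioi (0 : ℝ), ∫⁻ v, ENNReal.ofReal t⁻¹ *
        ((Set.Ioc (1 : ℝ) 4).indicator 1 (massOn k v) * G (dilate k t v) *
        ENNReal.ofReal ((t ^ 2) ^ pmCard k *
          Real.exp (-(t ^ 2 - 1) * (bracket k ^ 2 * massOn k v)))) ∂mu := by
        refine lintegral_lintegral_swap (Measurable.aemeasurable ?_)
        have hY' : Measurable fun z : HalfMinus × ℝ => massOn k z.1 := hY.comp measurable_fst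
        have hmm : Measurable fun z : HalfMinus × ℝ => ENNReal.ofReal ((z.2 ^ 2) ^ pmCard k *
          Real.exp (-(z.2 ^ 2 - 1) * (bracket k ^ 2 * massOn k z.1))) := by fun_prop
        exact (hinv.comp measurable_snd).mul
          (((hχ.comp hY').mul (hGm.comp (measurable_dilate k))).mul hmm)
    _ = ∫⁻ t in Set.Ioi (0 : ℝ), ∫⁻ u, ENNReal.ofReal t⁻¹ *
        ((Set.Ioc (1 : ℝ) 4).indicator 1 (massOn k u / t ^ 2) * G u) ∂mu := by
        refine setLIntegral_congr_fun measurableSet_Ioi fun t ht => ?_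
        rw [lintegral_const_mul' _ _ ENNReal.ofReal_ne_top,
          lintegral_const_mul' _ _ ENNReal.ofReal_ne_top, hχt t ht]
    _ = ∫⁻ u, (∫⁻ t in Set.Ioi (0 : ℝ), ENNReal.ofReal t⁻¹ *
        ((Set.Ioc (1 : ℝ) 4).indicator 1 (massOn k u / t ^ 2) * G u)) ∂mu := by
        refine lintegral_lintegral_swap (Measurable.aemeasurable ?_)
        have hY' : Measurable fun z : ℝ × HalfMinus => massOn k z.2 := hY.comp measurable_snd
        exact (hinv.comp measurable_fst).mul
          ((hχ.comp (hY'.div (measurable_fst.pow_const 2))).mul (hGm.comp measurable_snd))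
    _ = ∫⁻ u, ENNReal.ofReal (Real.log 2) * G u ∂mu := by
        refine lintegral_congr fun u => ?_
        simp_rw [← mul_assoc]
        have hm1 : Measurable fun t : ℝ => ENNReal.ofReal t⁻¹ *
            (Set.Ioc (1 : ℝ) 4).indicator 1 (massOn k u / t ^ 2) :=
          hinv.mul (hχ.comp (measurable_const.div (measurable_id.pow_const 2)))
        rw [lintegral_mul_const _ hm1]
        -- Where there is no mass on `±k` the cutoff integral is not `log 2`, but the factor
        -- `massOn` in `G` vanishes.
        rcases (massOn_nonneg k u).eq_or_lt with h0 | h0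
        · have : G u = 0 := by simp [hG, ← h0]
          rw [this, mul_zero, mul_zero]
        · rw [lintegral_inv_indicator h0]
    _ = _ := by
        rw [lintegral_const_mul _ hGm, ← lintegral_indicator hE]
        congr 1
        refine lintegral_congr fun u => ?_
        by_cases hu : u ∈ E
        · simp only [hG, Set.indicator_of_mem hu, Pi.one_apply, one_mul]
        · simp only [hG, Set.indicator_of_notMem hu, zero_mul]

/-! ### The fixed-mass measure -/

theorem measurable_lowCoeffs (N : ℕ) : Measurable (lowCoeffs N) :=
  measurable_pi_lambda _ fun n => measurable_coeff_apply n

theorem lowCoeffs_setCoeff {N : ℕ} {n : ℤ} (hn : n ∉ Set.Icc (-(N : ℤ)) (N : ℤ)) (x : ℂ)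
    (u : HalfMinus) : lowCoeffs N (setCoeff n x u) = lowCoeffs N u := by
  funext j
  refine coeff_setCoeff_of_ne (fun h => hn ?_) x u
  rw [← h]
  exact j.2

theorem shell_param_pos (k : ℕ) {m : ℝ} (hm : 0 < m) :
    mu (massOff k ⁻¹' Set.Ioc (m - m / bracket k ^ 2) (m - m / 2 / bracket k ^ 2)) ≠ 0 := by
  have hb : 1 ≤ bracket k ^ 2 := one_le_pow₀ (one_le_bracket k)
  refine mu_massOff_Ioc_ne_zero k (sub_nonneg.2 (div_le_self hm.le hb)) ?_
  gcongr
  linarith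

theorem mu_shell_ne_zero (k : ℕ) {m s : ℝ} (hm : 0 < m) (hm2 : m ≤ 2) (hs : 1 < s) :
    mu (shell k m s) ≠ 0 := by
  intro h
  have h1 := mu_shell_ge k hm hm2 hs
  rw [h, nonpos_iff_eq_zero, mul_eq_zero] at h1
  rcases h1 with h1 | h1
  · rw [ENNReal.ofReal_eq_zero] at h1
    have := width_pos hs
    exact absurd h1 (not_le.2 (by positivity))
  · exact shell_param_pos k hm h1

theorem nuApprox_apply (k : ℕ) (m s : ℝ) (E : Set HalfMinus) :
    nuApprox k m s E = (mu (shell k m s))⁻¹ * mu (shell k m s ∩ E) :=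
  cond_apply (measurableSet_shell k m s) mu E

/-- The limit of the measures of the shells `shell k m s`, divided by `s² - s⁻²`. -/
def shellLimit (k : ℕ) (n : ℤ) (m : ℝ) (E : Set HalfMinus) : ℝ≥0∞ :=
  ∫⁻ u in E, ENNReal.ofReal (massOn k u) * modeDensity n (m - massRest k n u - massOn k u) ∂mu

theorem tendsto_mu_shell_div {k : ℕ} {n : ℤ} (hn : |n| ≠ k) (m : ℝ) :
    Tendsto (fun s : ℝ => mu (shell k m s) / ENNReal.ofReal (s ^ 2 - (1 / s) ^ 2)) (𝓝[>] 1)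
      (𝓝 (shellLimit k n m Set.univ)) := by
  have h := tendsto_mu_shell_inter hn m MeasurableSet.univ (fun _ _ => by simp)
  simp only [Set.inter_univ] at h
  exact h

theorem shellLimit_univ_ne_top {k : ℕ} {n : ℤ} (hn : |n| ≠ k) (m : ℝ) :
    shellLimit k n m Set.univ ≠ ∞ := by
  refine ne_top_of_le_ne_top (ENNReal.ofReal_ne_top (r := 16 / bracket k ^ 2))
    (le_of_tendsto (tendsto_mu_shell_div hn m) ?_)
  filter_upwards [self_mem_nhdsWithin] with s hs
  have hw := width_pos hs
  refine ENNReal.div_le_of_le_mul ((mu_shell_le k m (le_of_lt hs)).trans (le_of_eq ?_))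
  rw [mul_comm, ENNReal.ofReal_mul (by positivity)]

theorem shellLimit_univ_ne_zero {k : ℕ} {n : ℤ} (hn : |n| ≠ k) {m : ℝ} (hm : 0 < m) (hm2 : m ≤ 2) :
    shellLimit k n m Set.univ ≠ 0 := by
  set P := mu (massOff k ⁻¹' Set.Ioc (m - m / bracket k ^ 2) (m - m / 2 / bracket k ^ 2)) with hP
  have h : ENNReal.ofReal (1 / 2 * Real.exp (-(2 * (m * 2))) * (m ^ 2 / 4)) * P ≤
      shellLimit k n m Set.univ := by
    refine ge_of_tendsto (tendsto_mu_shell_div hn m) ?_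
    filter_upwards [self_mem_nhdsWithin, tendsto_width.1.eventually_lt_const one_lt_two,
      tendsto_width.2.eventually_const_lt (by norm_num : (1 / 2 : ℝ) < 1)] with s hs h2 h3
    have hw := width_pos hs
    rw [ENNReal.le_div_iff_mul_le (Or.inl (ENNReal.ofReal_pos.2 hw).ne')
      (Or.inl ENNReal.ofReal_ne_top)]
    calc _ = ENNReal.ofReal ((s ^ 2 - (1 / s) ^ 2) *
          (1 / 2 * Real.exp (-(2 * (m * 2))) * (m ^ 2 / 4))) * P := by
          rw [ENNReal.ofReal_mul hw.le]
          ring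
      _ ≤ ENNReal.ofReal ((s ^ 2 - (1 / s) ^ 2) *
          ((1 / s) ^ 2 * Real.exp (-(2 * (m * s ^ 2))) * (m ^ 2 / 4))) * P := by
          gcongr
      _ ≤ _ := mu_shell_ge k hm hm2 hs
  intro h0
  rw [h0, nonpos_iff_eq_zero, mul_eq_zero] at h
  rcases h with h | h
  · rw [ENNReal.ofReal_eq_zero] at h
    exact absurd h (not_le.2 (by positivity))
  · exact shell_param_pos k hm h

/-- A conditional probability is a quotient of two shell measures: the widths `s² - s⁻²` cancel
before the limit, and the factors `log 2` after it. -/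
theorem isNu_sphereMeasure (k : ℕ) {m : ℝ} (hm : 0 < m) (hm2 : m ≤ 2) :
    IsNu k m ((sphereMeasure k m Set.univ)⁻¹ • sphereMeasure k m) := by
  intro N B hB
  -- A frequency beyond both the window of the cylinder set and `k`, free to be integrated out.
  set n : ℤ := N + k + 1 with hn
  have hnk : |n| ≠ k := by
    rw [abs_of_nonneg (by positivity)]
    omega
  have hnN : n ∉ Set.Icc (-(N : ℤ)) (N : ℤ) := by
    rw [Set.mem_Icc]
    omega
  have hE := measurable_lowCoeffs N hB
  have hEn : ∀ x u, setCoeff n x u ∈ lowCoeffs N ⁻¹' B ↔ u ∈ lowCoeffs N ⁻¹' B := fun x u => by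
    rw [Set.mem_preimage, Set.mem_preimage, lowCoeffs_setCoeff hnN]
  have h0 := shellLimit_univ_ne_zero hnk hm hm2
  have htop := shellLimit_univ_ne_top hnk m
  have hlog : ENNReal.ofReal (Real.log 2) ≠ 0 := by
    simpa using Real.log_pos one_lt_two
  have hval : ((sphereMeasure k m Set.univ)⁻¹ • sphereMeasure k m) (lowCoeffs N ⁻¹' B) =
      shellLimit k n m (lowCoeffs N ⁻¹' B) / shellLimit k n m Set.univ := by
    rw [Measure.smul_apply, smul_eq_mul, sphereMeasure_eq hnk m MeasurableSet.univ
      (fun _ _ => by simp), sphereMeasure_eq hnk m hE hEn, ← ENNReal.div_eq_inv_mul,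
      ENNReal.mul_div_mul_left _ _ hlog ENNReal.ofReal_ne_top]
    rfl
  rw [hval]
  refine Tendsto.congr' ?_ (ENNReal.Tendsto.div (tendsto_mu_shell_inter hnk m hE hEn) (Or.inr h0)
    (tendsto_mu_shell_div hnk m) (Or.inl htop))
  filter_upwards [self_mem_nhdsWithin] with s hs
  have hw : ENNReal.ofReal (s ^ 2 - (1 / s) ^ 2) ≠ 0 := by simpa using width_pos hs
  rw [nuApprox_apply, ENNReal.div_eq_inv_mul, ENNReal.div_eq_inv_mul, ENNReal.div_eq_inv_mul,
    ENNReal.mul_inv (Or.inr (measure_ne_top _ _)) (Or.inr (mu_shell_ne_zero k hm hm2 hs)), inv_inv]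
  rw [mul_mul_mul_comm, ENNReal.mul_inv_cancel hw ENNReal.ofReal_ne_top, one_mul]

theorem IsNu.measure_univ {k : ℕ} {m : ℝ} (hm : 0 < m) (hm2 : m ≤ 2) {ν : Measure HalfMinus}
    (h : IsNu k m ν) : ν Set.univ = 1 := by
  have h1 := h 0 Set.univ MeasurableSet.univ
  rw [Set.preimage_univ] at h1
  refine tendsto_nhds_unique h1 (Tendsto.congr' ?_ tendsto_const_nhds)
  filter_upwards [self_mem_nhdsWithin] with s hs
  rw [nuApprox_apply, Set.inter_univ, ENNReal.inv_mul_cancel (mu_shell_ne_zero k hm hm2 hs)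
    (measure_ne_top _ _)]

/-! ### Cylinder sets and uniqueness -/

/-- The sets that depend on finitely many Fourier coefficients. -/
def cylinderSets : Set (Set HalfMinus) :=
  {E | ∃ (N : ℕ) (B : Set (Set.Icc (-(N : ℤ)) (N : ℤ) → ℂ)), MeasurableSet B ∧
    E = lowCoeffs N ⁻¹' B}

theorem exists_lowCoeffs_preimage {N M : ℕ} (h : N ≤ M)
    {B : Set (Set.Icc (-(N : ℤ)) (N : ℤ) → ℂ)} (hB : MeasurableSet B) :
    ∃ B' : Set (Set.Icc (-(M : ℤ)) (M : ℤ) → ℂ), MeasurableSet B' ∧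
      lowCoeffs N ⁻¹' B = lowCoeffs M ⁻¹' B' := by
  have hsub : Set.Icc (-(N : ℤ)) (N : ℤ) ⊆ Set.Icc (-(M : ℤ)) (M : ℤ) :=
    Set.Icc_subset_Icc (by omega) (by omega)
  let r : (Set.Icc (-(M : ℤ)) (M : ℤ) → ℂ) → (Set.Icc (-(N : ℤ)) (N : ℤ) → ℂ) :=
    fun c n => c ⟨n, hsub n.2⟩
  have hr : Measurable r := measurable_pi_lambda _ fun n => measurable_pi_apply _
  exact ⟨r ⁻¹' B, hr hB, rfl⟩

theorem isPiSystem_cylinderSets : IsPiSystem cylinderSets := by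
  rintro _ ⟨N, B, hB, rfl⟩ _ ⟨N', B', hB', rfl⟩ -
  obtain ⟨C, hC, e⟩ := exists_lowCoeffs_preimage (le_max_left N N') hB
  obtain ⟨C', hC', e'⟩ := exists_lowCoeffs_preimage (le_max_right N N') hB'
  exact ⟨max N N', C ∩ C', hC.inter hC', by rw [e, e', Set.preimage_inter]⟩

theorem generateFrom_cylinderSets :
    (inferInstance : MeasurableSpace HalfMinus) = MeasurableSpace.generateFrom cylinderSets := by
  refine le_antisymm ?_ (MeasurableSpace.generateFrom_le ?_)
  · refine Measurable.comap_le ?_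
    refine @measurable_pi_lambda _ _ _ (MeasurableSpace.generateFrom cylinderSets) _ _ fun n => ?_
    intro A hA
    have hn : n ∈ Set.Icc (-(n.natAbs : ℤ)) (n.natAbs : ℤ) := by
      rw [Set.mem_Icc]
      omega
    refine MeasurableSpace.measurableSet_generateFrom
      ⟨n.natAbs, (fun c => c ⟨n, hn⟩) ⁻¹' A, measurable_pi_apply _ hA, rfl⟩
  · rintro _ ⟨N, B, hB, rfl⟩
    exact measurable_lowCoeffs N hB

theorem IsNu.unique {k : ℕ} {m : ℝ} (hm : 0 < m) (hm2 : m ≤ 2) {ν ν' : Measure HalfMinus}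
    (h : IsNu k m ν) (h' : IsNu k m ν') : ν = ν' := by
  have h1 := h.measure_univ hm hm2
  have h2 := h'.measure_univ hm hm2
  have : IsFiniteMeasure ν := ⟨by rw [h1]; exact ENNReal.one_lt_top⟩
  refine ext_of_generate_finite cylinderSets generateFrom_cylinderSets isPiSystem_cylinderSets ?_
    (h1.trans h2.symm)
  rintro _ ⟨N, B, hB, rfl⟩
  exact tendsto_nhds_unique (h N B hB) (h' N B hB)

/-! ### Exponential moments under the fixed-mass measure -/

/-- A Fatou-type argument: setwise convergence gives convergence for simple functions of `f`, and
the integral of `g` is the supremum over simple functions below it. No boundedness of `g` is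
required. -/
theorem lintegral_le_of_tendsto_measure {Ω α ι : Type*} [MeasurableSpace Ω] [MeasurableSpace α]
    {l : Filter ι} [l.NeBot] {μs : ι → Measure Ω} {μ : Measure Ω} {f : Ω → α} (hf : Measurable f)
    (h : ∀ B, MeasurableSet B → Tendsto (fun i => μs i (f ⁻¹' B)) l (𝓝 (μ (f ⁻¹' B))))
    {g : α → ℝ≥0∞} (hg : Measurable g) {c : ι → ℝ≥0∞} {C : ℝ≥0∞}
    (hc : ∀ᶠ i in l, ∫⁻ ω, g (f ω) ∂μs i ≤ c i) (hC : Tendsto c l (𝓝 C)) :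
    ∫⁻ ω, g (f ω) ∂μ ≤ C := by
  -- Finite-valued simple functions are used because multiplication by `∞` does not respect limits
  -- at 0.
  rw [← lintegral_map hg hf, lintegral_eq_nnreal]
  refine iSup₂_le fun φ hφ => ?_
  set ψ := φ.map ((↑) : ℝ≥0 → ℝ≥0∞) with hψ
  have hle : ∀ x, ψ x ≤ g x := hφ
  have hfin : ∀ x ∈ ψ.range, x ≠ ∞ := by
    intro x hx
    obtain ⟨y, rfl⟩ := SimpleFunc.mem_range.1 hx
    exact ENNReal.coe_ne_top
  have hlim : Tendsto (fun i => ψ.lintegral ((μs i).map f)) l (𝓝 (ψ.lintegral (μ.map f))) := by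
    refine tendsto_finsetSum _ fun x hx => ?_
    have hm : MeasurableSet (ψ ⁻¹' {x}) := ψ.measurableSet_preimage _
    simp_rw [Measure.map_apply hf hm]
    exact ENNReal.Tendsto.const_mul (h _ hm) (Or.inr (hfin x hx))
  refine le_of_tendsto_of_tendsto hlim hC ?_
  filter_upwards [hc] with i hi
  refine le_trans ?_ hi
  rw [← lintegral_map hg hf, ← SimpleFunc.lintegral_eq_lintegral]
  exact lintegral_mono hle

/-! ### Reduction of `f_N` to finitely many coefficients -/

theorem exists_trigPoly (N : ℕ) (c : Set.Icc (-(N : ℤ)) (N : ℤ) → ℂ) : ∃ u : HalfMinus,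
    ∀ n, coeff u n = if h : n ∈ Set.Icc (-(N : ℤ)) (N : ℤ) then c ⟨n, h⟩ else 0 := by
  refine exists_coeff_eq _ fun σ _ =>
    summable_of_ne_finset_zero (s := Finset.Icc (-(N : ℤ)) (N : ℤ)) fun n hn => ?_
  rw [dif_neg (by simpa using hn)]
  simp

/-- The trigonometric polynomial with given coefficients. -/
def trigPoly (N : ℕ) (c : Set.Icc (-(N : ℤ)) (N : ℤ) → ℂ) : HalfMinus :=
  (exists_trigPoly N c).choose

theorem coeff_trigPoly (N : ℕ) (c : Set.Icc (-(N : ℤ)) (N : ℤ) → ℂ) (n : ℤ) :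
    coeff (trigPoly N c) n = if h : n ∈ Set.Icc (-(N : ℤ)) (N : ℤ) then c ⟨n, h⟩ else 0 :=
  (exists_trigPoly N c).choose_spec n

theorem measurable_trigPoly (N : ℕ) : Measurable (trigPoly N) := by
  refine measurable_halfMinus fun n => ?_
  simp only [coeff_trigPoly]
  split_ifs with h
  · exact measurable_pi_apply _
  · exact measurable_const

theorem energyTerm_trigPoly (N : ℕ) (u : HalfMinus) :
    energyTerm N (trigPoly N (lowCoeffs N u)) = energyTerm N u := by
  have h : proj Set.univ N (trigPoly N (lowCoeffs N u)) = proj Set.univ N u := by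
    funext x
    rw [proj_eq, proj_eq]
    refine Finset.sum_congr rfl fun n hn => ?_
    have hn' : n ∈ Set.Icc (-(N : ℤ)) (N : ℤ) := by simpa using hn
    rw [Set.indicator_univ, Set.indicator_univ, coeff_trigPoly, dif_pos hn']
    rfl
  simp only [energyTerm, h]

theorem measurable_energyTerm (N : ℕ) : Measurable (energyTerm N) := by
  rw [funext (energyTerm_eq_quadTerm N)]
  exact measurable_quadTerm _ N

theorem lintegral_nuApprox (k : ℕ) (m s : ℝ) (F : HalfMinus → ℝ≥0∞) :
    ∫⁻ u, F u ∂nuApprox k m s = (mu (shell k m s))⁻¹ * ∫⁻ u in shell k m s, F u ∂mu := by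
  rw [nuApprox, ProbabilityTheory.cond, lintegral_smul_measure, smul_eq_mul]

/-- Quotient of the moment bound on the shell by the lower bound for its measure. The widths cancel,
so the bound stays finite as `s` tends to 1. -/
theorem exists_lintegral_isNu_le {p m₀ : ℝ} (hp : 0 ≤ p) (h : IsThreshold (480 * p) m₀)
    (hm₀ : m₀ / 2 < 1) : ∃ C : ℝ, ∀ m : ℝ, 0 < m → m < m₀ / 2 → ∀ k : ℕ,
      ∀ ν : Measure HalfMinus, IsNu k m ν → ∀ N : ℕ,
        ∫⁻ u, ENNReal.ofReal (Real.exp (p * energyTerm N u)) ∂ν ≤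
          ENNReal.ofReal (C * Real.exp m * bracket k ^ (19 / 20 : ℝ) /
            (mu.real (massBall m) * m ^ 2 *
              ∫ y in (m / 2)..m, density k (m - y / bracket k ^ 2))) := by
  obtain ⟨C, hC0, hC⟩ := exists_lintegral_shell_energyTerm_le hp h
  -- The 4 inverts `m²/4` in `mu_shell_ge`, and `exp 1` pays for replacing `exp(2m)` by `exp m`,
  -- since `m < 1`.
  refine ⟨4 * C * Real.exp 1, fun m hm hmm k ν hν N => ?_⟩
  set B := bracket k with hB
  have hB0 : 0 < B := bracket_pos k
  rw [integral_density_eq k hm]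
  set P := massOff k ⁻¹' Set.Ioc (m - m / B ^ 2) (m - m / 2 / B ^ 2) with hP
  have hP0 : 0 < mu.real P := ENNReal.toReal_pos (shell_param_pos k hm) (measure_ne_top _ _)
  have hA0 : 0 < mu.real (massBall m) :=
    ENNReal.toReal_pos (mu_massBall_ne_zero hm) (measure_ne_top _ _)
  have hA1 : mu.real (massBall m) ≤ 1 := measureReal_le_one
  have hPr : mu P = ENNReal.ofReal (mu.real P) := (ofReal_measureReal (measure_ne_top _ _)).symm
  set a : ℝ → ℝ := fun s => (1 / s) ^ 2 * Real.exp (-(2 * (m * s ^ 2))) * (m ^ 2 / 4) with ha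
  have ha0 : ∀ s : ℝ, 1 < s → 0 < a s := fun s hs => by
    have : 0 < 1 / s := one_div_pos.2 (by linarith)
    simp only [ha]
    positivity
  obtain ⟨t1, t2⟩ := tendsto_width
  have hbound : ∀ᶠ s in 𝓝[>] (1 : ℝ),
      ∫⁻ u, ENNReal.ofReal (Real.exp (p * energyTerm N u)) ∂nuApprox k m s ≤
        ENNReal.ofReal (C * B ^ (-(21 / 20) : ℝ) / (a s * mu.real P)) := by
    have hlim : Tendsto (fun s : ℝ => s ^ 2 * m) (𝓝[>] 1) (𝓝 m) := by
      simpa using t1.mul_const m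
    filter_upwards [self_mem_nhdsWithin, hlim.eventually_lt_const (by linarith : m < m₀)]
      with s hs hsm
    have hs' : 1 < s := hs
    have hw := width_pos hs'
    have hge := mu_shell_ge k hm (by linarith) hs'
    rw [hPr, ← ENNReal.ofReal_mul (by positivity)] at hge
    have hap := ha0 s hs'
    rw [lintegral_nuApprox]
    calc _ ≤ (ENNReal.ofReal ((s ^ 2 - (1 / s) ^ 2) * a s * mu.real P))⁻¹ *
          ENNReal.ofReal ((s ^ 2 - (1 / s) ^ 2) * (C * B ^ (-(21 / 20) : ℝ))) :=
          mul_le_mul' (ENNReal.inv_le_inv.2 hge) (hC k N m s hs' hsm)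
      _ = _ := by
          rw [← ENNReal.ofReal_inv_of_pos (by positivity), ← ENNReal.ofReal_mul (by positivity)]
          congr 1
          set w := s ^ 2 - (1 / s) ^ 2
          field_simp
  have hlim : Tendsto (fun s => ENNReal.ofReal (C * B ^ (-(21 / 20) : ℝ) / (a s * mu.real P)))
      (𝓝[>] 1) (𝓝 (ENNReal.ofReal (C * B ^ (-(21 / 20) : ℝ) /
        (1 * Real.exp (-(2 * (m * 1))) * (m ^ 2 / 4) * mu.real P)))) := by
    refine ENNReal.tendsto_ofReal (tendsto_const_nhds.div (Tendsto.mul_const _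
      ((t2.mul ?_).mul_const _)) (by positivity))
    exact (Real.continuous_exp.tendsto _).comp ((t1.const_mul m).const_mul 2).neg
  have hmain := lintegral_le_of_tendsto_measure (measurable_lowCoeffs N) (hν N)
    (g := fun c => ENNReal.ofReal (Real.exp (p * energyTerm N (trigPoly N c))))
    (((measurable_energyTerm N).comp (measurable_trigPoly N)).const_mul p).exp.ennreal_ofReal
    (by simpa only [energyTerm_trigPoly] using hbound) hlim
  simp only [energyTerm_trigPoly] at hmain
  refine hmain.trans (ENNReal.ofReal_le_ofReal ?_)
  have e1 : B ^ (-(21 / 20) : ℝ) = B ^ (19 / 20 : ℝ) / B ^ 2 := by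
    have : (-(21 / 20) : ℝ) = 19 / 20 - (2 : ℕ) := by norm_num
    rw [this, Real.rpow_sub_natCast hB0.ne']
  have e2 : Real.exp (-(2 * (m * 1))) = (Real.exp m * Real.exp m)⁻¹ := by
    rw [← Real.exp_add, ← Real.exp_neg]
    congr 1
    ring
  rw [e1, e2]
  have hR : 0 < B ^ (19 / 20 : ℝ) := Real.rpow_pos_of_pos hB0 _
  have hexp : Real.exp m ≤ Real.exp 1 := Real.exp_le_exp.2 (by linarith)
  calc _ = 4 * C * Real.exp m * Real.exp m * B ^ (19 / 20 : ℝ) /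
        (1 * m ^ 2 * (B ^ 2 * mu.real P)) := by
        field_simp
    -- Besides `exp m ≤ exp 1`, only `mu.real (massBall m) ≤ 1` is used: that factor in the
    -- denominator merely weakens the bound.
    _ ≤ _ := by
        gcongr

end FixedMass

end

theorem theorem1001 (p : ℝ) (hp : 1 ≤ p) :
    (∃ m₀ : ℝ, IsThreshold (480 * p) m₀ ∧ m₀ / 2 < 1) ∧
    ∀ m₀ : ℝ, IsThreshold (480 * p) m₀ → m₀ / 2 < 1 →
      ∃ C : ℝ, ∀ m : ℝ, 0 < m → m < m₀ / 2 → ∀ k : ℕ,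
        (∃! ν : Measure HalfMinus, IsNu k m ν) ∧
        ∀ ν : Measure HalfMinus, IsNu k m ν → ∀ N : ℕ,
          ∫⁻ u, ENNReal.ofReal (Real.exp (p * energyTerm N u)) ∂ν ≤
            ENNReal.ofReal (C * Real.exp m * bracket k ^ (19 / 20 : ℝ) /
              (mu.real (massBall m) * m ^ 2 *
                ∫ y in (m / 2)..m, density k (m - y / bracket k ^ 2))) := by
  refine ⟨exists_isThreshold (by linarith), fun m₀ h hm₀ => ?_⟩
  obtain ⟨C, hC⟩ := exists_lintegral_isNu_le (by linarith) h hm₀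
  refine ⟨C, fun m hm hmm k => ⟨?_, hC m hm hmm k⟩⟩
  have hm2 : m ≤ 2 := by linarith
  exact ⟨_, isNu_sphereMeasure k hm hm2, fun ν hν => hν.unique hm hm2 (isNu_sphereMeasure k hm hm2)⟩
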